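/- **Theorem 1.6 (Extremal case).** All graphs are finite. An *oriented graph* is a digraph without loops in which any two vertices are joined by at most one edge (in one of the two directions); $xy$ denotes the edge from $x$ to $y$. For vertex sets $X,Y$, let $e(X,Y)$ be the number of edges $xy$ with $x\in X$, $y\in Y$, and let $e(X)=e(X,X)$. For $K,\eta>0$, an oriented graph $G$ on $n$ vertices is called *$\eta$-extremal with implied constant $K$* if there are pairwise disjoint (possibly empty) sets $A,B,C,D\subseteq V(G)$ such that $$\bigl||A|+|C|-\tfrac n2\bigr|\le K\eta n,\qquad \bigl||B|-\tfrac n4\bigr|\le K\eta n,\qquad \bigl||D|-\tfrac n4\bigr|\le K\eta n,$$ and - $e(A,B)>|A||B|-K\eta n^2$, $\;e(B,C)>|B||C|-K\eta n^2$, $\;e(C,D)>|C||D|-K\eta n^2$, $\;e(D,A)>|A||D|-K\eta n^2$, - $e(B,D)>|A|n/8-K\eta n^2$, $\;e(D,B)>|C|n/8-K\eta n^2$, - $e(A)>|A|^2/2-K\eta n^2$, $\;e(C)>|C|^2/2-K\eta n^2$, - $e(A,C)<K\eta n^2$, $\;e(D)<K\eta n^2$. Then for every $K>0$ there is $\eta_0>0$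 such that for every $0<\eta\le\eta_0$ there is $n_0$ such that the following holds for every $n\ge n_0$. Let $G$ be an oriented graph on $n$ vertices such that $$\deg^+(x)+\deg^-(y)\ge \frac{3n-3}{4}\qquad\text{for all distinct vertices } x,y \text{ with } xy\notin E(G),$$ and suppose that $G$ is $\eta$-extremal with implied constant $K$. Then $G$ contains a (directed) Hamilton cycle. -/

import Mathlib

namespace Digraph

/-- An oriented graph: a digraph with no loops and no 2-cycles
(taking `x = y` shows that there are no loops). -/
def IsOriented {V : Type*} (G : Digraph V) : Prop :=
  ∀ x y : V, G.Adj x y → ¬ G.Adj y x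

open Classical in
/-- The outdegree of `x`: the number of `y` such that `xy` is an edge. -/
noncomputable def outDeg {V : Type*} [Fintype V] (G : Digraph V) (x : V) : ℕ :=
  (Finset.univ.filter fun y => G.Adj x y).card

open Classical in
/-- The indegree of `y`: the number of `x` such that `xy` is an edge. -/
noncomputable def inDeg {V : Type*} [Fintype V] (G : Digraph V) (y : V) : ℕ :=
  (Finset.univ.filter fun x => G.Adj x y).card

open Classical in
/-- `e(X, Y)`: the number of edges `xy` with `x ∈ X` and `y ∈ Y`.
The number `e(X)` of edges inside `X` is `G.edgeCount X X`. -/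
noncomputable def edgeCount {V : Type*} (G : Digraph V) (X Y : Finset V) : ℕ :=
  ((X ×ˢ Y).filter fun p => G.Adj p.1 p.2).card

/-- The Ore-degree condition: `deg⁺(x) + deg⁻(y) ≥ (3n - 3) / 4` for all distinct vertices
`x`, `y` such that `xy` is not an edge, where `n` is the number of vertices. -/
def OreCondition {V : Type*} [Fintype V] (G : Digraph V) : Prop :=
  ∀ x y : V, x ≠ y → ¬ G.Adj x y →
    (3 * (Fintype.card V : ℝ) - 3) / 4 ≤ (G.outDeg x : ℝ) + (G.inDeg y : ℝ)

/-- `G` is `η`-extremal, with `K` as the constant implied by every occurrence of `O(η)`: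
there are pairwise disjoint vertex sets `A`, `B`, `C`, `D` (not necessarily covering all
vertices; `A` or `C` may be empty) with the sizes and edge counts of the extremal construction
up to an error of `K η n` for sizes and `K η n²` for edge counts. -/
def IsExtremal {V : Type*} [Fintype V] (G : Digraph V) (K η : ℝ) : Prop :=
  ∃ A B C D : Finset V,
    (Disjoint A B ∧ Disjoint A C ∧ Disjoint A D ∧
      Disjoint B C ∧ Disjoint B D ∧ Disjoint C D) ∧
    (let n : ℝ := (Fintype.card V : ℝ)
     let a : ℝ := (A.card : ℝ)
     let b : ℝ := (B.card : ℝ)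
     let c : ℝ := (C.card : ℝ)
     let d : ℝ := (D.card : ℝ)
     |(a + c) - n / 2| ≤ K * η * n ∧
     |b - n / 4| ≤ K * η * n ∧
     |d - n / 4| ≤ K * η * n ∧
     (G.edgeCount A B : ℝ) > a * b - K * η * n ^ 2 ∧
     (G.edgeCount B C : ℝ) > b * c - K * η * n ^ 2 ∧
     (G.edgeCount C D : ℝ) > c * d - K * η * n ^ 2 ∧
     (G.edgeCount D A : ℝ) > a * d - K * η * n ^ 2 ∧
     (G.edgeCount B D : ℝ) > a * n / 8 - K * η * n ^ 2 ∧
     (G.edgeCount D B : ℝ) > c * n / 8 - K * η * n ^ 2 ∧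
     (G.edgeCount A A : ℝ) > a ^ 2 / 2 - K * η * n ^ 2 ∧
     (G.edgeCount C C : ℝ) > c ^ 2 / 2 - K * η * n ^ 2 ∧
     (G.edgeCount A C : ℝ) < K * η * n ^ 2 ∧
     (G.edgeCount D D : ℝ) < K * η * n ^ 2)

/-- `G` contains a directed Hamilton cycle: with `n` the number of vertices, the vertices can be
enumerated bijectively by `ℤ/nℤ` so that each one sends an edge to its cyclic successor. -/
def HasHamiltonCycle {V : Type*} [Fintype V] (G : Digraph V) : Prop :=
  ∃ v : ZMod (Fintype.card V) → V, Function.Bijective v ∧ ∀ i, G.Adj (v i) (v (i + 1))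

end Digraph

/-! In the extremal configuration the useful edges run along AA, AB, DA, DB, BC, BD, CC and CD. Let
the out-type set `P` consist of A and D, and the in-type set `Q` of A and B. The pairs listed are
exactly those `xy` with `x ∈ P ↔ y ∈ Q`; call such edges neutral. The successor map of a Hamilton
cycle of neutral edges carries `P` onto `Q`, so `|P| = |Q|` is necessary, and on the four classes
this says `|B| = |D|`. This parity-like condition is the essential obstruction.

If `|P| = |Q|`, a cycle is assembled from paths (`hasHamiltonCycle_of_blowup`). The few exceptional
vertices and prescribed edges are put on short paths from A to A. Counting types along these paths
shows that what is left of B and D has equal size. The rest of B, C, D is covered by `|B|` paths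
from B to D (`exists_units`): C is cut into paths entered from B and left to D, and the surplus of B
over C is matched directly into D. The rest of A is cut into just enough paths
(`exists_path_partition`) to have as many A-paths as B-D-paths. The pairs AB and DA are nearly
complete, so the two families are joined by a perfect matching (`exists_join`) and the results are
closed to a cycle (`hasHamiltonCycle_of_segs`).

To reach `|P| = |Q|`, the vertices outside the four classes first receive types according to where
many of their neighbours lie (`Frame.exists_typing`); this uses the linear semidegrees forced by the
Ore condition (`IsExtremal.inDeg_lower`). Up to reversal `|P| ≥ |Q|`. A vertex of `P` with many
out-neighbours in C ∪ D may leave `P`, and a vertex outside `Q` with many in-neighbours in A ∪ D may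
enter `Q`; each move lowers the surplus by one. So does an edge from `P` to the complement of `Q`
whose tail is removed from `P`, which makes that edge neutral. That enough such disjoint edges exist
is `exists_balancing_edges`, the heart of the argument and the place where the exact value `(3n - 3)
/ 4` matters: without them, the Ore inequalities summed over D and over suitable pairs starting in A
are contradictory.

The passage from edge counts to this clean structure (`Frame`) deletes vertices of atypical degree.
When C is tiny it is discarded and BD is nearly complete; otherwise the error scales are chosen far
below `|C|`. -/

namespace Digraph

/-! ### Counting in lists, matchings and Hamilton cycles of almost complete relations -/

section Lists

open Classical

/-- The number of entries of `l` with the property `q`. -/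
noncomputable def lcount {α : Type*} (q : α → Prop) (l : List α) : ℕ := l.countP (fun a => q a)

/-- The elements of `S` with the property `q`. -/
noncomputable def sel {α : Type*} (S : Finset α) (q : α → Prop) : Finset α := S.filter q

/-- The number of elements of `S` with the property `q`. -/
noncomputable def fcount {α : Type*} (S : Finset α) (q : α → Prop) : ℕ := (sel S q).card

lemma mem_sel {α : Type*} {S : Finset α} {q : α → Prop} {x : α} : x ∈ sel S q ↔ x ∈ S ∧ q x :=
  Finset.mem_filter

lemma sel_subset {α : Type*} (S : Finset α) (q : α → Prop) : sel S q ⊆ S :=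
  Finset.filter_subset _ _

lemma lcount_nil {α : Type*} (q : α → Prop) : lcount q [] = 0 := rfl

lemma lcount_cons {α : Type*} (q : α → Prop) (a : α) (l : List α) :
    lcount q (a :: l) = lcount q l + if q a then 1 else 0 := by
  unfold lcount
  rw [List.countP_cons]
  simp

lemma lcount_append {α : Type*} (q : α → Prop) (l l' : List α) :
    lcount q (l ++ l') = lcount q l + lcount q l' := List.countP_append

lemma lcount_perm {α : Type*} (q : α → Prop) {l l' : List α} (h : l.Perm l') :
    lcount q l = lcount q l' := h.countP_eq _

lemma lcount_add_not {α : Type*} (q : α → Prop) (l : List α) :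
    lcount q l + lcount (fun a => ¬ q a) l = l.length := by
  induction l with
  | nil => rfl
  | cons a l ih =>
    rw [lcount_cons, lcount_cons, List.length_cons]
    by_cases h : q a <;> simp [h] <;> omega

lemma lcount_le_length {α : Type*} (q : α → Prop) (l : List α) : lcount q l ≤ l.length :=
  List.countP_le_length

lemma lcount_eq_length_filter {α : Type*} (q : α → Prop) (l : List α) :
    lcount q l = (l.filter (fun a => q a)).length := List.countP_eq_length_filter

lemma exists_filter {α : Type*} (q : α → Prop) (l : List α) :
    ∃ F : List α, F.length = lcount q l ∧ ∀ y, y ∈ F ↔ y ∈ l ∧ q y :=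
  ⟨l.filter (fun a => q a), (lcount_eq_length_filter q l).symm, by simp⟩

lemma lcount_mono {α : Type*} (q : α → Prop) {l l' : List α} (hl : l.Nodup) (h : l ⊆ l') :
    lcount q l ≤ lcount q l' := (hl.subperm h).countP_le _

lemma fcount_mono {α : Type*} {S S' : Finset α} (h : S ⊆ S') (q : α → Prop) :
    fcount S q ≤ fcount S' q := Finset.card_le_card (Finset.filter_subset_filter _ h)

lemma fcount_le_card {α : Type*} (S : Finset α) (q : α → Prop) : fcount S q ≤ S.card :=
  Finset.card_filter_le _ _

lemma fcount_add_not {α : Type*} (S : Finset α) (q : α → Prop) :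
    fcount S q + fcount S (fun a => ¬ q a) = S.card :=
  by
  unfold fcount sel
  rw [← Finset.card_filter_add_card_filter_not (s := S) q]
  congr!

lemma mem_of_fcount_pos {α : Type*} {S : Finset α} {q : α → Prop} (h : 0 < fcount S q) :
    ∃ x ∈ S, q x := by
  obtain ⟨x, hx⟩ := Finset.card_pos.1 h
  exact ⟨x, mem_sel.1 hx⟩

lemma card_sel {α : Type*} (S : Finset α) (q : α → Prop) : (sel S q).card = fcount S q := rfl

lemma fcount_toFinset {α : Type*} {X : List α} (hX : X.Nodup) (q : α → Prop) :
    fcount X.toFinset q = lcount q X := by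
  unfold fcount sel
  rw [lcount_eq_length_filter, ← List.toFinset_card_of_nodup (hX.filter _)]
  congr 1
  ext x
  simp

lemma lcount_toList {α : Type*} (S : Finset α) (q : α → Prop) :
    lcount q S.toList = fcount S q := by
  rw [← fcount_toFinset S.nodup_toList, Finset.toList_toFinset]

/-- A property of the members of a family of disjoint lists that forces them to meet `F`
holds for at most `F.card` of them. -/
lemma countP_le_card {V : Type*} (X : List (List V)) (hX : X.flatten.Nodup)
    (q : List V → Prop) (F : Finset V) (h : ∀ p ∈ X, q p → ∃ y ∈ p, y ∈ F) :
    lcount q X ≤ F.card := by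
  induction X generalizing F with
  | nil => simp [lcount_nil]
  | cons p X ih =>
    rw [List.flatten_cons, List.nodup_append] at hX
    obtain ⟨_, hX2, hd⟩ := hX
    rw [lcount_cons]
    by_cases hq : q p
    · obtain ⟨y, hyp, hyF⟩ := h p (by simp) hq
      have h1 := ih hX2 (F.erase y) (fun p' hp' hq' => by
        obtain ⟨z, hz, hzF⟩ := h p' (by simp [hp']) hq'
        refine ⟨z, hz, Finset.mem_erase.2 ⟨?_, hzF⟩⟩
        rintro rfl
        exact hd z hyp z (List.mem_flatten.2 ⟨p', hp', hz⟩) rfl)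
      rw [Finset.card_erase_of_mem hyF] at h1
      have := Finset.card_pos.2 ⟨y, hyF⟩
      rw [if_pos hq]
      omega
    · have h1 := ih hX2 F (fun p' hp' hq' => h p' (by simp [hp']) hq')
      simpa [hq] using h1

/-- A bipartite relation between two lists of the same length in which every element misses at
most half of the other side contains a perfect matching. -/
lemma exists_perfect_matching {α β : Type*} (X : List α) (Y : List β) (hX : X.Nodup)
    (hY : Y.Nodup) (hXY : X.length = Y.length) (r : α → β → Prop) (m : ℕ)
    (h1 : ∀ x ∈ X, lcount (fun y => ¬ r x y) Y ≤ m)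
    (h2 : ∀ y ∈ Y, lcount (fun x => ¬ r x y) X ≤ m) (hm : 2 * m ≤ X.length) :
    ∃ W : List (α × β), (W.map Prod.fst).Perm X ∧ (W.map Prod.snd).Perm Y ∧
      ∀ w ∈ W, r w.1 w.2 := by
  let t : {x // x ∈ X} → Finset β := fun x => Y.toFinset.filter (fun y => r x y)
  have hall : ∀ s : Finset {x // x ∈ X}, s.card ≤ (s.biUnion t).card := by
    intro s
    rcases s.eq_empty_or_nonempty with rfl | ⟨x, hx⟩
    · simp
    have hs : s.card ≤ X.length := by
      rw [← List.toFinset_card_of_nodup hX, ← Finset.card_map (Function.Embedding.subtype _)]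
      apply Finset.card_le_card
      intro z hz
      obtain ⟨z', -, rfl⟩ := Finset.mem_map.1 hz
      exact List.mem_toFinset.2 z'.2
    -- Hall's condition: a small `s` is dominated by the neighbourhood of a single element; a larger
    -- one has more than `m` elements, since `2 * m ≤ |X|`, and so every `y` has a neighbour in it.
    by_cases hc : s.card ≤ Y.length - m
    · have ht : Y.length - m ≤ (t x).card := by
        have e1 := fcount_toFinset hY (fun y => r x y)
        have e2 := h1 x x.2
        have e3 := lcount_add_not (fun y => r x y) Y
        have : (t x).card = lcount (fun y => r x y) Y := e1
        rw [this]
        omega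
      exact (hc.trans ht).trans (Finset.card_le_card (Finset.subset_biUnion_of_mem t hx))
    · have : Y.toFinset ⊆ s.biUnion t := by
        intro y hy
        by_contra hny
        have hy' := List.mem_toFinset.1 hy
        have hb : s.card ≤ lcount (fun x => ¬ r x y) X := by
          rw [← fcount_toFinset hX, fcount, sel, ← Finset.card_map (Function.Embedding.subtype _)]
          apply Finset.card_le_card
          intro z hz
          obtain ⟨z', hz', rfl⟩ := Finset.mem_map.1 hz
          simp only [Finset.mem_filter, List.mem_toFinset]
          refine ⟨z'.2, fun hr => hny ?_⟩
          exact Finset.mem_biUnion.2 ⟨z', hz', by simp only [t, Finset.mem_filter]; exact ⟨hy, hr⟩⟩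
        have := h2 y hy'
        omega
      have h3 := Finset.card_le_card this
      rw [List.toFinset_card_of_nodup hY] at h3
      omega
  obtain ⟨f, hf, hft⟩ := (Finset.all_card_le_biUnion_card_iff_exists_injective t).1 hall
  refine ⟨X.attach.map (fun x => (x.1, f x)), ?_, ?_, ?_⟩
  · simp [List.map_map, Function.comp_def]
  · rw [List.map_map]
    have hn : (X.attach.map (Prod.snd ∘ fun x => (x.1, f x))).Nodup :=
      (List.nodup_attach.2 hX).map hf
    have hsub : X.attach.map (Prod.snd ∘ fun x => (x.1, f x)) ⊆ Y := by
      intro y hy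
      obtain ⟨x, _, rfl⟩ := List.mem_map.1 hy
      have := hft x
      simp only [t, Finset.mem_filter, List.mem_toFinset] at this
      exact this.1
    exact (hn.subperm hsub).perm_of_length_le (by simp [hXY])
  · intro w hw
    obtain ⟨x, _, rfl⟩ := List.mem_map.1 hw
    have := hft x
    simp only [t, Finset.mem_filter, List.mem_toFinset] at this
    exact this.2

lemma exists_insertion {α : Type*} (r : α → α → Prop) (x : α) (Q : List α)
    (h : lcount (fun q => ¬ r q x) Q.dropLast + lcount (fun q => ¬ r x q) Q.tail + 1 < Q.length) :
    ∃ Q₁ Q₂ : List α, Q = Q₁ ++ Q₂ ∧ Q₁ ≠ [] ∧ Q₂ ≠ [] ∧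
      (∀ a ∈ Q₁.getLast?, r a x) ∧ (∀ b ∈ Q₂.head?, r x b) := by
  induction Q with
  | nil => simp at h
  | cons q T ih =>
    cases T with
    | nil => simp at h
    | cons q' T =>
      by_cases hq : r q x ∧ r x q'
      · exact ⟨[q], q' :: T, by simp, by simp, by simp, by simpa using hq.1, by simpa using hq.2⟩
      · obtain ⟨Q₁, Q₂, e, n1, n2, a1, a2⟩ := ih (by
          rw [List.dropLast_cons_cons, List.tail_cons, lcount_cons, lcount_cons] at h
          rw [List.tail_cons]
          simp only [List.length_cons] at h ⊢
          by_cases h1 : r q x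
          · have h2 : ¬ r x q' := fun h2 => hq ⟨h1, h2⟩
            simp only [h1, h2, not_true_eq_false, if_false, not_false_eq_true, if_true] at h
            omega
          · simp only [h1, not_false_eq_true, if_true] at h
            omega)
        refine ⟨q :: Q₁, Q₂, by simp [e], by simp, n2, ?_, a2⟩
        intro a ha
        rw [List.getLast?_cons_of_ne_nil n1] at ha
        exact a1 a ha

lemma isChain_insert {α : Type*} {r : α → α → Prop} {x : α} {Q₁ Q₂ : List α}
    (hQ : (Q₁ ++ Q₂).IsChain r)
    (h1 : ∀ a ∈ Q₁.getLast?, r a x) (h2 : ∀ b ∈ Q₂.head?, r x b) :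
    (Q₁ ++ x :: Q₂).IsChain r := by
  rw [List.isChain_append] at hQ ⊢
  refine ⟨hQ.1, ?_, by simpa using h1⟩
  rw [List.isChain_cons]
  exact ⟨h2, hQ.2.1⟩

/-- A relation on a list in which every element misses few others in both directions has a
Hamilton cycle. -/
lemma exists_closed_chain {α : Type*} (r : α → α → Prop) (W : List α) (hW : W.Nodup) (m : ℕ)
    (h1 : ∀ w ∈ W, lcount (fun v => ¬ r w v) W ≤ m)
    (h2 : ∀ w ∈ W, lcount (fun v => ¬ r v w) W ≤ m) (hm : 4 * m + 3 ≤ W.length) :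
    ∃ (h : α) (T : List α), (h :: T).Perm W ∧ (h :: T ++ [h]).IsChain r := by
  have cnt : ∀ (q : α → Prop) (P : List α), P.Nodup → P ⊆ W → lcount q P ≤ lcount q W :=
    fun q P hP hPW => lcount_mono q hP hPW
  -- a path with `L + 1` vertices
  have path : ∀ L : ℕ, L ≤ 2 * m → ∃ P : List α, P.length = L + 1 ∧ P.Nodup ∧ P ⊆ W ∧
      P.IsChain r := by
    intro L
    induction L with
    | zero =>
      intro _
      obtain ⟨w, hw⟩ := List.exists_mem_of_length_pos (l := W) (by omega)
      exact ⟨[w], by simp, by simp, by simpa using hw, by simp⟩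
    | succ L ih =>
      intro hL
      obtain ⟨P, hl, hn, hs, hc⟩ := ih (by omega)
      have hne : P ≠ [] := by rintro rfl; simp at hl
      have : ∃ y ∈ W, y ∉ P ∧ r (P.getLast hne) y := by
        by_contra hcon
        push Not at hcon
        have e1 := h1 _ (hs (List.getLast_mem hne))
        obtain ⟨F, hF, hF'⟩ := exists_filter (fun v => ¬ r (P.getLast hne) v) W
        have e2 : W ⊆ P ++ F := by
          intro y hy
          by_cases hyP : y ∈ P
          · simp [hyP]
          · simp [hF', hy, hcon y hy hyP]
        have e3 := (hW.subperm e2).length_le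
        simp only [List.length_append] at e3
        omega
      obtain ⟨y, hyW, hyP, hr⟩ := this
      refine ⟨P ++ [y], by simp [hl], ?_, ?_, ?_⟩
      · rw [List.nodup_append]
        refine ⟨hn, by simp, ?_⟩
        rintro a ha b hb rfl
        simp only [List.mem_singleton] at hb
        exact hyP (hb ▸ ha)
      · intro z hz
        rcases List.mem_append.1 hz with hz | hz
        · exact hs hz
        · rw [List.mem_singleton.1 hz]; exact hyW
      · rw [List.isChain_append]
        refine ⟨hc, by simp, ?_⟩
        intro a ha b hb
        rw [List.getLast?_eq_some_getLast hne] at ha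
        simp only [Option.mem_def, Option.some.injEq, List.head?_cons] at ha hb
        rw [← ha, ← hb]; exact hr
  -- close it to a cycle
  have base : ∃ (h : α) (T : List α), 2 * m + 1 ≤ T.length ∧ (h :: T).Nodup ∧ h :: T ⊆ W ∧
      (h :: T ++ [h]).IsChain r := by
    obtain ⟨P, hl, hn, hs, hc⟩ := path (2 * m) le_rfl
    have hne : P ≠ [] := by rintro rfl; simp at hl
    -- The path has `2 * m + 1` elements and at most `2 * m` others fail one of the relations. The
    -- resulting cycle of `2 * m + 2` elements is long enough for every later insertion.
    have : ∃ y ∈ W, y ∉ P ∧ r (P.getLast hne) y ∧ r y (P.head hne) := by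
      by_contra hcon
      push Not at hcon
      have e1 := h1 _ (hs (List.getLast_mem hne))
      have e1' := h2 _ (hs (List.head_mem hne))
      obtain ⟨F, hF, hF'⟩ := exists_filter (fun v => ¬ r (P.getLast hne) v) W
      obtain ⟨E, hE, hE'⟩ := exists_filter (fun v => ¬ r v (P.head hne)) W
      have e2 : W ⊆ P ++ (F ++ E) := by
        intro y hy
        by_cases hyP : y ∈ P
        · simp [hyP]
        · by_cases hr : r (P.getLast hne) y
          · simp [hE', hy, hcon y hy hyP hr]
          · simp [hF', hy, hr]
      have e3 := (hW.subperm e2).length_le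
      simp only [List.length_append] at e3
      omega
    obtain ⟨y, hyW, hyP, hr, hr'⟩ := this
    refine ⟨y, P, by omega, List.nodup_cons.2 ⟨hyP, hn⟩, List.cons_subset.2 ⟨hyW, hs⟩, ?_⟩
    rw [List.cons_append, List.isChain_cons, List.isChain_append]
    refine ⟨?_, hc, by simp, ?_⟩
    · rw [List.head?_append_of_ne_nil _ hne, List.head?_eq_some_head hne]
      simpa using hr'
    · rw [List.getLast?_eq_some_getLast hne]
      simpa using hr
  obtain ⟨h, T, hT, hn, hs, hc⟩ := base
  -- insert the remaining elements one by one
  have ins : ∀ (R T : List α), 2 * m + 1 ≤ T.length → (h :: T ++ R).Perm W →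
      (h :: T ++ [h]).IsChain r →
      ∃ T' : List α, (h :: T').Perm W ∧ (h :: T' ++ [h]).IsChain r := by
    intro R
    induction R with
    | nil => intro T _ hp hc; exact ⟨T, by simpa using hp, hc⟩
    | cons x R ih =>
      intro T hT hp hc
      have hnd : (h :: T ++ x :: R).Nodup := hp.nodup_iff.2 hW
      have hsub : ∀ z ∈ h :: T ++ x :: R, z ∈ W := fun z hz => hp.mem_iff.1 hz
      have hxW : x ∈ W := hsub x (by simp)
      have hTn : (h :: T).Nodup := hnd.of_append_left
      have hTs : h :: T ⊆ W := fun z hz => hsub z (List.mem_append_left _ hz)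
      have c1 := (cnt (fun q => ¬ r q x) _ hTn hTs).trans (h2 x hxW)
      have c2 := (cnt (fun q => ¬ r x q) _ hTn hTs).trans (h1 x hxW)
      have c3 : lcount (fun q => ¬ r x q) (T ++ [h]) = lcount (fun q => ¬ r x q) (h :: T) :=
        lcount_perm _ (List.perm_append_singleton h T)
      obtain ⟨Q₁, Q₂, e, n1, n2, a1, a2⟩ := exists_insertion r x (h :: T ++ [h]) (by
        rw [List.dropLast_concat]
        simp only [List.cons_append, List.tail_cons, List.length_cons, List.length_append,
          List.length_nil]
        rw [c3]
        omega)
      obtain ⟨h', Q₁', rfl⟩ := List.exists_cons_of_ne_nil n1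
      have hQ2 := (List.dropLast_append_getLast n2).symm
      set Q₂' := Q₂.dropLast
      rw [hQ2] at e
      have e' : h :: T ++ [h] = (h' :: Q₁' ++ Q₂') ++ [Q₂.getLast n2] := by rw [e]; simp
      obtain ⟨e1, e2⟩ := List.append_inj' e' rfl
      simp only [List.cons_append, List.cons.injEq] at e1 e2
      obtain ⟨rfl, rfl⟩ := e1
      have e3 : Q₂ = Q₂' ++ [h] := by rw [hQ2, ← e2.1]
      refine ih (Q₁' ++ x :: Q₂') ?_ ?_ ?_
      · simp only [List.length_append, List.length_cons] at hT ⊢; omega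
      · refine List.Perm.trans ?_ hp
        simp only [List.cons_append]
        refine List.Perm.cons _ ?_
        rw [List.append_assoc, List.append_assoc]
        refine List.Perm.append_left _ ?_
        simpa using (List.perm_middle (a := x) (l₁ := Q₂') (l₂ := R)).symm
      · have := isChain_insert (x := x) (Q₁ := h :: Q₁') (Q₂ := Q₂) (by
          rw [e3]; simpa using hc) a1 a2
        rw [e3] at this
        simpa using this
  obtain ⟨T', hp', hc'⟩ := ins (W.filter (fun w => w ∉ h :: T)) T hT (by
    rw [List.perm_ext_iff_of_nodup _ hW]
    · intro a
      simp only [List.mem_append, List.mem_filter, decide_eq_true_eq]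
      constructor
      · rintro (ha | ha)
        · exact hs ha
        · exact ha.1
      · intro ha
        by_cases h : a ∈ h :: T
        · exact Or.inl h
        · exact Or.inr ⟨ha, h⟩
    · rw [List.nodup_append]
      refine ⟨hn, hW.filter _, ?_⟩
      rintro a ha b hb rfl
      simp only [List.mem_filter, decide_eq_true_eq] at hb
      exact hb.2 ha) hc
  exact ⟨h, T', hp', hc'⟩

lemma hasHamiltonCycle_of_list {V : Type*} [Fintype V] (G : Digraph V) (h : V) (T : List V)
    (hn : (h :: T).Nodup) (hc : ∀ v, v ∈ h :: T) (hch : (h :: T ++ [h]).IsChain G.Adj) :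
    G.HasHamiltonCycle := by
  have hlen : (h :: T).length = Fintype.card V := by
    rw [← List.toFinset_card_of_nodup hn, ← Finset.card_univ]
    congr 1
    ext v
    simpa using hc v
  unfold HasHamiltonCycle
  rw [← hlen]
  have hch' := List.isChain_iff_getElem.1 hch
  -- The length is a successor, so `ZMod` of it reduces to `Fin (T.length + 1)`. Only the last index
  -- wraps around, and there the closing entry `h` of the chain is used.
  let v : Fin (T.length + 1) → V := fun i => (h :: T)[i.val]'(by simpa using i.2)
  have hinj : Function.Injective v := fun i j hij =>
    Fin.ext ((List.Nodup.getElem_inj_iff hn).1 hij)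
  have hadj : ∀ i : Fin (T.length + 1), G.Adj (v i) (v (i + 1)) := by
    intro i
    have h1 := hch' i.val (by simp; omega)
    by_cases hi : i = Fin.last _
    · subst hi
      have h2 : v (Fin.last T.length + 1) = h := by simp [v]
      rw [h2]
      simp only [Fin.val_last] at h1
      have h3 : (h :: T ++ [h])[T.length + 1]'(by simp) = h := by simp
      have h4 : (h :: T ++ [h])[T.length]'(by simp) = (h :: T)[T.length]'(by simp) :=
        List.getElem_append_left (by simp)
      rw [h3, h4] at h1
      exact h1
    · have hlt : i.val < T.length := by
        have := i.2
        have : i.val ≠ T.length := fun h => hi (Fin.ext h)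
        omega
      have hv : (i + 1).val = i.val + 1 := Fin.val_add_one_of_lt (Fin.lt_last_iff_ne_last.2 hi)
      simp only [v, hv]
      rw [List.getElem_append_left (by simp; omega), List.getElem_append_left (by simpa using hlt)] at h1
      exact h1
  refine ⟨v, ⟨hinj, ?_⟩, hadj⟩
  intro x
  obtain ⟨i, hi, rfl⟩ := List.getElem_of_mem (hc x)
  exact ⟨⟨i, by simpa using hi⟩, rfl⟩

end Lists

end Digraph

namespace Digraph

/-! ### Families of disjoint paths: joining, closing, partitioning -/

section Segments

open Classical

variable {V : Type*}

/-- Every vertex of `X` sends edges to all but at most `m` vertices of `Y`, and every vertex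
of `Y` receives edges from all but at most `m` vertices of `X`. -/
def Near (H : Digraph V) (X Y : Finset V) (m : ℕ) : Prop :=
  (∀ x ∈ X, fcount Y (fun y => ¬ H.Adj x y) ≤ m) ∧ ∀ y ∈ Y, fcount X (fun x => ¬ H.Adj x y) ≤ m

lemma Near.mono {H : Digraph V} {X Y X' Y' : Finset V} {m : ℕ} (h : H.Near X Y m)
    (hX : X' ⊆ X) (hY : Y' ⊆ Y) : H.Near X' Y' m :=
  ⟨fun x hx => (fcount_mono hY _).trans (h.1 x (hX hx)),
    fun y hy => (fcount_mono hX _).trans (h.2 y (hY hy))⟩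

/-- The last vertex of `p` sends an edge to the first vertex of `q`. -/
def Link (H : Digraph V) (p q : List V) : Prop :=
  ∀ x ∈ p.getLast?, ∀ y ∈ q.head?, H.Adj x y

/-- `p` is a nonempty path of `H` from `S` to `T`. -/
def IsSeg (H : Digraph V) (S T : Finset V) (p : List V) : Prop :=
  p.IsChain H.Adj ∧ (∃ x ∈ p.head?, x ∈ S) ∧ ∃ x ∈ p.getLast?, x ∈ T

lemma IsSeg.ne_nil {H : Digraph V} {S T : Finset V} {p : List V} (h : H.IsSeg S T p) :
    p ≠ [] := by
  rintro rfl
  obtain ⟨_, ⟨x, hx, _⟩, _⟩ := h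
  simp at hx

lemma isSeg_singleton {H : Digraph V} {S T : Finset V} {x : V} (h : x ∈ S) (h' : x ∈ T) :
    H.IsSeg S T [x] := ⟨by simp, ⟨x, by simp, h⟩, ⟨x, by simp, h'⟩⟩

lemma IsSeg.append {H : Digraph V} {S T S' T' : Finset V} {p q : List V} (hp : H.IsSeg S T p)
    (hq : H.IsSeg S' T' q) (h : H.Link p q) : H.IsSeg S T' (p ++ q) := by
  refine ⟨List.isChain_append.2 ⟨hp.1, hq.1, h⟩, ?_, ?_⟩
  · rw [List.head?_append_of_ne_nil _ hp.ne_nil]; exact hp.2.1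
  · rw [List.getLast?_append_of_ne_nil _ hq.ne_nil]; exact hq.2.2

lemma IsSeg.mono {H : Digraph V} {S T S' T' : Finset V} {p : List V} (hp : H.IsSeg S T p)
    (hS : S ⊆ S') (hT : T ⊆ T') : H.IsSeg S' T' p := by
  obtain ⟨h, ⟨x, hx, hx'⟩, ⟨y, hy, hy'⟩⟩ := hp
  exact ⟨h, ⟨x, hx, hS hx'⟩, ⟨y, hy, hT hy'⟩⟩

lemma nodup_of_flatten {X : List (List V)} (hX : X.flatten.Nodup) (hne : ∀ p ∈ X, p ≠ []) :
    X.Nodup := by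
  induction X with
  | nil => simp
  | cons p X ih =>
    rw [List.flatten_cons, List.nodup_append] at hX
    refine List.nodup_cons.2 ⟨fun hp => ?_, ih hX.2.1 fun q hq => hne q (by simp [hq])⟩
    obtain ⟨x, hx⟩ := List.exists_mem_of_ne_nil p (hne p (by simp))
    exact hX.2.2 x hx x (List.mem_flatten.2 ⟨p, hp, hx⟩) rfl

/-- In a family of disjoint paths ending in `T`, at most `m` fail to link to a path starting
in `S`, if `T` and `S` are nearly complete. -/
lemma lcount_not_link_left {H : Digraph V} {X : List (List V)} (hX : X.flatten.Nodup)
    {S T S' T' : Finset V} (hs : ∀ p ∈ X, H.IsSeg S T p) {m : ℕ} (hm : H.Near T S' m)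
    {q : List V} (hq : H.IsSeg S' T' q) : lcount (fun p => ¬ H.Link p q) X ≤ m := by
  obtain ⟨_, ⟨y, hy, hyS⟩, _⟩ := hq
  refine (countP_le_card X hX _ (sel T (fun x => ¬ H.Adj x y)) ?_).trans (hm.2 y hyS)
  intro p hp hl
  obtain ⟨_, _, ⟨x, hx, hxT⟩⟩ := hs p hp
  refine ⟨x, List.mem_of_getLast? hx, mem_sel.2 ⟨hxT, fun ha => hl ?_⟩⟩
  intro x' hx' y' hy'
  rw [Option.mem_def] at *
  rw [hx] at hx'
  rw [hy] at hy'
  cases hx'; cases hy'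
  exact ha

lemma lcount_not_link_right {H : Digraph V} {X : List (List V)} (hX : X.flatten.Nodup)
    {S T S' T' : Finset V} (hs : ∀ p ∈ X, H.IsSeg S T p) {m : ℕ} (hm : H.Near T' S m)
    {q : List V} (hq : H.IsSeg S' T' q) : lcount (fun p => ¬ H.Link q p) X ≤ m := by
  obtain ⟨_, _, ⟨y, hy, hyS⟩⟩ := hq
  refine (countP_le_card X hX _ (sel S (fun x => ¬ H.Adj y x)) ?_).trans (hm.1 y hyS)
  intro p hp hl
  obtain ⟨_, ⟨x, hx, hxT⟩, _⟩ := hs p hp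
  refine ⟨x, List.mem_of_head? hx, mem_sel.2 ⟨hxT, fun ha => hl ?_⟩⟩
  intro x' hx' y' hy'
  rw [Option.mem_def] at *
  rw [hx] at hy'
  rw [hy] at hx'
  cases hx'; cases hy'
  exact ha

lemma flatten_map_append {α : Type*} (W : List (List α × List α)) :
    (W.map (fun w => w.1 ++ w.2)).flatten.Perm
      ((W.map Prod.fst).flatten ++ (W.map Prod.snd).flatten) := by
  induction W with
  | nil => simp
  | cons w W ih =>
    simp only [List.map_cons, List.flatten_cons]
    calc w.1 ++ w.2 ++ (W.map (fun w => w.1 ++ w.2)).flatten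
        |>.Perm (w.1 ++ w.2 ++ ((W.map Prod.fst).flatten ++ (W.map Prod.snd).flatten)) :=
          ih.append_left _
      _ |>.Perm _ := by
          simp only [List.append_assoc]
          refine List.Perm.append_left _ ?_
          rw [← List.append_assoc, ← List.append_assoc]
          exact List.Perm.append_right _ List.perm_append_comm

/-- Two families of disjoint paths of the same size can be joined along a perfect matching. -/
lemma exists_join {H : Digraph V} {S T S' T' : Finset V} {X Y : List (List V)}
    (hn : (X.flatten ++ Y.flatten).Nodup) (hX : ∀ p ∈ X, H.IsSeg S T p)
    (hY : ∀ p ∈ Y, H.IsSeg S' T' p) (hl : X.length = Y.length) {m : ℕ} (hm : H.Near T S' m)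
    (h2 : X.length = 0 ∨ 2 * m ≤ X.length) :
    ∃ W : List (List V), W.length = X.length ∧ W.flatten.Perm (X.flatten ++ Y.flatten) ∧
      ∀ p ∈ W, H.IsSeg S T' p := by
  -- Empty families are allowed separately: when C is empty there are no paths through it, while `m`
  -- need not vanish.
  rcases h2 with h0 | h2
  · have hX0 : X = [] := List.length_eq_zero_iff.1 h0
    have hY0 : Y = [] := List.length_eq_zero_iff.1 (by omega)
    exact ⟨[], by simp [hX0], by simp [hX0, hY0], by simp⟩
  obtain ⟨W, h1, h2, h3⟩ := exists_perfect_matching X Y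
    (nodup_of_flatten hn.of_append_left fun p hp => (hX p hp).ne_nil)
    (nodup_of_flatten hn.of_append_right fun p hp => (hY p hp).ne_nil) hl H.Link m
    (fun p hp => lcount_not_link_right hn.of_append_right hY hm (hX p hp))
    (fun p hp => lcount_not_link_left hn.of_append_left hX hm (hY p hp)) h2
  refine ⟨W.map (fun w => w.1 ++ w.2), ?_, ?_, ?_⟩
  · rw [List.length_map, ← h1.length_eq, List.length_map]
  · exact (flatten_map_append W).trans (h1.flatten.append h2.flatten)
  · intro p hp
    obtain ⟨w, hw, rfl⟩ := List.mem_map.1 hp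
    exact (hX _ (h1.mem_iff.1 (List.mem_map_of_mem hw))).append
      (hY _ (h2.mem_iff.1 (List.mem_map_of_mem hw))) (h3 w hw)

/-- A family of disjoint paths from `S` to `T` covering all vertices closes up to a
Hamilton cycle if `T` and `S` are nearly complete. -/
lemma hasHamiltonCycle_of_segs [Fintype V] {H : Digraph V} {S T : Finset V} {W : List (List V)}
    (hn : W.flatten.Nodup) (hc : ∀ v, v ∈ W.flatten) (hW : ∀ p ∈ W, H.IsSeg S T p) {m : ℕ}
    (hm : H.Near T S m) (h4 : 4 * m + 3 ≤ W.length) : H.HasHamiltonCycle := by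
  have hne : ∀ p ∈ W, p ≠ [] := fun p hp => (hW p hp).ne_nil
  obtain ⟨h, L, hp, hch⟩ := exists_closed_chain H.Link W (nodup_of_flatten hn hne) m
    (fun p hp => lcount_not_link_right hn hW hm (hW p hp))
    (fun p hp => lcount_not_link_left hn hW hm (hW p hp)) h4
  have hW' : ∀ p ∈ h :: L ++ [h], H.IsSeg S T p := fun p hpm => hW p (by
    refine hp.mem_iff.1 ?_
    simp only [List.mem_append, List.mem_cons] at hpm ⊢
    tauto)
  have hfl : ((h :: L ++ [h]).flatten).IsChain H.Adj := by
    rw [List.isChain_flatten]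
    · exact ⟨fun p hpm => (hW' p hpm).1, hch⟩
    · intro hnil
      exact (hW' [] hnil).ne_nil rfl
  have hhne : h ≠ [] := hne h (hp.mem_iff.1 (by simp))
  obtain ⟨x, h', rfl⟩ := List.exists_cons_of_ne_nil hhne
  refine hasHamiltonCycle_of_list H x (h' ++ L.flatten) ?_ ?_ ?_
  · exact (hp.flatten.nodup_iff (l₁ := ((x :: h') :: L).flatten)).2 hn
  · exact fun v => (hp.flatten.mem_iff (l₁ := ((x :: h') :: L).flatten)).2 (hc v)
  · have e : (((x :: h') :: L) ++ [x :: h']).flatten =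
        (x :: (h' ++ L.flatten) ++ [x]) ++ h' := by simp
    rw [e] at hfl
    exact hfl.left_of_append

/-- A set in which every vertex is nonadjacent to few others contains a path on three vertices. -/
lemma exists_three_path {H : Digraph V} (hirr : ∀ x, ¬ H.Adj x x) (S : Finset V) (m : ℕ)
    (hS : ∀ x ∈ S, fcount S (fun y => ¬ (H.Adj x y ∨ H.Adj y x)) ≤ m) (hm : 2 * m < S.card) :
    ∃ x y z, x ∈ S ∧ y ∈ S ∧ z ∈ S ∧ x ≠ y ∧ x ≠ z ∧ y ≠ z ∧ H.Adj x y ∧ H.Adj y z := by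
  have hne : ∀ {x y}, H.Adj x y → x ≠ y := fun h e => hirr _ (e ▸ h)
  have two : ∃ x ∈ S, ∃ y ∈ S, H.Adj x y := by
    obtain ⟨x, hx⟩ := Finset.card_pos.1 (show 0 < S.card by omega)
    have h1 := fcount_add_not S (fun y => H.Adj x y ∨ H.Adj y x)
    have h2 := hS x hx
    obtain ⟨y, hy, hxy⟩ := mem_of_fcount_pos
      (S := S) (q := fun y => H.Adj x y ∨ H.Adj y x) (by omega)
    rcases hxy with h | h
    · exact ⟨x, hx, y, hy, h⟩
    · exact ⟨y, hy, x, hx, h⟩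
  obtain ⟨x, hx, y, hy, hxy⟩ := two
  have three : ∃ z ∈ S, (H.Adj x z ∨ H.Adj z x) ∧ (H.Adj y z ∨ H.Adj z y) := by
    by_contra hcon
    push Not at hcon
    have h1 : S ⊆ sel S (fun z => ¬ (H.Adj x z ∨ H.Adj z x)) ∪
        sel S (fun z => ¬ (H.Adj y z ∨ H.Adj z y)) := by
      intro z hz
      rw [Finset.mem_union, mem_sel, mem_sel]
      by_cases h : H.Adj x z ∨ H.Adj z x
      · have := hcon z hz h
        exact Or.inr ⟨hz, by tauto⟩
      · exact Or.inl ⟨hz, h⟩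
    have h2 := (Finset.card_le_card h1).trans (Finset.card_union_le _ _)
    have h3 := hS x hx
    have h4 := hS y hy
    rw [card_sel, card_sel] at h2
    omega
  obtain ⟨z, hz, h1, h2⟩ := three
  rcases h1 with h1 | h1
  · rcases h2 with h2 | h2
    · exact ⟨x, y, z, hx, hy, hz, hne hxy, hne h1, hne h2, hxy, h2⟩
    · exact ⟨x, z, y, hx, hz, hy, hne h1, hne hxy, hne h2, h1, h2⟩
  · exact ⟨z, x, y, hz, hx, hy, hne h1, fun e => by
      rcases h2 with h2 | h2 <;> exact hne h2 (by rw [e]), hne hxy, h1, hxy⟩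

/-- A near-tournament `S` can be partitioned into exactly `|S| - e` paths. -/
lemma exists_path_partition {H : Digraph V} (hirr : ∀ x, ¬ H.Adj x x) (m : ℕ) (e : ℕ) :
    ∀ (S : Finset V), (∀ x ∈ S, fcount S (fun y => ¬ (H.Adj x y ∨ H.Adj y x)) ≤ m) →
      (e = 0 ∨ 3 * e + 4 * m + 4 ≤ 2 * S.card) →
      ∃ X : List (List V), X.length + e = S.card ∧ X.flatten.Perm S.toList ∧
        ∀ p ∈ X, H.IsSeg S S p := by
  have hne : ∀ {x y}, H.Adj x y → x ≠ y := fun h e => hirr _ (e ▸ h)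
  have triv : ∀ S : Finset V, (S.toList.map (fun x => [x])).length = S.card ∧
      (S.toList.map (fun x => [x])).flatten.Perm S.toList ∧
        ∀ p ∈ S.toList.map (fun x => [x]), H.IsSeg S S p := by
    intro S
    refine ⟨by simp, by rw [← List.flatMap_def]; simp, ?_⟩
    intro p hp
    obtain ⟨x, hx, rfl⟩ := List.mem_map.1 hp
    rw [Finset.mem_toList] at hx
    exact isSeg_singleton hx hx
  -- removing a path from a set
  have rem : ∀ (S : Finset V) (l : List V), l.Nodup → (∀ x ∈ l, x ∈ S) → l.IsChain H.Adj →
      l ≠ [] → ∀ (X : List (List V)), X.flatten.Perm (S \ l.toFinset).toList →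
      (∀ p ∈ X, H.IsSeg (S \ l.toFinset) (S \ l.toFinset) p) →
      (l :: X).flatten.Perm S.toList ∧ ∀ p ∈ l :: X, H.IsSeg S S p := by
    intro S l hl hlS hch hnil X hX hXs
    constructor
    · rw [List.flatten_cons]
      refine (hX.append_left l).trans ?_
      rw [List.perm_ext_iff_of_nodup _ S.nodup_toList]
      · intro a
        simp only [List.mem_append, Finset.mem_toList, Finset.mem_sdiff, List.mem_toFinset]
        constructor
        · rintro (h | h)
          · exact hlS a h
          · exact h.1
        · intro h
          by_cases ha : a ∈ l
          · exact Or.inl ha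
          · exact Or.inr ⟨h, ha⟩
      · rw [List.nodup_append]
        refine ⟨hl, Finset.nodup_toList _, ?_⟩
        rintro a ha b hb rfl
        simp only [Finset.mem_toList, Finset.mem_sdiff, List.mem_toFinset] at hb
        exact hb.2 ha
    · intro p hp
      rcases List.mem_cons.1 hp with rfl | hp
      · refine ⟨hch, ⟨p.head hnil, List.head?_eq_some_head hnil, hlS _ (List.head_mem _)⟩,
          ⟨p.getLast hnil, List.getLast?_eq_some_getLast hnil, hlS _ (List.getLast_mem _)⟩⟩
      · exact (hXs p hp).mono Finset.sdiff_subset Finset.sdiff_subset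
  have cardrem : ∀ (S : Finset V) (l : List V), l.Nodup → (∀ x ∈ l, x ∈ S) →
      (S \ l.toFinset).card + l.length = S.card := by
    intro S l hl hlS
    rw [← List.toFinset_card_of_nodup hl]
    exact Finset.card_sdiff_add_card_eq_card (fun x hx => hlS x (List.mem_toFinset.1 hx))
  induction e using Nat.strong_induction_on with
  | _ e ih =>
    intro S hS hc
    rcases Nat.eq_zero_or_pos e with rfl | hpos
    · obtain ⟨h1, h2, h3⟩ := triv S
      exact ⟨_, h1, h2, h3⟩
    replace hc : 3 * e + 4 * m + 4 ≤ 2 * S.card := by omega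
    obtain ⟨x, y, z, hx, hy, hz, nxy, nxz, nyz, axy, ayz⟩ :=
      exists_three_path hirr S m hS (by omega)
    have sub : ∀ l : List V, ∀ x ∈ S \ l.toFinset,
        fcount (S \ l.toFinset) (fun y => ¬ (H.Adj x y ∨ H.Adj y x)) ≤ m := fun l x hx =>
      (fcount_mono Finset.sdiff_subset _).trans (hS x (Finset.sdiff_subset hx))
    -- A path on three vertices lowers the number of paths by two at the cost of three vertices; a
    -- single edge is used only for a last odd unit. Edges alone would need `2 * e` vertices, which
    -- leaves no room when about n/2 vertices are to be cut into about n/4 paths.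
    by_cases h1 : e = 1
    · subst h1
      have hl : [x, y].Nodup := by simp [nxy]
      have hlS : ∀ v ∈ [x, y], v ∈ S := by simp [hx, hy]
      have hcard := cardrem S [x, y] hl hlS
      obtain ⟨X, hX1, hX2, hX3⟩ := ih 0 (by omega) (S \ [x, y].toFinset) (sub _) (Or.inl rfl)
      obtain ⟨r1, r2⟩ := rem S [x, y] hl hlS (by simpa using axy) (by simp) X hX2 hX3
      exact ⟨[x, y] :: X, by simp only [List.length_cons, List.length_nil] at *; omega, r1, r2⟩
    · have hl : [x, y, z].Nodup := by simp [nxy, nxz, nyz]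
      have hlS : ∀ v ∈ [x, y, z], v ∈ S := by simp [hx, hy, hz]
      have hcard := cardrem S [x, y, z] hl hlS
      simp only [List.length_cons, List.length_nil] at hcard
      obtain ⟨X, hX1, hX2, hX3⟩ := ih (e - 2) (by omega) (S \ [x, y, z].toFinset) (sub _)
        (by omega)
      obtain ⟨r1, r2⟩ := rem S [x, y, z] hl hlS (by simp [axy, ayz]) (by simp) X hX2 hX3
      exact ⟨[x, y, z] :: X, by simp only [List.length_cons]; omega, r1, r2⟩

/-- The deficiency version of Hall's theorem: a bipartite relation has a matching of size `k`
unless some `S ⊆ Y` has fewer than `|S| - (|Y| - k)` neighbours. -/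
lemma exists_matching_of_deficiency (X Y : Finset V) (r : V → V → Prop) (k : ℕ)
    (hk : k ≤ Y.card)
    (h : ∀ S ⊆ Y, S.card + k ≤ fcount X (fun x => ∃ y ∈ S, r x y) + Y.card) :
    ∃ M : List (V × V), M.length = k ∧ (M.map Prod.fst).Nodup ∧ (M.map Prod.snd).Nodup ∧
      ∀ w ∈ M, w.1 ∈ X ∧ w.2 ∈ Y ∧ r w.1 w.2 := by
  -- Add `|Y| - k` dummy elements related to every `y`. Hall's theorem then matches all of `Y`, and
  -- at most `|Y| - k` of its elements are matched to dummies.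
  let t : Y → Finset (V ⊕ Fin (Y.card - k)) := fun y =>
    (X.filter (fun x => r x y)).disjSum Finset.univ
  have hall : ∀ s : Finset Y, s.card ≤ (s.biUnion t).card := by
    intro s
    rcases s.eq_empty_or_nonempty with rfl | ⟨y0, hy0⟩
    · simp
    let S : Finset V := s.map (Function.Embedding.subtype _)
    have hS : S ⊆ Y := by
      intro y hy
      obtain ⟨y', _, rfl⟩ := Finset.mem_map.1 hy
      exact y'.2
    have hSc : S.card = s.card := Finset.card_map _
    have hsub : (sel X (fun x => ∃ y ∈ S, r x y)).disjSum
        (Finset.univ : Finset (Fin (Y.card - k))) ⊆ s.biUnion t := by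
      intro a ha
      rw [Finset.mem_biUnion]
      rcases a with a | a
      · rw [Finset.inl_mem_disjSum, mem_sel] at ha
        obtain ⟨haX, y, hy, hr⟩ := ha
        obtain ⟨y', hy', rfl⟩ := Finset.mem_map.1 hy
        exact ⟨y', hy', by
          simp only [t]; rw [Finset.inl_mem_disjSum, Finset.mem_filter]; exact ⟨haX, hr⟩⟩
      · exact ⟨y0, hy0, by simp only [t]; rw [Finset.inr_mem_disjSum]; simp⟩
    have h1 := Finset.card_le_card hsub
    rw [Finset.card_disjSum, Finset.card_univ, Fintype.card_fin, card_sel] at h1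
    have h2 := h S hS
    omega
  obtain ⟨f, hf, hft⟩ := (Finset.all_card_le_biUnion_card_iff_exists_injective t).1 hall
  have hpart : (Finset.univ.filter (fun y : Y => (f y).isRight)).card ≤ Y.card - k := by
    have : (Finset.univ.filter (fun y : Y => (f y).isRight)).card ≤
        ((Finset.univ : Finset (Fin (Y.card - k))).map
          (Function.Embedding.inr (α := V))).card := by
      refine Finset.card_le_card_of_injOn f ?_ hf.injOn
      intro y hy
      have hy' := (Finset.mem_filter.1 hy).2
      obtain ⟨j, hj⟩ := Sum.isRight_iff.1 hy'
      rw [hj]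
      simp
    simpa using this
  have hcomp := Finset.card_filter_add_card_filter_not (s := (Finset.univ : Finset Y))
    (fun y => (f y).isRight)
  rw [Finset.card_univ, Fintype.card_coe] at hcomp
  obtain ⟨R, hR, hRc⟩ := Finset.exists_subset_card_eq
    (show k ≤ (Finset.univ.filter (fun y : Y => ¬ (f y).isRight)).card by omega)
  have hleft : ∀ y ∈ R, ∃ x, f y = Sum.inl x := by
    intro y hy
    have := (Finset.mem_filter.1 (hR hy)).2
    rcases hfy : f y with x | x
    · exact ⟨x, rfl⟩
    · simp [hfy] at this
  rcases isEmpty_or_nonempty V with hV | hV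
  · have : k = 0 := by
      have := Finset.card_eq_zero.2 (Finset.eq_empty_of_isEmpty Y)
      omega
    exact ⟨[], by simp [this], by simp, by simp, by simp⟩
  choose! g hg using hleft
  have hmem : ∀ y ∈ R, g y ∈ X ∧ r (g y) y := by
    intro y hy
    have h1 := hft y
    simp only [t] at h1
    rw [hg y hy, Finset.inl_mem_disjSum, Finset.mem_filter] at h1
    exact h1
  refine ⟨R.toList.map (fun y => (g y, y.1)), by simpa using hRc, ?_, ?_, ?_⟩
  · rw [List.map_map]
    refine (R.nodup_toList).map_on ?_
    intro y hy y' hy' he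
    rw [Finset.mem_toList] at hy hy'
    apply hf
    rw [hg y hy, hg y' hy']
    exact congrArg _ he
  · rw [List.map_map]
    refine (R.nodup_toList).map_on ?_
    intro y _ y' _ he
    exact Subtype.ext he
  · intro w hw
    obtain ⟨y, hy, rfl⟩ := List.mem_map.1 hw
    rw [Finset.mem_toList] at hy
    exact ⟨(hmem y hy).1, y.2, (hmem y hy).2⟩

end Segments

end Digraph

namespace Digraph

/-! ### Absorbing exceptional paths into paths from A to A -/

section Assembly

open Classical

variable {V : Type*}

/-- The digraph with all edges reversed. -/
def rev (G : Digraph V) : Digraph V := ⟨fun x y => G.Adj y x⟩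

@[simp] lemma rev_adj (G : Digraph V) (x y : V) : G.rev.Adj x y ↔ G.Adj y x := Iff.rfl

lemma Near.rev {H : Digraph V} {X Y : Finset V} {m : ℕ} (h : H.Near X Y m) : H.rev.Near Y X m :=
  ⟨h.2, h.1⟩

/-- A nearly complete blow-up of a directed four-cycle in a digraph all of whose edges respect
the bipartition of out-types (given by `P`) and in-types (given by `Q`). -/
structure Blowup (H : Digraph V) (A B C D P Q : Finset V) (m : ℕ) : Prop where
  neutral : ∀ x y, H.Adj x y → (x ∈ P ↔ y ∈ Q)
  memA : ∀ x ∈ A, x ∈ P ∧ x ∈ Q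
  memB : ∀ x ∈ B, x ∉ P ∧ x ∈ Q
  memC : ∀ x ∈ C, x ∉ P ∧ x ∉ Q
  memD : ∀ x ∈ D, x ∈ P ∧ x ∉ Q
  nearAB : H.Near A B m
  nearBC : H.Near B C m
  nearCD : H.Near C D m
  nearDA : H.Near D A m

namespace Blowup

variable {H : Digraph V} {A B C D P Q : Finset V} {m : ℕ}

lemma rev (hb : Blowup H A B C D P Q m) : Blowup H.rev A D C B Q P m where
  neutral x y h := (hb.neutral y x h).symm
  memA x hx := (hb.memA x hx).symm
  memB x hx := (hb.memD x hx).symm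
  memC x hx := (hb.memC x hx).symm
  memD x hx := (hb.memB x hx).symm
  nearAB := hb.nearDA.rev
  nearBC := hb.nearCD.rev
  nearCD := hb.nearBC.rev
  nearDA := hb.nearAB.rev

end Blowup

lemma exists_mem_avoiding {S U : Finset V} {q : V → Prop} {m : ℕ}
    (h : fcount S (fun x => ¬ q x) ≤ m) (hU : U.card + m < S.card) : ∃ x ∈ S, x ∉ U ∧ q x := by
  have h1 := fcount_add_not S q
  have h2 : U.card < (sel S q).card := by rw [card_sel]; omega
  obtain ⟨x, hx, hxU⟩ := Finset.exists_mem_notMem_of_card_lt_card h2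
  exact ⟨x, (mem_sel.1 hx).1, hxU, (mem_sel.1 hx).2⟩

/-- Every vertex of the blow-up is reached by a short path from `A` avoiding a given small set. -/
lemma exists_path_from {H : Digraph V} {A B C D P Q : Finset V} {m : ℕ}
    (hb : Blowup H A B C D P Q m) (U : Finset V) (hA : U.card + m < A.card)
    (hB : U.card + m < B.card) (hC : (C = ∅ ∧ H.Near B D m) ∨ U.card + m < C.card)
    {p : V} (hp : p ∈ A ∪ B ∪ C ∪ D) (hpU : p ∉ U) :
    ∃ l : List V, l.IsChain H.Adj ∧ l.getLast? = some p ∧ (∃ x ∈ l.head?, x ∈ A) ∧ l.Nodup ∧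
      (∀ x ∈ l, x ∉ U ∧ x ∈ A ∪ B ∪ C ∪ D) ∧ l.length ≤ 4 ∧ lcount (· ∈ A) l = 1 ∧
      (p ∉ P → 1 ≤ lcount (· ∈ B) l) := by
  have toB : ∀ b ∈ B, ∃ a ∈ A, a ∉ U ∧ H.Adj a b := fun b hb' =>
    exists_mem_avoiding (hb.nearAB.2 b hb') hA
  have toC : ∀ c ∈ C, ∃ b ∈ B, b ∉ U ∧ H.Adj b c := fun c hc =>
    exists_mem_avoiding (hb.nearBC.2 c hc) hB
  have nBA : ∀ b ∈ B, b ∉ A := fun b h1 h2 => (hb.memB b h1).1 (hb.memA b h2).1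
  have nCA : ∀ b ∈ C, b ∉ A := fun b h1 h2 => (hb.memC b h1).1 (hb.memA b h2).1
  have nDA : ∀ b ∈ D, b ∉ A := fun b h1 h2 => (hb.memD b h1).2 (hb.memA b h2).2
  have nCB : ∀ b ∈ C, b ∉ B := fun b h1 h2 => (hb.memC b h1).2 (hb.memB b h2).2
  have nDB : ∀ b ∈ D, b ∉ B := fun b h1 h2 => (hb.memD b h1).2 (hb.memB b h2).2
  have nDC : ∀ b ∈ D, b ∉ C := fun b h1 h2 => (hb.memC b h2).1 (hb.memD b h1).1
  have ne : ∀ {S : Finset V} {x y : V}, x ∈ S → y ∉ S → x ≠ y := fun h1 h2 e => h2 (e ▸ h1)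
  simp only [Finset.mem_union] at hp ⊢
  rcases hp with ((hp | hp) | hp) | hp
  · exact ⟨[p], by simp, by simp, ⟨p, by simp, hp⟩, by simp, by simp [hp, hpU], by simp,
      by simp [lcount_cons, lcount_nil, hp], fun h => absurd (hb.memA p hp).1 h⟩
  · obtain ⟨a, ha, haU, hab⟩ := toB p hp
    have n1 : a ≠ p := ne ha (nBA p hp)
    exact ⟨[a, p], by simp [hab], by simp, ⟨a, by simp, ha⟩, by simp [n1],
      by simp [hp, hpU, ha, haU], by simp, by simp [lcount_cons, lcount_nil, ha, nBA p hp],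
      fun _ => by simp [lcount_cons, lcount_nil, hp]⟩
  · obtain ⟨b, hbB, hbU, hbp⟩ := toC p hp
    obtain ⟨a, ha, haU, hab⟩ := toB b hbB
    have n1 : a ≠ p := ne ha (nCA p hp)
    have n2 : a ≠ b := ne ha (nBA b hbB)
    have n3 : b ≠ p := ne hbB (nCB p hp)
    exact ⟨[a, b, p], by simp [hab, hbp], by simp, ⟨a, by simp, ha⟩, by simp [n1, n2, n3],
      by simp [hp, hpU, ha, haU, hbB, hbU], by simp,
      by simp [lcount_cons, lcount_nil, ha, nBA b hbB, nCA p hp],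
      fun _ => by simp [lcount_cons, lcount_nil, hbB]; omega⟩
  · have hpP : p ∈ P := (hb.memD p hp).1
    -- The class D is entered through C, or straight from B when C is empty.
    rcases hC with ⟨hC, hBD⟩ | hC
    · obtain ⟨b, hbB, hbU, hbp⟩ := exists_mem_avoiding (hBD.2 p hp) hB
      obtain ⟨a, ha, haU, hab⟩ := toB b hbB
      have n1 : a ≠ p := ne ha (nDA p hp)
      have n2 : a ≠ b := ne ha (nBA b hbB)
      have n3 : b ≠ p := ne hbB (nDB p hp)
      exact ⟨[a, b, p], by simp [hab, hbp], by simp, ⟨a, by simp, ha⟩, by simp [n1, n2, n3],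
        by simp [hp, hpU, ha, haU, hbB, hbU], by simp,
        by simp [lcount_cons, lcount_nil, ha, nBA b hbB, nDA p hp], fun h => absurd hpP h⟩
    · obtain ⟨c, hcC, hcU, hcp⟩ := exists_mem_avoiding (hb.nearCD.2 p hp) hC
      obtain ⟨b, hbB, hbU, hbc⟩ := toC c hcC
      obtain ⟨a, ha, haU, hab⟩ := toB b hbB
      have n1 : a ≠ p := ne ha (nDA p hp)
      have n2 : a ≠ b := ne ha (nBA b hbB)
      have n3 : b ≠ p := ne hbB (nDB p hp)
      have n4 : a ≠ c := ne ha (nCA c hcC)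
      have n5 : b ≠ c := ne hbB (nCB c hcC)
      have n6 : c ≠ p := ne hcC (nDC p hp)
      exact ⟨[a, b, c, p], by simp [hab, hbc, hcp], by simp, ⟨a, by simp, ha⟩,
        by simp [n1, n2, n3, n4, n5, n6],
        by simp [hp, hpU, ha, haU, hbB, hbU, hcC, hcU], by simp,
        by simp [lcount_cons, lcount_nil, ha, nBA b hbB, nCA c hcC, nDA p hp],
        fun h => absurd hpP h⟩

/-- Reversal gives a blow-up again, with B and D as well as `P` and `Q` exchanged. -/
lemma exists_path_to {H : Digraph V} {A B C D P Q : Finset V} {m : ℕ}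
    (hb : Blowup H A B C D P Q m) (U : Finset V) (hA : U.card + m < A.card)
    (hD : U.card + m < D.card) (hC : (C = ∅ ∧ H.Near B D m) ∨ U.card + m < C.card)
    {p : V} (hp : p ∈ A ∪ B ∪ C ∪ D) (hpU : p ∉ U) :
    ∃ l : List V, l.IsChain H.Adj ∧ l.head? = some p ∧ (∃ x ∈ l.getLast?, x ∈ A) ∧ l.Nodup ∧
      (∀ x ∈ l, x ∉ U ∧ x ∈ A ∪ B ∪ C ∪ D) ∧ l.length ≤ 4 ∧ lcount (· ∈ A) l = 1 := by
  obtain ⟨l, h1, h2, h3, h4, h5, h6, h7, -⟩ := exists_path_from hb.rev U hA hD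
    (hC.imp_left fun h => ⟨h.1, h.2.rev⟩) (p := p) (by
      simp only [Finset.mem_union] at hp ⊢; tauto) hpU
  refine ⟨l.reverse, List.isChain_reverse.2 h1, by simpa using h2, by simpa using h3, by simpa,
    ?_, by simpa using h6, by rw [lcount_perm _ (List.reverse_perm l)]; exact h7⟩
  intro x hx
  obtain ⟨hx1, hx2⟩ := h5 x (by simpa using hx)
  refine ⟨hx1, ?_⟩
  simp only [Finset.mem_union] at hx2 ⊢
  tauto

/-- `z` is a path whose first vertex has more than `u` in-neighbours in `T` and whose last vertex
has more than `u` out-neighbours in `T`. -/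
def IsItem (H : Digraph V) (T : Finset V) (u : ℕ) (z : List V) : Prop :=
  z.IsChain H.Adj ∧ (∃ x ∈ z.head?, u < fcount T (fun y => H.Adj y x)) ∧
    ∃ x ∈ z.getLast?, u < fcount T (fun y => H.Adj x y)

/-- An in-neighbour of the head and an out-neighbour of the last vertex are linked to A by paths on
at most four vertices each; the second must also avoid the first, hence the reserve of 4. Exactly
two vertices of A are spent. A head outside `Q` is entered by a neutral edge from outside `P`, that
is from B or C, and the path from A to such a vertex passes through B. -/
lemma exists_extension {H : Digraph V} {A B C D P Q : Finset V} {m u : ℕ}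
    (hb : Blowup H A B C D P Q m) (hA : u + m < A.card) (hB : u + m < B.card)
    (hC : (C = ∅ ∧ H.Near B D m) ∨ u + m < C.card) (hD : u + m < D.card)
    {z : List V} (hz : H.IsItem (A ∪ B ∪ C ∪ D) u z) (U : Finset V) (hU : U.card + 4 ≤ u) :
    ∃ l l' : List V, H.IsSeg A A (l ++ z ++ l') ∧ (l ++ l').Nodup ∧
      (∀ x ∈ l ++ l', x ∉ U ∧ x ∈ A ∪ B ∪ C ∪ D) ∧ (l ++ l').length ≤ 8 ∧
      lcount (· ∈ A) (l ++ l') = 2 ∧ ((∃ x ∈ z.head?, x ∉ Q) → 1 ≤ lcount (· ∈ B) (l ++ l')) := by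
  obtain ⟨hch, ⟨x, hx, hxu⟩, ⟨y, hy, hyu⟩⟩ := hz
  rw [Option.mem_def] at hx hy
  obtain ⟨p, hp, hpU⟩ := Finset.exists_mem_notMem_of_card_lt_card
    (show U.card < (sel (A ∪ B ∪ C ∪ D) (fun v => H.Adj v x)).card by rw [card_sel]; omega)
  obtain ⟨hp, hpx⟩ := mem_sel.1 hp
  obtain ⟨l, h1, h2, h3, h4, h5, h6, h7, h8⟩ := exists_path_from hb U (by omega) (by omega)
    (hC.imp_right fun h => by omega) hp hpU
  have hU' : (U ∪ l.toFinset).card ≤ u := by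
    have := Finset.card_union_le U l.toFinset
    have := List.toFinset_card_le l
    omega
  obtain ⟨q, hq, hqU⟩ := Finset.exists_mem_notMem_of_card_lt_card
    (show (U ∪ l.toFinset).card < (sel (A ∪ B ∪ C ∪ D) (fun v => H.Adj y v)).card by
      rw [card_sel]; omega)
  obtain ⟨hq, hqy⟩ := mem_sel.1 hq
  obtain ⟨l', g1, g2, g3, g4, g5, g6, g7⟩ := exists_path_to hb (U ∪ l.toFinset) (by omega)
    (by omega) (hC.imp_right fun h => by omega) hq hqU
  have hlne : l ≠ [] := by rintro rfl; simp at h2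
  have hlne' : l' ≠ [] := by rintro rfl; simp at g2
  have hzne : z ≠ [] := by rintro rfl; simp at hx
  refine ⟨l, l', ⟨?_, ?_, ?_⟩, ?_, ?_, ?_, ?_, ?_⟩
  · rw [List.isChain_append, List.isChain_append]
    refine ⟨⟨h1, hch, ?_⟩, g1, ?_⟩
    · rw [h2, hx]
      simpa using hpx
    · rw [List.getLast?_append_of_ne_nil _ hzne, hy, g2]
      simpa using hqy
  · rw [List.append_assoc, List.head?_append_of_ne_nil _ hlne]; exact h3
  · rw [List.getLast?_append_of_ne_nil _ hlne']; exact g3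
  · rw [List.nodup_append]
    refine ⟨h4, g4, ?_⟩
    rintro a ha b hb' rfl
    exact (g5 a hb').1 (Finset.mem_union_right _ (List.mem_toFinset.2 ha))
  · intro v hv
    rcases List.mem_append.1 hv with hv | hv
    · exact h5 v hv
    · exact ⟨fun h => (g5 v hv).1 (Finset.mem_union_left _ h), (g5 v hv).2⟩
  · rw [List.length_append]; omega
  · rw [lcount_append, h7, g7]
  · rintro ⟨x', hx', hxQ⟩
    rw [Option.mem_def, hx] at hx'
    cases hx'
    rw [lcount_append]
    have := h8 (fun h => hxQ ((hb.neutral p x hpx).1 h))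
    omega

lemma exists_extensions {H : Digraph V} {A B C D P Q : Finset V} {m u : ℕ}
    (hb : Blowup H A B C D P Q m) (hA : u + m < A.card) (hB : u + m < B.card)
    (hC : (C = ∅ ∧ H.Near B D m) ∨ u + m < C.card) (hD : u + m < D.card) (Z : List (List V))
    (hZ : ∀ z ∈ Z, H.IsItem (A ∪ B ∪ C ∪ D) u z) (hu : 8 * Z.length ≤ u) :
    ∃ (X : List (List V)) (E : List V), X.length = Z.length ∧ (∀ p ∈ X, H.IsSeg A A p) ∧
      X.flatten.Perm (Z.flatten ++ E) ∧ E.Nodup ∧ (∀ x ∈ E, x ∈ A ∪ B ∪ C ∪ D) ∧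
      E.length ≤ 8 * Z.length ∧ lcount (· ∈ A) E = 2 * Z.length ∧
      lcount (fun z => ∃ x ∈ z.head?, x ∉ Q) Z ≤ lcount (· ∈ B) E := by
  induction Z with
  | nil => exact ⟨[], [], by simp, by simp, by simp, by simp, by simp, by simp, by simp [lcount_nil],
      by simp [lcount_nil]⟩
  | cons z Z ih =>
    simp only [List.length_cons] at hu
    obtain ⟨X, E, h1, h2, h3, h4, h5, h6, h7, h8⟩ := ih (fun z' hz' => hZ z' (by simp [hz']))
      (by omega)
    obtain ⟨l, l', g1, g2, g3, g4, g5, g6⟩ := exists_extension hb hA hB hC hD (hZ z (by simp))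
      E.toFinset (by have := List.toFinset_card_le E; omega)
    refine ⟨(l ++ z ++ l') :: X, (l ++ l') ++ E, by simp [h1], ?_, ?_, ?_, ?_, ?_, ?_, ?_⟩
    · intro p hp
      rcases List.mem_cons.1 hp with rfl | hp
      · exact g1
      · exact h2 p hp
    · simp only [List.flatten_cons]
      have e1 : (l ++ z ++ l').Perm (z ++ (l ++ l')) := by
        rw [List.append_assoc]
        refine (List.perm_append_comm (l₁ := l) (l₂ := z ++ l')).trans ?_
        rw [List.append_assoc]
        exact List.Perm.append_left _ List.perm_append_comm
      refine (e1.append h3).trans ?_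
      rw [List.append_assoc, List.append_assoc z]
      refine List.Perm.append_left _ ?_
      rw [← List.append_assoc, ← List.append_assoc Z.flatten]
      exact List.Perm.append_right _ List.perm_append_comm
    · rw [List.nodup_append]
      refine ⟨g2, h4, ?_⟩
      rintro a ha b hb' rfl
      exact (g3 a ha).1 (List.mem_toFinset.2 hb')
    · intro x hx
      rcases List.mem_append.1 hx with hx | hx
      · exact (g3 x hx).2
      · exact h5 x hx
    · rw [List.length_append, List.length_cons]; omega
    · rw [lcount_append, List.length_cons]; omega
    · rw [lcount_append, lcount_cons]
      by_cases hz : ∃ x ∈ z.head?, x ∉ Q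
      · rw [if_pos hz]
        have := g6 hz
        omega
      · rw [if_neg hz]
        omega

/-- Along a path of neutral edges the numbers of vertices of out-type `P` and of in-type `Q`
differ only at the ends. -/
lemma lcount_chain {H : Digraph V} {P Q : Finset V}
    (hn : ∀ x y, H.Adj x y → (x ∈ P ↔ y ∈ Q)) (l : List V) (hl : l.IsChain H.Adj) (x y : V)
    (hx : l.head? = some x) (hy : l.getLast? = some y) :
    lcount (· ∈ P) l + (if x ∈ Q then 1 else 0) = lcount (· ∈ Q) l + if y ∈ P then 1 else 0 := by
  induction l generalizing x with
  | nil => simp at hx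
  | cons a l ih =>
    simp only [List.head?_cons, Option.some.injEq] at hx
    subst hx
    rw [lcount_cons, lcount_cons]
    cases l with
    | nil =>
      simp only [List.getLast?_singleton, Option.some.injEq] at hy
      subst hy
      simp only [lcount_nil]
      split_ifs <;> omega
    | cons b l =>
      rw [List.isChain_cons_cons] at hl
      have h1 := ih hl.2 b (by simp) (by simpa using hy)
      have h2 := hn _ _ hl.1
      split_ifs at * <;> first | omega | tauto

/-- Both ends of each path lie in `P ∩ Q`, so the boundary terms of `lcount_chain` cancel. This is
what later forces the leftovers of B and D to have equal size. -/
lemma lcount_flatten_eq {H : Digraph V} {P Q : Finset V}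
    (hn : ∀ x y, H.Adj x y → (x ∈ P ↔ y ∈ Q)) {A : Finset V} (hA : ∀ x ∈ A, x ∈ P ∧ x ∈ Q)
    (X : List (List V)) (hX : ∀ p ∈ X, H.IsSeg A A p) :
    lcount (· ∈ P) X.flatten = lcount (· ∈ Q) X.flatten := by
  induction X with
  | nil => rfl
  | cons p X ih =>
    rw [List.flatten_cons, lcount_append, lcount_append, ih fun q hq => hX q (by simp [hq])]
    obtain ⟨h1, ⟨x, hx, hxA⟩, ⟨y, hy, hyA⟩⟩ := hX p (by simp)
    have := lcount_chain hn p h1 x y hx hy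
    rw [if_pos (hA x hxA).2, if_pos (hA y hyA).1] at this
    omega

end Assembly

end Digraph

namespace Digraph

/-! ### Covering B, C, D by paths and closing up the Hamilton cycle -/

section Assembly

open Classical

variable {V : Type*}

lemma nodup_append_of {l l' : List V} (h : l.Nodup) (h' : l'.Nodup) (hd : ∀ x ∈ l, x ∉ l') :
    (l ++ l').Nodup := by
  rw [List.nodup_append]
  refine ⟨h, h', ?_⟩
  rintro a ha b hb rfl
  exact hd a ha hb

lemma perm_toList_sdiff {S : Finset V} {l : List V} (hl : l.Nodup) (h : ∀ x ∈ l, x ∈ S) :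
    (l ++ (S \ l.toFinset).toList).Perm S.toList := by
  rw [List.perm_ext_iff_of_nodup _ S.nodup_toList]
  · intro a
    simp only [List.mem_append, Finset.mem_toList, Finset.mem_sdiff, List.mem_toFinset]
    constructor
    · rintro (ha | ha)
      · exact h a ha
      · exact ha.1
    · intro ha
      by_cases hal : a ∈ l
      · exact Or.inl hal
      · exact Or.inr ⟨ha, hal⟩
  · refine nodup_append_of hl (Finset.nodup_toList _) ?_
    intro a ha hb
    simp only [Finset.mem_toList, Finset.mem_sdiff, List.mem_toFinset] at hb
    exact hb.2 ha

lemma flatten_map_singleton {l : List V} : (l.map (fun x => [x])).flatten = l := by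
  rw [← List.flatMap_def]; simp

lemma flatten_map_pair (M : List (V × V)) :
    (M.map (fun w => [w.1, w.2])).flatten.Perm (M.map Prod.fst ++ M.map Prod.snd) := by
  induction M with
  | nil => simp
  | cons w M ih =>
    simp only [List.map_cons, List.flatten_cons, List.cons_append, List.nil_append]
    refine List.Perm.cons _ ?_
    refine (List.Perm.cons _ ih).trans ?_
    exact List.perm_middle.symm

/-- The number of nonadjacent pairs from `X` to `Y`. -/
noncomputable def nonEdges (H : Digraph V) (X Y : Finset V) : ℕ :=
  ∑ y ∈ Y, fcount X (fun x => ¬ H.Adj x y)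

/-- Disjoint paths from `B` to `D` through `C` covering three leftover sets. -/
lemma exists_units {H : Digraph V} (hirr : ∀ x, ¬ H.Adj x x) {B C D : Finset V} {m : ℕ}
    (hBC : H.Near B C m) (hCD : H.Near C D m) (hdBC : Disjoint B C) (hdBD : Disjoint B D)
    (hdCD : Disjoint C D)
    (tourC : ∀ x ∈ C, fcount C (fun y => ¬ (H.Adj x y ∨ H.Adj y x)) ≤ m)
    (hcard : B.card = D.card) (hm : 2 * m ≤ B.card) (hC3 : C.card + 4 * m + 4 ≤ 3 * B.card)
    (hC : (C = ∅ ∧ H.Near B D m) ∨ (2 * m ≤ C.card ∧ nonEdges H B D < B.card * C.card)) :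
    ∃ U : List (List V), U.length = B.card ∧
      U.flatten.Perm (B.toList ++ (C.toList ++ D.toList)) ∧ ∀ p ∈ U, H.IsSeg B D p := by
  -- the paths covering `C`
  obtain ⟨Y, hY1, hY2, hY3⟩ := exists_path_partition hirr m (C.card - B.card) C tourC (by omega)
  have hYle : Y.length ≤ B.card := by omega
  -- the matching from `B` to `D`
  have hM : ∃ M : List (V × V), M.length = B.card - Y.length ∧ (M.map Prod.fst).Nodup ∧
      (M.map Prod.snd).Nodup ∧ ∀ w ∈ M, w.1 ∈ B ∧ w.2 ∈ D ∧ H.Adj w.1 w.2 := by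
    rcases hC with ⟨hC0, hBD⟩ | ⟨hC2, hne⟩
    · obtain ⟨W, hW1, hW2, hW3⟩ := exists_perfect_matching B.toList D.toList B.nodup_toList
        D.nodup_toList (by simp [hcard]) H.Adj m
        (fun x hx => by rw [lcount_toList]; exact hBD.1 x (Finset.mem_toList.1 hx))
        (fun x hx => by rw [lcount_toList]; exact hBD.2 x (Finset.mem_toList.1 hx))
        (by simpa using hm)
      have hY0 : Y.length = 0 := by simp [hC0] at hY1; simp [hY1]
      refine ⟨W, ?_, hW1.nodup_iff.2 B.nodup_toList, hW2.nodup_iff.2 D.nodup_toList, ?_⟩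
      · have := hW1.length_eq
        rw [List.length_map, Finset.length_toList] at this
        omega
      · intro w hw
        exact ⟨Finset.mem_toList.1 (hW1.mem_iff.1 (List.mem_map_of_mem hw)),
          Finset.mem_toList.1 (hW2.mem_iff.1 (List.mem_map_of_mem hw)), hW3 w hw⟩
    -- A violating `S` has more than `|N(S)| + |C|` elements, so it sees at least `|S| * (|B| - |S|
    -- + |C|)` non-edges. As `|S| > |C|`, this is at least `|B| * |C|`.
    · refine exists_matching_of_deficiency B D H.Adj _ (by omega) ?_
      intro S hS
      by_contra hcon
      have hSD := Finset.card_le_card hS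
      have hlt : fcount B (fun x => ∃ y ∈ S, H.Adj x y) + C.card < S.card := by omega
      have h1 : S.card * (B.card - fcount B (fun x => ∃ y ∈ S, H.Adj x y)) ≤ nonEdges H B D := by
        unfold nonEdges
        refine le_trans ?_ (Finset.sum_le_sum_of_subset hS)
        rw [← smul_eq_mul]
        refine Finset.card_nsmul_le_sum _ _ _ ?_
        intro y hy
        have e1 := fcount_add_not B (fun x => ∃ y ∈ S, H.Adj x y)
        have e2 : fcount B (fun x => ¬ ∃ y ∈ S, H.Adj x y) ≤ fcount B (fun x => ¬ H.Adj x y) := by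
          refine Finset.card_le_card ?_
          intro x hx
          rw [mem_sel] at hx ⊢
          exact ⟨hx.1, fun h => hx.2 ⟨y, hy, h⟩⟩
        omega
      have h2 := lt_of_le_of_lt h1 hne
      set N := fcount B (fun x => ∃ y ∈ S, H.Adj x y)
      have hN : B.card - N ≥ B.card - S.card + C.card := by omega
      have h3 : S.card * (B.card - S.card + C.card) < B.card * C.card :=
        lt_of_le_of_lt (Nat.mul_le_mul_left _ hN) h2
      obtain ⟨t, ht⟩ := Nat.exists_eq_add_of_le (show S.card ≤ B.card by omega)
      rw [ht] at h3
      have : S.card + t - S.card = t := by omega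
      rw [this] at h3
      nlinarith
  obtain ⟨M, hM1, hM2, hM3, hM4⟩ := hM
  set B₂ := B \ (M.map Prod.fst).toFinset with hB₂
  set D₂ := D \ (M.map Prod.snd).toFinset with hD₂
  have pB : (M.map Prod.fst ++ B₂.toList).Perm B.toList := perm_toList_sdiff hM2 (by
    intro x hx
    obtain ⟨w, hw, rfl⟩ := List.mem_map.1 hx
    exact (hM4 w hw).1)
  have pD : (M.map Prod.snd ++ D₂.toList).Perm D.toList := perm_toList_sdiff hM3 (by
    intro x hx
    obtain ⟨w, hw, rfl⟩ := List.mem_map.1 hx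
    exact (hM4 w hw).2.1)
  have cB := pB.length_eq
  have cD := pD.length_eq
  simp only [List.length_append, List.length_map, Finset.length_toList] at cB cD
  have hB₂B : B₂ ⊆ B := Finset.sdiff_subset
  have hD₂D : D₂ ⊆ D := Finset.sdiff_subset
  have hYd : ∀ x ∈ Y.flatten, x ∈ C := fun x hx => Finset.mem_toList.1 (hY2.mem_iff.1 hx)
  have hYn : Y.flatten.Nodup := hY2.nodup_iff.2 C.nodup_toList
  have hY0 : Y.length = 0 ∨ 2 * m ≤ Y.length := by
    rcases hC with ⟨hC0, _⟩ | ⟨hC2, _⟩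
    · left
      simp [hC0] at hY1
      simp [hY1]
    · right; omega
  -- Each path through C receives an unmatched vertex of B in front, and in the second join an
  -- unmatched vertex of D at its end.
  obtain ⟨W, hW1, hW2, hW3⟩ := exists_join (H := H) (S := B) (T := B) (S' := C) (T' := C)
    (X := B₂.toList.map (fun x => [x])) (Y := Y) (m := m)
    (by
      rw [flatten_map_singleton]
      refine nodup_append_of B₂.nodup_toList hYn ?_
      intro x hx hy
      exact Finset.disjoint_left.1 hdBC (hB₂B (Finset.mem_toList.1 hx)) (hYd x hy))
    (by
      intro p hp
      obtain ⟨x, hx, rfl⟩ := List.mem_map.1 hp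
      have := hB₂B (Finset.mem_toList.1 hx)
      exact isSeg_singleton this this)
    hY3 (by rw [List.length_map, Finset.length_toList]; omega) hBC
    (by rw [List.length_map, Finset.length_toList]; omega)
  rw [List.length_map, Finset.length_toList] at hW1
  rw [flatten_map_singleton] at hW2
  obtain ⟨W', hW'1, hW'2, hW'3⟩ := exists_join (H := H) (S := B) (T := C) (S' := D) (T' := D)
    (X := W) (Y := D₂.toList.map (fun x => [x])) (m := m)
    (by
      rw [flatten_map_singleton]
      refine nodup_append_of ?_ D₂.nodup_toList ?_
      · refine hW2.nodup_iff.2 (nodup_append_of B₂.nodup_toList hYn ?_)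
        intro x hx hy
        exact Finset.disjoint_left.1 hdBC (hB₂B (Finset.mem_toList.1 hx)) (hYd x hy)
      · intro x hx hy
        have hxD := hD₂D (Finset.mem_toList.1 hy)
        rcases List.mem_append.1 (hW2.mem_iff.1 hx) with hx | hx
        · exact Finset.disjoint_left.1 hdBD (hB₂B (Finset.mem_toList.1 hx)) hxD
        · exact Finset.disjoint_left.1 hdCD (hYd x hx) hxD)
    hW3
    (by
      intro p hp
      obtain ⟨x, hx, rfl⟩ := List.mem_map.1 hp
      have := hD₂D (Finset.mem_toList.1 hx)
      exact isSeg_singleton this this)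
    (by rw [List.length_map, Finset.length_toList]; omega) hCD (by omega)
  rw [flatten_map_singleton] at hW'2
  refine ⟨M.map (fun w => [w.1, w.2]) ++ W', ?_, ?_, ?_⟩
  · rw [List.length_append, List.length_map]; omega
  · rw [List.flatten_append]
    refine ((flatten_map_pair M).append (hW'2.trans ((hW2.trans (hY2.append_left _)).append_right
      _))).trans ?_
    refine List.Perm.trans ?_ (pB.append (pD.append_left C.toList))
    rw [← Multiset.coe_eq_coe]
    simp only [← Multiset.coe_add]
    abel
  · intro p hp
    rcases List.mem_append.1 hp with hp | hp
    · obtain ⟨w, hw, rfl⟩ := List.mem_map.1 hp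
      obtain ⟨h1, h2, h3⟩ := hM4 w hw
      exact ⟨by simpa using h3, ⟨w.1, by simp, h1⟩, ⟨w.2, by simp, h2⟩⟩
    · exact hW'3 p hp

/-- The cycle alternates between paths from A to A and paths from B to D, using AB and DA for the
connections. There are `|B'|` of the latter, where primes denote what the extensions of the items
leave over. The A-paths are the `|Z|` extended items and a partition of A', so `|B'| ≤ |A'| + |Z|`
is required. The items take exactly `2 * |Z|` vertices from A and at least one from B for each head
outside `Q`, which turns the requirement into `hAB`. The bounds with factor 3 leave room for the
path partitions of A' and C'. -/
theorem hasHamiltonCycle_of_blowup [Fintype V] {H : Digraph V} {A B C D P Q : Finset V}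
    {m s : ℕ} (hb : Blowup H A B C D P Q m) (hirr : ∀ x, ¬ H.Adj x x) (hPQ : P.card = Q.card)
    (tourA : ∀ x ∈ A, fcount A (fun y => ¬ (H.Adj x y ∨ H.Adj y x)) ≤ m)
    (tourC : ∀ x ∈ C, fcount C (fun y => ¬ (H.Adj x y ∨ H.Adj y x)) ≤ m)
    (Z : List (List V)) (hZ : ∀ z ∈ Z, H.IsItem (A ∪ B ∪ C ∪ D) (8 * s) z) (hZs : Z.length ≤ s)
    (hZn : Z.flatten.Nodup) (hZT : ∀ x ∈ Z.flatten, x ∉ A ∪ B ∪ C ∪ D)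
    (hcov : ∀ x, x ∈ A ∪ B ∪ C ∪ D ∨ x ∈ Z.flatten)
    (hA : 8 * s + m < A.card) (hB : 8 * s + 4 * m + 3 ≤ B.card) (hD : 8 * s + m < D.card)
    (hAB : B.card + Z.length ≤ A.card + lcount (fun z => ∃ x ∈ z.head?, x ∉ Q) Z)
    (hA3 : A.card + 25 * s + 4 * m + 4 ≤ 3 * B.card)
    (hC3 : C.card + 24 * s + 4 * m + 4 ≤ 3 * B.card)
    (hC : (C = ∅ ∧ H.Near B D m) ∨ (8 * s + 2 * m < C.card ∧
      ∀ b c, B.card ≤ b + 8 * s → C.card ≤ c + 8 * s → nonEdges H B D < b * c)) :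
    H.HasHamiltonCycle := by
  obtain ⟨X, E, hX1, hX2, hX3, hE1, hE2, hE3, hE4, hE5⟩ := exists_extensions hb hA (by omega)
    (hC.imp_right fun h => by omega) hD Z hZ (by omega)
  -- what is left of a set
  have left : ∀ S : Finset V, (sel S (· ∉ E)).card + lcount (· ∈ S) E = S.card := by
    intro S
    have h1 := fcount_add_not S (· ∈ E)
    have h2 : fcount S (· ∈ E) = lcount (· ∈ S) E := by
      rw [← fcount_toFinset hE1]
      unfold fcount
      congr 1
      ext x
      rw [mem_sel, mem_sel, List.mem_toFinset, and_comm]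
    rw [card_sel]
    omega
  have lE : ∀ S : Finset V, lcount (· ∈ S) E ≤ 8 * s := fun S =>
    (lcount_le_length _ _).trans (by omega)
  set A' := sel A (· ∉ E)
  set B' := sel B (· ∉ E)
  set C' := sel C (· ∉ E)
  set D' := sel D (· ∉ E)
  have sA : A' ⊆ A := sel_subset _ _
  have sB : B' ⊆ B := sel_subset _ _
  have sC : C' ⊆ C := sel_subset _ _
  have sD : D' ⊆ D := sel_subset _ _
  have cA : A'.card + lcount (· ∈ A) E = A.card := left A
  have cB : B'.card + lcount (· ∈ B) E = B.card := left B
  have cC : C'.card + lcount (· ∈ C) E = C.card := left C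
  have cD : D'.card + lcount (· ∈ D) E = D.card := left D
  have lB := lE B
  have lC := lE C
  have lD := lE D
  have dAB : Disjoint A B := Finset.disjoint_left.2 fun x h h' => (hb.memB x h').1 (hb.memA x h).1
  have dAC : Disjoint A C := Finset.disjoint_left.2 fun x h h' => (hb.memC x h').1 (hb.memA x h).1
  have dAD : Disjoint A D := Finset.disjoint_left.2 fun x h h' => (hb.memD x h').2 (hb.memA x h).2
  have dBC : Disjoint B C := Finset.disjoint_left.2 fun x h h' => (hb.memC x h').2 (hb.memB x h).2
  have dBD : Disjoint B D := Finset.disjoint_left.2 fun x h h' => (hb.memD x h').2 (hb.memB x h).2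
  have dCD : Disjoint C D := Finset.disjoint_left.2 fun x h h' => (hb.memC x h).1 (hb.memD x h').1
  -- the list of all vertices
  have nR : (A'.toList ++ (B'.toList ++ (C'.toList ++ D'.toList))).Nodup := by
    refine nodup_append_of (Finset.nodup_toList _) (nodup_append_of (Finset.nodup_toList _)
      (nodup_append_of (Finset.nodup_toList _) (Finset.nodup_toList _) ?_) ?_) ?_
    · intro x h h'
      exact Finset.disjoint_left.1 dCD (sC (Finset.mem_toList.1 h)) (sD (Finset.mem_toList.1 h'))
    · intro x h h'
      have h := sB (Finset.mem_toList.1 h)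
      rcases List.mem_append.1 h' with h' | h'
      · exact Finset.disjoint_left.1 dBC h (sC (Finset.mem_toList.1 h'))
      · exact Finset.disjoint_left.1 dBD h (sD (Finset.mem_toList.1 h'))
    · intro x h h'
      have h := sA (Finset.mem_toList.1 h)
      rcases List.mem_append.1 h' with h' | h'
      · exact Finset.disjoint_left.1 dAB h (sB (Finset.mem_toList.1 h'))
      rcases List.mem_append.1 h' with h' | h'
      · exact Finset.disjoint_left.1 dAC h (sC (Finset.mem_toList.1 h'))
      · exact Finset.disjoint_left.1 dAD h (sD (Finset.mem_toList.1 h'))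
  have mR : ∀ x, x ∈ A'.toList ++ (B'.toList ++ (C'.toList ++ D'.toList)) ↔
      x ∈ A ∪ B ∪ C ∪ D ∧ x ∉ E := by
    intro x
    simp only [List.mem_append, Finset.mem_toList, Finset.mem_union, A', B', C', D', mem_sel]
    tauto
  have nX : X.flatten.Nodup := hX3.nodup_iff.2 (nodup_append_of hZn hE1 fun x h h' =>
    hZT x h (hE2 x h'))
  have nL : (X.flatten ++ (A'.toList ++ (B'.toList ++ (C'.toList ++ D'.toList)))).Nodup := by
    refine nodup_append_of nX nR ?_
    intro x hx hx'
    rw [mR] at hx'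
    rcases List.mem_append.1 (hX3.mem_iff.1 hx) with h | h
    · exact hZT x h hx'.1
    · exact hx'.2 h
  have covL : ∀ x, x ∈ X.flatten ++ (A'.toList ++ (B'.toList ++ (C'.toList ++ D'.toList))) := by
    intro x
    rw [List.mem_append, mR, hX3.mem_iff, List.mem_append]
    have := hcov x
    tauto
  -- `B'` and `D'` have the same size
  have cnt : ∀ S : Finset V, S.card =
      lcount (· ∈ S) (X.flatten ++ (A'.toList ++ (B'.toList ++ (C'.toList ++ D'.toList)))) := by
    intro S
    rw [← fcount_toFinset nL, ← card_sel]
    congr 1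
    ext x
    rw [mem_sel, List.mem_toFinset]
    exact ⟨fun h => ⟨covL x, h⟩, fun h => h.2⟩
  have all : ∀ (S : Finset V) (q : V → Prop), (∀ x ∈ S, q x) → lcount q S.toList = S.card := by
    intro S q h
    rw [lcount_toList, ← card_sel]
    congr 1
    ext x
    rw [mem_sel]
    exact ⟨fun h => h.1, fun hx => ⟨hx, h x hx⟩⟩
  have none : ∀ (S : Finset V) (q : V → Prop), (∀ x ∈ S, ¬ q x) → lcount q S.toList = 0 := by
    intro S q h
    rw [lcount_toList, ← card_sel, Finset.card_eq_zero]
    ext x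
    rw [mem_sel]
    simp only [Finset.notMem_empty, iff_false, not_and]
    exact h x
  -- The extended items contain equally many vertices of `P` and of `Q`, and A' lies in both; what
  -- remains of `|P| = |Q|` is this equality.
  have hBD : B'.card = D'.card := by
    have e1 := cnt P
    have e2 := cnt Q
    have e3 := lcount_flatten_eq hb.neutral hb.memA X hX2
    simp only [lcount_append] at e1 e2
    rw [all A' _ fun x hx => (hb.memA x (sA hx)).1, none B' _ fun x hx => (hb.memB x (sB hx)).1,
      none C' _ fun x hx => (hb.memC x (sC hx)).1, all D' _ fun x hx => (hb.memD x (sD hx)).1] at e1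
    rw [all A' _ fun x hx => (hb.memA x (sA hx)).2, all B' _ fun x hx => (hb.memB x (sB hx)).2,
      none C' _ fun x hx => (hb.memC x (sC hx)).2, none D' _ fun x hx => (hb.memD x (sD hx)).2] at e2
    omega
  obtain ⟨U, hU1, hU2, hU3⟩ := exists_units hirr (hb.nearBC.mono sB sC) (hb.nearCD.mono sC sD)
    (dBC.mono sB sC) (dBD.mono sB sD) (dCD.mono sC sD)
    (fun x hx => (fcount_mono sC _).trans (tourC x (sC hx))) hBD (by omega) (by omega)
    (by
      rcases hC with ⟨h1, h2⟩ | ⟨h1, h2⟩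
      · left
        refine ⟨?_, h2.mono sB sD⟩
        rw [h1] at sC
        exact Finset.subset_empty.1 sC
      · right
        refine ⟨by omega, lt_of_le_of_lt ?_ (h2 _ _ (by omega) (by omega))⟩
        unfold nonEdges
        refine (Finset.sum_le_sum_of_subset sD).trans (Finset.sum_le_sum fun y _ => ?_)
        exact fcount_mono sB _)
  -- The number of merges is chosen so that `Y` has `|B'| - |Z|` paths. The truncated subtraction is
  -- exact by `hAB`.
  obtain ⟨Y, hY1, hY2, hY3⟩ := exists_path_partition hirr m (A'.card + Z.length - B'.card) A'
    (fun x hx => (fcount_mono sA _).trans (tourA x (sA hx))) (by omega)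
  have hn2 : ((X ++ Y).flatten ++ U.flatten).Nodup := by
    rw [List.flatten_append, List.append_assoc]
    exact (((hY2.append hU2).append_left _).nodup_iff).2 nL
  obtain ⟨W, hW1, hW2, hW3⟩ := exists_join (H := H) (X := X ++ Y) (Y := U) hn2
    (S := A) (T := A) (S' := B) (T' := D)
    (by
      intro p hp
      rcases List.mem_append.1 hp with hp | hp
      · exact hX2 p hp
      · exact (hY3 p hp).mono sA sA)
    (fun p hp => (hU3 p hp).mono sB sD)
    (by rw [List.length_append]; omega) hb.nearAB
    (by rw [List.length_append]; omega)
  have hWL : W.flatten.Perm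
      (X.flatten ++ (A'.toList ++ (B'.toList ++ (C'.toList ++ D'.toList)))) := by
    refine hW2.trans ?_
    rw [List.flatten_append, List.append_assoc]
    exact (hY2.append hU2).append_left _
  exact hasHamiltonCycle_of_segs (hWL.nodup_iff.2 nL) (fun v => hWL.mem_iff.2 (covL v)) hW3
    hb.nearDA (by rw [hW1, List.length_append]; omega)

end Assembly

end Digraph

namespace Digraph

/-! ### Edge counts, greedy matchings and summed Ore inequalities -/

section Counting

open Classical

variable {V : Type*}

lemma fcount_union {α : Type*} {S T : Finset α} (h : Disjoint S T) (q : α → Prop) :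
    fcount (S ∪ T) q = fcount S q + fcount T q := by
  unfold fcount sel
  rw [Finset.filter_union, Finset.card_union_of_disjoint (Finset.disjoint_filter_filter h)]

lemma fcount_imp {α : Type*} (S : Finset α) {q q' : α → Prop} (h : ∀ x ∈ S, q x → q' x) :
    fcount S q ≤ fcount S q' := Finset.card_le_card fun x hx =>
  mem_sel.2 ⟨(mem_sel.1 hx).1, h x (mem_sel.1 hx).1 (mem_sel.1 hx).2⟩

lemma fcount_eq_zero {α : Type*} {S : Finset α} {q : α → Prop} (h : ∀ x ∈ S, ¬ q x) :
    fcount S q = 0 := by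
  by_contra hc
  obtain ⟨x, hx, hq⟩ := mem_of_fcount_pos (Nat.pos_of_ne_zero hc)
  exact h x hx hq

lemma outDeg_eq [Fintype V] (G : Digraph V) (x : V) :
    G.outDeg x = fcount Finset.univ (fun y => G.Adj x y) := rfl

lemma inDeg_eq [Fintype V] (G : Digraph V) (y : V) :
    G.inDeg y = fcount Finset.univ (fun x => G.Adj x y) := rfl

lemma edgeCount_eq_sum_left (G : Digraph V) (X Y : Finset V) :
    G.edgeCount X Y = ∑ x ∈ X, fcount Y (fun y => G.Adj x y) := by
  unfold edgeCount fcount sel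
  simp only [Finset.card_filter]
  rw [Finset.sum_product]

lemma edgeCount_eq_sum_right (G : Digraph V) (X Y : Finset V) :
    G.edgeCount X Y = ∑ y ∈ Y, fcount X (fun x => G.Adj x y) := by
  unfold edgeCount fcount sel
  simp only [Finset.card_filter]
  rw [Finset.sum_product_right]

lemma edgeCount_mono (G : Digraph V) {X Y X' Y' : Finset V} (hX : X ⊆ X') (hY : Y ⊆ Y') :
    G.edgeCount X Y ≤ G.edgeCount X' Y' := by
  unfold edgeCount
  exact Finset.card_le_card (Finset.filter_subset_filter _ (Finset.product_subset_product hX hY))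

lemma edgeCount_le_mul (G : Digraph V) (X Y : Finset V) :
    G.edgeCount X Y ≤ X.card * Y.card := by
  unfold edgeCount
  rw [← Finset.card_product]
  exact Finset.card_filter_le _ _

lemma edgeCount_rev (G : Digraph V) (X Y : Finset V) :
    G.rev.edgeCount X Y = G.edgeCount Y X := by
  rw [edgeCount_eq_sum_left, edgeCount_eq_sum_right]
  rfl

lemma edgeCount_add_nonEdges (G : Digraph V) (X Y : Finset V) :
    G.edgeCount X Y + G.nonEdges X Y = X.card * Y.card := by
  rw [edgeCount_eq_sum_right, nonEdges, ← Finset.sum_add_distrib]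
  simp only [fcount_add_not, Finset.sum_const, smul_eq_mul]
  ring

lemma IsOriented.irrefl {G : Digraph V} (h : G.IsOriented) (x : V) : ¬ G.Adj x x :=
  fun hx => h x x hx hx

lemma IsOriented.rev {G : Digraph V} (h : G.IsOriented) : G.rev.IsOriented :=
  fun x y hx => h y x hx

lemma IsOriented.fcount_add_le {G : Digraph V} (h : G.IsOriented) (S : Finset V) (x : V) :
    fcount S (fun y => G.Adj x y) + fcount S (fun y => G.Adj y x) ≤ S.card := by
  have h1 := fcount_add_not S (fun y => G.Adj x y)
  have h2 : fcount S (fun y => G.Adj y x) ≤ fcount S (fun y => ¬ G.Adj x y) :=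
    fcount_imp S fun y _ hy hxy => h x y hxy hy
  omega

lemma IsOriented.fcount_add_lt {G : Digraph V} (h : G.IsOriented) {S : Finset V} {x : V}
    (hx : x ∈ S) : fcount S (fun y => G.Adj x y) + fcount S (fun y => G.Adj y x) + 1 ≤ S.card := by
  have h1 := fcount_add_not S (fun y => G.Adj x y)
  have h2 : fcount S (fun y => G.Adj y x) < fcount S (fun y => ¬ G.Adj x y) := by
    refine Finset.card_lt_card (Finset.ssubset_iff_of_subset ?_ |>.2 ⟨x, ?_, ?_⟩)
    · intro y hy
      rw [mem_sel] at hy ⊢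
      exact ⟨hy.1, fun hxy => h x y hxy hy.2⟩
    · exact mem_sel.2 ⟨hx, h.irrefl x⟩
    · exact fun hc => h.irrefl x (mem_sel.1 hc).2
  omega

lemma IsOriented.two_mul_edgeCount {G : Digraph V} (h : G.IsOriented) (S : Finset V) :
    2 * G.edgeCount S S + S.card ≤ S.card * S.card := by
  have h1 := edgeCount_eq_sum_left G S S
  have h2 := edgeCount_eq_sum_right G S S
  have h3 : ∑ x ∈ S, (fcount S (fun y => G.Adj x y) + fcount S (fun y => G.Adj y x) + 1) ≤
      ∑ x ∈ S, S.card := Finset.sum_le_sum fun x hx => h.fcount_add_lt hx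
  rw [Finset.sum_add_distrib, Finset.sum_add_distrib, ← h1, ← h2] at h3
  simp only [Finset.sum_const, smul_eq_mul, mul_one] at h3
  omega

lemma IsOriented.edgeCount_add_le {G : Digraph V} (h : G.IsOriented) (S T : Finset V) :
    G.edgeCount S T + G.edgeCount T S ≤ S.card * T.card := by
  rw [edgeCount_eq_sum_left G S T, edgeCount_eq_sum_right G T S, ← Finset.sum_add_distrib]
  refine (Finset.sum_le_sum fun x _ => h.fcount_add_le T x).trans ?_
  simp

/-- Many edges from `X` to `Y` of bounded degrees contain many disjoint edges. -/
lemma exists_disjoint_edges {G : Digraph V} (hirr : ∀ x, ¬ G.Adj x x) (X Y : Finset V) (d : ℕ)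
    (hX : ∀ x ∈ X, fcount Y (fun y => G.Adj x y) ≤ d)
    (hY : ∀ y ∈ Y, fcount X (fun x => G.Adj x y) ≤ d) (k : ℕ)
    (h : 4 * k * d < G.edgeCount X Y) :
    ∃ M : List (V × V), M.length = k ∧ (M.map Prod.fst ++ M.map Prod.snd).Nodup ∧
      ∀ w ∈ M, w.1 ∈ X ∧ w.2 ∈ Y ∧ G.Adj w.1 w.2 := by
  induction k with
  | zero => exact ⟨[], by simp⟩
  | succ k ih =>
    obtain ⟨M, hM1, hM2, hM3⟩ := ih (lt_of_le_of_lt (by gcongr; omega) h)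
    set U := (M.map Prod.fst ++ M.map Prod.snd).toFinset with hU
    have hUc : U.card ≤ 2 * k := by
      refine (List.toFinset_card_le _).trans ?_
      simp only [List.length_append, List.length_map]
      omega
    -- At most `2 * k` vertices are in use; on each side they meet at most `2 * k * d` edges.
    have : ∃ x ∈ X \ U, ∃ y ∈ Y \ U, G.Adj x y := by
      by_contra hcon
      push Not at hcon
      have e1 : G.edgeCount X Y = ∑ x ∈ X ∩ U, fcount Y (fun y => G.Adj x y) +
          G.edgeCount (X \ U) Y := by
        rw [edgeCount_eq_sum_left, edgeCount_eq_sum_left, Finset.sum_inter_add_sum_sdiff]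
      have e2 : G.edgeCount (X \ U) Y = ∑ y ∈ Y ∩ U, fcount (X \ U) (fun x => G.Adj x y) := by
        rw [edgeCount_eq_sum_right, ← Finset.sum_inter_add_sum_sdiff Y U]
        rw [Finset.sum_eq_zero (s := Y \ U), add_zero]
        intro y hy
        exact fcount_eq_zero fun x hx => hcon x hx y hy
      have e3 : ∑ x ∈ X ∩ U, fcount Y (fun y => G.Adj x y) ≤ (X ∩ U).card * d := by
        rw [← smul_eq_mul]
        exact Finset.sum_le_card_nsmul _ _ _ fun x hx => hX x (Finset.mem_inter.1 hx).1
      have e4 : ∑ y ∈ Y ∩ U, fcount (X \ U) (fun x => G.Adj x y) ≤ (Y ∩ U).card * d := by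
        rw [← smul_eq_mul]
        exact Finset.sum_le_card_nsmul _ _ _ fun y hy =>
          (fcount_mono Finset.sdiff_subset _).trans (hY y (Finset.mem_inter.1 hy).1)
      have e5 : (X ∩ U).card * d ≤ 2 * k * d :=
        Nat.mul_le_mul_right _ ((Finset.card_le_card Finset.inter_subset_right).trans hUc)
      have e6 : (Y ∩ U).card * d ≤ 2 * k * d :=
        Nat.mul_le_mul_right _ ((Finset.card_le_card Finset.inter_subset_right).trans hUc)
      nlinarith
    obtain ⟨x, hx, y, hy, hxy⟩ := this
    rw [Finset.mem_sdiff, hU, List.mem_toFinset, List.mem_append, not_or] at hx hy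
    have hne : x ≠ y := fun e => hirr x (by rw [← e] at hxy; exact hxy)
    refine ⟨(x, y) :: M, by simp [hM1], ?_, ?_⟩
    · simp only [List.map_cons, List.cons_append]
      rw [List.nodup_cons]
      refine ⟨?_, ?_⟩
      · rw [List.mem_append, List.mem_cons]
        rintro (h | h | h)
        · exact hx.2.1 h
        · exact hne h
        · exact hx.2.2 h
      · rw [List.nodup_middle, List.nodup_cons]
        exact ⟨by rw [List.mem_append]; rintro (h | h); exacts [hy.2.1 h, hy.2.2 h], hM2⟩
    · intro w hw
      rcases List.mem_cons.1 hw with rfl | hw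
      · exact ⟨hx.1, hy.1, hxy⟩
      · exact hM3 w hw

variable [Fintype V]

lemma OreCondition.rev {G : Digraph V} (h : G.OreCondition) : G.rev.OreCondition := by
  intro x y hxy hadj
  have := h y x hxy.symm hadj
  rw [add_comm]
  exact this

lemma card_eq_of_partition {A B C D : Finset V} (hu : ∀ x, x ∈ A ∪ B ∪ C ∪ D)
    (h1 : Disjoint A B) (h2 : Disjoint (A ∪ B) C) (h3 : Disjoint (A ∪ B ∪ C) D) (q : V → Prop) :
    fcount Finset.univ q = fcount A q + fcount B q + fcount C q + fcount D q := by
  rw [← fcount_union h1, ← fcount_union h2, ← fcount_union h3]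
  congr 1
  exact (Finset.eq_univ_iff_forall.2 hu).symm

/-- Summing the Ore condition over the pairs of two disjoint sets. -/
lemma OreCondition.sum_disjoint {G : Digraph V} (h : G.OreCondition) (T : ℝ)
    (hTn : T = (3 * (Fintype.card V : ℝ) - 3) / 4) (X Y : Finset V) (hXY : Disjoint X Y) :
    T * (X.card * Y.card - G.edgeCount X Y) ≤
      Y.card * ∑ x ∈ X, (G.outDeg x : ℝ) + X.card * ∑ y ∈ Y, (G.inDeg y : ℝ) := by
  -- An adjacent pair carries no information; subtracting `T` for it leaves the trivial bound by 0,
  -- so all pairs can be summed at once.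
  have key : ∀ x ∈ X, ∀ y ∈ Y, T - T * (if G.Adj x y then (1 : ℝ) else 0) ≤
      (G.outDeg x : ℝ) + (G.inDeg y : ℝ) := by
    intro x hx y hy
    by_cases hxy : G.Adj x y
    · rw [if_pos hxy]
      have : (0 : ℝ) ≤ (G.outDeg x : ℝ) + (G.inDeg y : ℝ) := by positivity
      linarith
    · rw [if_neg hxy]
      have := h x y (fun e => Finset.disjoint_left.1 hXY hx (e ▸ hy)) hxy
      linarith
  have h1 := Finset.sum_le_sum fun x hx => Finset.sum_le_sum fun y hy => key x hx y hy
  have h2 : (G.edgeCount X Y : ℝ) = ∑ x ∈ X, ∑ y ∈ Y, (if G.Adj x y then (1 : ℝ) else 0) := by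
    rw [edgeCount_eq_sum_left]
    unfold fcount sel
    push_cast [Finset.card_filter]
    rfl
  simp only [Finset.sum_add_distrib, Finset.sum_sub_distrib, Finset.sum_const, nsmul_eq_mul,
    ← Finset.mul_sum] at h1
  rw [← h2] at h1
  linarith

/-- The Ore condition concerns distinct vertices, so the diagonal is taken out and each degree is
counted `|X| - 1` times. -/
lemma OreCondition.sum_self {G : Digraph V} (h : G.OreCondition) (T : ℝ) (hT : 0 ≤ T)
    (hTn : T = (3 * (Fintype.card V : ℝ) - 3) / 4) (X : Finset V) :
    T * (X.card * X.card - X.card - G.edgeCount X X) ≤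
      (X.card - 1) * (∑ x ∈ X, (G.outDeg x : ℝ) + ∑ y ∈ X, (G.inDeg y : ℝ)) := by
  have key : ∀ x ∈ X, ∀ y ∈ X, T - T * (if G.Adj x y then (1 : ℝ) else 0) -
      (if x = y then T else 0) ≤ (G.outDeg x : ℝ) + (G.inDeg y : ℝ) -
        (if x = y then (G.outDeg x : ℝ) + (G.inDeg y : ℝ) else 0) := by
    intro x hx y hy
    by_cases he : x = y
    · rw [if_pos he, if_pos he]
      have : (0 : ℝ) ≤ (if G.Adj x y then (1 : ℝ) else 0) := by split_ifs <;> norm_num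
      have := mul_nonneg hT this
      linarith
    rw [if_neg he, if_neg he]
    by_cases hxy : G.Adj x y
    · rw [if_pos hxy]
      have : (0 : ℝ) ≤ (G.outDeg x : ℝ) + (G.inDeg y : ℝ) := by positivity
      linarith
    · rw [if_neg hxy]
      have := h x y he hxy
      linarith
  have h1 := Finset.sum_le_sum fun x hx => Finset.sum_le_sum fun y hy => key x hx y hy
  have h2 : (G.edgeCount X X : ℝ) = ∑ x ∈ X, ∑ y ∈ X, (if G.Adj x y then (1 : ℝ) else 0) := by
    rw [edgeCount_eq_sum_left]
    unfold fcount sel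
    push_cast [Finset.card_filter]
    rfl
  have h3 : ∀ f : V → V → ℝ, ∑ x ∈ X, ∑ y ∈ X, (if x = y then f x y else 0) =
      ∑ x ∈ X, f x x := by
    intro f
    refine Finset.sum_congr rfl fun x hx => ?_
    rw [Finset.sum_ite_eq, if_pos hx]
  simp only [Finset.sum_sub_distrib] at h1
  rw [h3 (fun _ _ => T), h3 (fun x y => (G.outDeg x : ℝ) + (G.inDeg y : ℝ))] at h1
  simp only [Finset.sum_add_distrib, Finset.sum_const, nsmul_eq_mul,
    ← Finset.mul_sum] at h1
  rw [← h2] at h1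
  linarith

end Counting

end Digraph

namespace Digraph

/-! ### Disjoint edges that compensate a surplus of D over B -/

section Balance

open Classical

/-- With no edges inside D, averaging would give `T ≤ n - d`, that is `d ≤ n / 4 + 3 / 4`. The few
edges inside cost at most `0.03 * k`. -/
lemma card_le_of_sum_self {n d e S k T : ℝ} (hT : T = (3 * n - 3) / 4) (hn : 1000 ≤ n)
    (hd1 : 0.24 * n ≤ d) (hd2 : d ≤ 0.26 * n) (h1 : T * (d * d - d - e) ≤ (d - 1) * S)
    (h2 : S ≤ d * (n - d) + 2 * e) (he : 0 ≤ e) (he2 : e ≤ 4 * k * (n / 10000)) (hk : 1 ≤ k) :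
    d ≤ n / 4 + 3 / 4 + 0.03 * k := by
  by_contra hcon
  push Not at hcon
  have e1 : (d - 1) * S ≤ (d - 1) * (d * (n - d) + 2 * e) :=
    mul_le_mul_of_nonneg_left h2 (by linarith)
  have e2 : d * (d - 1) * (d - n / 4 - 3 / 4) ≤ e * (T + 2 * (d - 1)) := by
    rw [hT] at *
    nlinarith
  have e3 : e * (T + 2 * (d - 1)) ≤ e * (1.3 * n) :=
    mul_le_mul_of_nonneg_left (by rw [hT]; linarith) he
  have e4 : e * (1.3 * n) ≤ 4 * k * (n / 10000) * (1.3 * n) :=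
    mul_le_mul_of_nonneg_right he2 (by linarith)
  have e5 : 0.05 * (n * n) ≤ d * (d - 1) := by nlinarith
  have e6 : 0.05 * (n * n) * (0.03 * k) ≤ d * (d - 1) * (d - n / 4 - 3 / 4) :=
    mul_le_mul e5 (by linarith) (by linarith) (by nlinarith)
  have e7 : 0 < n * n * k := by positivity
  nlinarith

/-- A vertex of outdegree `x` that misses almost all of D forces indegrees at least `T - x` there.
The average indegree in D is at most about `b + c / 2`, since D sends about `d * (a + c / 2)` edges.
-/
lemma lower_bound_out {n a b c d k T e x s : ℝ} (hT : T = (3 * n - 3) / 4) (hn : 10000 ≤ n)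
    (hsum : a + b + c + d = n) (hb2 : b ≤ 0.26 * n) (hd1 : 0.24 * n ≤ d) (ha : 0 ≤ a)
    (hbd : b ≤ d) (hkn : k ≤ 0.02 * n)
    (h : (d - n / 10000) * (T - x) ≤ s)
    (hs : s ≤ d * (n - d) + 2 * e - (d * (a + c / 2) - n * n / 1000))
    (he : e ≤ 4 * k * (n / 10000)) :
    (a - 1) / 2 + b + 0.01 * k - 0.035 * n ≤ x := by
  by_contra hcon
  push Not at hcon
  have e1 : b + c / 2 + 0.02 * n ≤ T - x := by
    rw [hT]; linarith
  have e2 : (d - n / 10000) * (b + c / 2 + 0.02 * n) ≤ (d - n / 10000) * (T - x) :=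
    mul_le_mul_of_nonneg_left e1 (by linarith)
  have e3 : d * (n - d) - d * (a + c / 2) = d * (b + c / 2) := by rw [← hsum]; ring
  have e4 : k * n ≤ 0.02 * n * n := mul_le_mul_of_nonneg_right hkn (by linarith)
  have e5 : n * (b + c / 2) ≤ n * n := mul_le_mul_of_nonneg_left (by linarith) (by linarith)
  have e6 : 0.24 * n * n ≤ d * n := mul_le_mul_of_nonneg_right hd1 (by linarith)
  nlinarith

/-- The average outdegree in A is at most `v`. Vertices off the cover have outdegree at least `T -
i₀`, the `x₁` others fall short of `v` by at most `0.035 * n`, so `T - i₀ - v ≤ 0.2 * x₁`. The size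
relations give `T - i₀ - v ≥ 0.96 * k - x₀ / 2`, which is too large because `x₁ ≤ x₀ < k`. -/
lemma contradiction_of_small_cover {n a b c d k T x₀ x₁ i₀ s SA : ℝ} (hT : T = (3 * n - 3) / 4)
    (hn : 10000 ≤ n) (hsum : a + b + c + d = n) (hdb : d = b + k) (hk : 1 ≤ k)
    (hkn : k ≤ 0.02 * n) (ha : n / 5 ≤ a) (hd : d ≤ n / 4 + 3 / 4 + 0.03 * k)
    (hx1 : x₁ ≤ x₀) (hx0 : 0 ≤ x₁) (hs : x₀ + c + 1 ≤ s + k) (hsc : s ≤ c)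
    (hi : i₀ ≤ b + (s - 1) / 2 + (c - s) + x₀)
    (hSA : SA ≤ a * ((a - 1) / 2 + b + 0.01 * k))
    (hSA2 : x₁ * ((a - 1) / 2 + b + 0.01 * k - 0.035 * n) + (a - x₁) * (T - i₀) ≤ SA) :
    False := by
  set v := (a - 1) / 2 + b + 0.01 * k with hv
  have e1 : (a - x₁) * (T - i₀ - v) ≤ 0.035 * n * x₁ := by nlinarith
  have e2 : T - i₀ - v ≤ 0.2 * x₁ := by
    by_contra hcon
    push Not at hcon
    have : (0.18 * n) * (0.2 * x₁) ≤ (a - x₁) * (0.2 * x₁) :=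
      mul_le_mul_of_nonneg_right (by linarith) (by linarith)
    have h3 : (a - x₁) * (0.2 * x₁) < (a - x₁) * (T - i₀ - v) :=
      mul_lt_mul_of_pos_left hcon (by linarith)
    nlinarith
  rw [hT] at e2
  linarith

/-- Averaging the Ore condition over A × D would need `T` to be at most `(a - 1) / 2 + 2 * b + c` up
to a small multiple of `k`. With `d = b + k`, the upper bound on `d` and `c < k`, this sum falls
short of `T` by a constant multiple of `k`. -/
lemma contradiction_of_few_vertices {n a b c d k T e SA SI : ℝ} (hT : T = (3 * n - 3) / 4)
    (hn : 10000 ≤ n) (hsum : a + b + c + d = n) (hdb : d = b + k) (hk : 1 ≤ k)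
    (ha : n / 5 ≤ a) (hd : d ≤ n / 4 + 3 / 4 + 0.03 * k) (hd1 : 0.24 * n ≤ d)
    (hc : c + 1 ≤ k) (he0 : 0 ≤ e) (he : e ≤ 4 * k * (n / 10000))
    (hSA : SA ≤ a * ((a - 1) / 2 + b + 0.01 * k)) (hSI : SI ≤ d * (b + c) + e)
    (h : T * (a * d - e) ≤ d * SA + a * SI) : False := by
  have e1 : d * SA ≤ d * (a * ((a - 1) / 2 + b + 0.01 * k)) :=
    mul_le_mul_of_nonneg_left hSA (by linarith)
  have e2 : a * SI ≤ a * (d * (b + c) + e) := mul_le_mul_of_nonneg_left hSI (by linarith)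
  have e3 : a * d * (T - (a - 1) / 2 - 2 * b - c - 0.01 * k) ≤ e * (a + T) := by nlinarith
  have e4 : e * (a + T) ≤ 4 * k * (n / 10000) * (a + T) :=
    mul_le_mul_of_nonneg_right he (by rw [hT]; linarith)
  have e5 : 0 ≤ T - (a - 1) / 2 - 2 * b - c - 0.01 * k - 0.05 * k := by
    rw [hT]; linarith
  have e6 : T ≤ 3.75 * a := by rw [hT]; linarith
  have e7 : 4 * k * (n / 10000) * (a + T) ≤ 4 * k * (n / 10000) * (4.75 * a) :=
    mul_le_mul_of_nonneg_left (by linarith) (by positivity)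
  have e8 : a * d * (0.05 * k) ≤ a * d * (T - (a - 1) / 2 - 2 * b - c - 0.01 * k) :=
    mul_le_mul_of_nonneg_left (by linarith) (by nlinarith)
  have e9 : (0.24 * n) * (a * k) ≤ d * (a * k) := mul_le_mul_of_nonneg_right hd1 (by nlinarith)
  have : 0 < n * (a * k) := by
    have : 0 < a := by linarith
    positivity
  nlinarith

variable {V : Type*} [Fintype V]

set_option maxHeartbeats 1000000 in
/-- If `|D| = |B| + k` in a partition that looks like the extremal one, then the Ore condition
yields `k` disjoint edges from `A ∪ D` to `C ∪ D`. -/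
theorem exists_balancing_edges {G : Digraph V} (hG : G.IsOriented) (hO : G.OreCondition)
    {A B C D : Finset V} (hu : ∀ x, x ∈ A ∪ B ∪ C ∪ D)
    (h1 : Disjoint A B) (h2 : Disjoint (A ∪ B) C) (h3 : Disjoint (A ∪ B ∪ C) D)
    {k : ℕ} (hk : 1 ≤ k) (hDB : D.card = B.card + k) {n : ℝ} (hnV : (Fintype.card V : ℝ) = n)
    (hn : 10000 ≤ n) (Δ : ℕ) (hΔ : (Δ : ℝ) ≤ n / 10000)
    (hP : ∀ x ∈ A ∪ D, fcount (C ∪ D) (fun y => G.Adj x y) ≤ Δ)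
    (hQ : ∀ y ∈ C ∪ D, fcount (A ∪ D) (fun x => G.Adj x y) ≤ Δ)
    (ha : n / 5 ≤ A.card) (hb1 : 0.24 * n ≤ B.card) (hd2 : (D.card : ℝ) ≤ 0.26 * n)
    (hout : D.card * ((A.card : ℝ) + C.card / 2) - n * n / 1000 ≤ ∑ x ∈ D, (G.outDeg x : ℝ)) :
    ∃ M : List (V × V), M.length = k ∧ (M.map Prod.fst ++ M.map Prod.snd).Nodup ∧
      ∀ w ∈ M, w.1 ∈ A ∪ D ∧ w.2 ∈ C ∪ D ∧ G.Adj w.1 w.2 := by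
  have hAC : Disjoint A C := h2.mono_left Finset.subset_union_left
  have hAD : Disjoint A D := h3.mono_left (Finset.subset_union_left.trans Finset.subset_union_left)
  have hDC : Disjoint D C := (h3.mono_left Finset.subset_union_right).symm
  have hPC : Disjoint (A ∪ D) C := Finset.disjoint_union_left.2 ⟨hAC, hDC⟩
  have hsplit := fun q => card_eq_of_partition hu h1 h2 h3 q
  -- Many edges into D already contain `k` disjoint ones by the greedy argument. Otherwise D is
  -- almost independent and receives almost nothing from A.
  by_cases hPD : 4 * k * Δ < G.edgeCount (A ∪ D) D
  · obtain ⟨M, m1, m2, m3⟩ := exists_disjoint_edges hG.irrefl (A ∪ D) D Δ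
      (fun x hx => (fcount_mono Finset.subset_union_right _).trans (hP x hx))
      (fun y hy => hQ y (Finset.mem_union_right _ hy)) k hPD
    exact ⟨M, m1, m2, fun w hw => ⟨(m3 w hw).1, Finset.mem_union_right _ (m3 w hw).2.1,
      (m3 w hw).2.2⟩⟩
  push Not at hPD
  -- real parameters
  obtain ⟨T, hT⟩ : ∃ T : ℝ, T = (3 * n - 3) / 4 := ⟨_, rfl⟩
  have hT0 : 0 ≤ T := by rw [hT]; linarith
  have hTn : T = (3 * (Fintype.card V : ℝ) - 3) / 4 := by rw [hnV]; exact hT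
  have hdb : (D.card : ℝ) = B.card + k := by exact_mod_cast hDB
  have hkR : (1 : ℝ) ≤ k := by exact_mod_cast hk
  have hd1 : 0.24 * n ≤ (D.card : ℝ) := by linarith
  have hb2 : (B.card : ℝ) ≤ 0.26 * n := by linarith
  have hkn : (k : ℝ) ≤ 0.02 * n := by linarith
  have hsum : (A.card : ℝ) + B.card + C.card + D.card = n := by
    have := hsplit (fun _ => True)
    unfold fcount sel at this
    simp only [Finset.filter_true, Finset.card_univ] at this
    rw [← hnV]
    exact_mod_cast this.symm
  have sumOut : ∀ X : Finset V, ∑ x ∈ X, (G.outDeg x : ℝ) = G.edgeCount X A + G.edgeCount X B +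
      G.edgeCount X C + G.edgeCount X D := by
    intro X
    simp only [edgeCount_eq_sum_left, outDeg_eq, hsplit]
    push_cast
    simp only [Finset.sum_add_distrib]
  have sumIn : ∀ X : Finset V, ∑ x ∈ X, (G.inDeg x : ℝ) = G.edgeCount A X + G.edgeCount B X +
      G.edgeCount C X + G.edgeCount D X := by
    intro X
    simp only [edgeCount_eq_sum_right, inDeg_eq, hsplit]
    push_cast
    simp only [Finset.sum_add_distrib]
  have hPDsplit : (G.edgeCount (A ∪ D) D : ℝ) = G.edgeCount A D + G.edgeCount D D := by
    rw [edgeCount_eq_sum_left, edgeCount_eq_sum_left, edgeCount_eq_sum_left,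
      Finset.sum_union hAD]
    push_cast; rfl
  have hkΔ : (k : ℝ) * Δ ≤ k * (n / 10000) := mul_le_mul_of_nonneg_left hΔ (by linarith)
  have hPD' : (G.edgeCount (A ∪ D) D : ℝ) ≤ 4 * k * (n / 10000) := by
    have : (G.edgeCount (A ∪ D) D : ℝ) ≤ 4 * k * Δ := by exact_mod_cast hPD
    linarith
  have pos : ∀ X Y : Finset V, (0 : ℝ) ≤ G.edgeCount X Y := fun X Y => by positivity
  have hAD' : (G.edgeCount A D : ℝ) ≤ 4 * k * (n / 10000) := by
    have := pos D D
    linarith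
  have hDD' : (G.edgeCount D D : ℝ) ≤ 4 * k * (n / 10000) := by
    have := pos A D
    linarith
  have hor : ∀ X Y : Finset V, (G.edgeCount X Y : ℝ) + G.edgeCount Y X ≤ X.card * Y.card :=
    fun X Y => by exact_mod_cast hG.edgeCount_add_le X Y
  have hle : ∀ X Y : Finset V, (G.edgeCount X Y : ℝ) ≤ X.card * Y.card :=
    fun X Y => by exact_mod_cast G.edgeCount_le_mul X Y
  -- the sum over `D`
  have hS : ∑ x ∈ D, (G.outDeg x : ℝ) + ∑ x ∈ D, (G.inDeg x : ℝ) ≤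
      D.card * (n - D.card) + 2 * G.edgeCount D D := by
    rw [sumOut, sumIn, ← hsum]
    have := hor D A
    have := hor D B
    have := hor D C
    linarith
  have hdle := card_le_of_sum_self hT (by linarith) hd1 hd2 (hO.sum_self T hT0 hTn D) hS
    (pos D D) hDD' hkR
  -- the sum over `A`
  have hSA : (G.edgeCount A C : ℝ) ≤ k * (n / 10000) →
      ∑ x ∈ A, (G.outDeg x : ℝ) ≤ A.card * (((A.card : ℝ) - 1) / 2 + B.card + 0.01 * k) := by
    intro hAC'
    rw [sumOut]
    have e1 : 2 * (G.edgeCount A A : ℝ) + A.card ≤ A.card * A.card := by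
      exact_mod_cast hG.two_mul_edgeCount A
    have e2 := hle A B
    have e3 : (k : ℝ) * n ≤ k * (5 * A.card) :=
      mul_le_mul_of_nonneg_left (by linarith) (by linarith)
    linarith
  by_cases hkC : k ≤ C.card
  · -- matching edges into `C`
    by_cases hall : ∀ S ⊆ C, S.card + k ≤
        fcount (A ∪ D) (fun x => ∃ y ∈ S, G.Adj x y) + C.card
    · obtain ⟨M, m1, m2, m3, m4⟩ := exists_matching_of_deficiency (A ∪ D) C G.Adj k hkC hall
      refine ⟨M, m1, nodup_append_of m2 m3 ?_, fun w hw =>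
        ⟨(m4 w hw).1, Finset.mem_union_left _ (m4 w hw).2.1, (m4 w hw).2.2⟩⟩
      intro x hx hx'
      obtain ⟨w, hw, rfl⟩ := List.mem_map.1 hx
      obtain ⟨w', hw', he⟩ := List.mem_map.1 hx'
      exact Finset.disjoint_left.1 hPC (m4 w hw).1 (he ▸ (m4 w' hw').2.1)
    exfalso
    push Not at hall
    -- Failure of the deficiency condition means that `X₀` and `C \ S`, together fewer than `k`
    -- vertices, cover all edges from A ∪ D to C. With degrees at most `Δ` this makes `e(A, C)`
    -- negligible.
    obtain ⟨S, hSC, hS⟩ := hall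
    set X₀ := sel (A ∪ D) (fun x => ∃ y ∈ S, G.Adj x y) with hX₀
    rw [← card_sel, ← hX₀] at hS
    have hSle := Finset.card_le_card hSC
    have hsd := Finset.card_sdiff_add_card_eq_card hSC
    have hAC' : (G.edgeCount A C : ℝ) ≤ k * (n / 10000) := by
      have e1 : G.edgeCount A C ≤ G.edgeCount (A ∪ D) C :=
        edgeCount_mono G Finset.subset_union_left subset_rfl
      have e2 : G.edgeCount (A ∪ D) C = G.edgeCount (A ∪ D) S + G.edgeCount (A ∪ D) (C \ S) := by
        rw [edgeCount_eq_sum_right, edgeCount_eq_sum_right, edgeCount_eq_sum_right,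
          add_comm, Finset.sum_sdiff hSC]
      have e3 : G.edgeCount (A ∪ D) (C \ S) ≤ (C \ S).card * Δ := by
        rw [edgeCount_eq_sum_right, ← smul_eq_mul]
        exact Finset.sum_le_card_nsmul _ _ _ fun y hy =>
          hQ y (Finset.mem_union_left _ (Finset.sdiff_subset hy))
      have e4 : G.edgeCount (A ∪ D) S ≤ X₀.card * Δ := by
        rw [edgeCount_eq_sum_left, ← smul_eq_mul]
        have hX₀s : X₀ ⊆ A ∪ D := sel_subset _ _
        rw [← Finset.sum_subset hX₀s]
        · refine Finset.sum_le_card_nsmul _ _ _ fun x hx => ?_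
          exact (fcount_mono (hSC.trans Finset.subset_union_left) _).trans (hP x (hX₀s hx))
        · intro x hx hx0
          exact fcount_eq_zero fun y hy hxy => hx0 (mem_sel.2 ⟨hx, y, hy, hxy⟩)
      have e5 : G.edgeCount A C ≤ k * Δ := by
        have e6 : (X₀.card + (C \ S).card) * Δ ≤ k * Δ := Nat.mul_le_mul_right _ (by omega)
        rw [add_mul] at e6
        exact e1.trans (e2.le.trans ((Nat.add_le_add e4 e3).trans e6))
      have e6 : (G.edgeCount A C : ℝ) ≤ k * Δ := by exact_mod_cast e5
      linarith
    -- a vertex of small indegree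
    have hex : ∃ c ∈ S, 2 * fcount S (fun x => G.Adj x c) + 1 ≤ S.card := by
      by_contra hcon
      push Not at hcon
      have e1 := hG.two_mul_edgeCount S
      have e2 : S.card * S.card ≤ ∑ c ∈ S, 2 * fcount S (fun x => G.Adj x c) := by
        rw [← smul_eq_mul]
        exact Finset.card_nsmul_le_sum _ _ _ fun c hc => by have := hcon c hc; omega
      rw [← Finset.mul_sum, ← edgeCount_eq_sum_right] at e2
      omega
    obtain ⟨c, hcS, hc⟩ := hex
    have hin : G.inDeg c + S.card ≤ B.card + fcount S (fun x => G.Adj x c) + C.card + X₀.card := by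
      rw [inDeg_eq, hsplit]
      have e1 : fcount A (fun x => G.Adj x c) + fcount D (fun x => G.Adj x c) ≤ X₀.card := by
        rw [← fcount_union hAD, hX₀, card_sel]
        exact fcount_imp _ fun x _ hx => ⟨c, hcS, hx⟩
      have e2 := fcount_le_card B (fun x => G.Adj x c)
      have e3 : fcount C (fun x => G.Adj x c) =
          fcount (C \ S) (fun x => G.Adj x c) + fcount S (fun x => G.Adj x c) := by
        rw [← fcount_union Finset.sdiff_disjoint, Finset.sdiff_union_of_subset hSC]
      have e4 := fcount_le_card (C \ S) (fun x => G.Adj x c)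
      omega
    have hlow : ∀ x ∈ A \ X₀, T - G.inDeg c ≤ G.outDeg x := by
      intro x hx
      rw [Finset.mem_sdiff] at hx
      have hxc : ¬ G.Adj x c := fun h =>
        hx.2 (mem_sel.2 ⟨Finset.mem_union_left _ hx.1, c, hcS, h⟩)
      have := hO x c (fun e => Finset.disjoint_left.1 hAC hx.1 (e ▸ hSC hcS)) hxc
      rw [← hTn] at this
      linarith
    -- Vertices of A in the cover may send an edge to `c`, so their outdegrees are bounded through
    -- their non-neighbours in D instead.
    have hlow2 : ∀ x ∈ A, ((A.card : ℝ) - 1) / 2 + B.card + 0.01 * k - 0.035 * n ≤ G.outDeg x := by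
      intro x hx
      have hx' := hP x (Finset.mem_union_left _ hx)
      by_cases hTx : T ≤ G.outDeg x
      · have hc0 : (0 : ℝ) ≤ C.card := by positivity
        linarith
      push Not at hTx
      refine lower_bound_out (c := C.card) (d := D.card) (e := G.edgeCount D D)
        (s := ∑ y ∈ D, (G.inDeg y : ℝ)) hT hn hsum hb2 hd1
        (by positivity) (by linarith) hkn ?_ (by linarith) hDD'
      have e1 : (sel D (fun y => ¬ G.Adj x y)).card • (T - (G.outDeg x : ℝ)) ≤
          ∑ y ∈ sel D (fun y => ¬ G.Adj x y), (G.inDeg y : ℝ) := by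
        refine Finset.card_nsmul_le_sum _ _ _ fun y hy => ?_
        rw [mem_sel] at hy
        have := hO x y (fun e => Finset.disjoint_left.1 hAD hx (e ▸ hy.1)) hy.2
        rw [← hTn] at this
        linarith
      have e2 : ∑ y ∈ sel D (fun y => ¬ G.Adj x y), (G.inDeg y : ℝ) ≤ ∑ y ∈ D, (G.inDeg y : ℝ) :=
        Finset.sum_le_sum_of_subset_of_nonneg (sel_subset _ _) fun _ _ _ => by positivity
      have e3 : (D.card : ℝ) - n / 10000 ≤ (sel D (fun y => ¬ G.Adj x y)).card := by
        rw [card_sel]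
        have e4 := fcount_add_not D (fun y => G.Adj x y)
        have e5 : fcount D (fun y => G.Adj x y) ≤ Δ :=
          (fcount_mono Finset.subset_union_right _).trans hx'
        have e6 : (fcount D (fun y => G.Adj x y) : ℝ) + fcount D (fun y => ¬ G.Adj x y) = D.card := by
          exact_mod_cast e4
        have e7 : (fcount D (fun y => G.Adj x y) : ℝ) ≤ Δ := by exact_mod_cast e5
        linarith
      rw [nsmul_eq_mul] at e1
      have e8 := mul_le_mul_of_nonneg_right e3 (show 0 ≤ T - (G.outDeg x : ℝ) by linarith)
      linarith
    have hsumA : ((A ∩ X₀).card : ℝ) * (((A.card : ℝ) - 1) / 2 + B.card + 0.01 * k - 0.035 * n) +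
        (A.card - (A ∩ X₀).card) * (T - G.inDeg c) ≤ ∑ x ∈ A, (G.outDeg x : ℝ) := by
      rw [← Finset.sum_inter_add_sum_sdiff A X₀]
      have e1 := Finset.card_nsmul_le_sum (A ∩ X₀) (fun x => (G.outDeg x : ℝ)) _
        fun x hx => hlow2 x (Finset.mem_inter.1 hx).1
      have e2 := Finset.card_nsmul_le_sum (A \ X₀) (fun x => (G.outDeg x : ℝ)) _ hlow
      have e3 : ((A \ X₀).card : ℝ) = A.card - (A ∩ X₀).card := by
        have := Finset.card_sdiff_add_card_inter A X₀
        rw [← this]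
        push_cast
        ring
      rw [nsmul_eq_mul] at e1 e2
      rw [e3] at e2
      linarith
    refine contradiction_of_small_cover (x₀ := X₀.card) (x₁ := (A ∩ X₀).card) (i₀ := G.inDeg c)
      (s := S.card) hT hn hsum hdb hkR hkn ha hdle ?_ (by positivity) ?_ ?_ ?_ (hSA hAC') hsumA
    · exact_mod_cast Finset.card_le_card Finset.inter_subset_right
    · exact_mod_cast hS
    · exact_mod_cast hSle
    · have e1 : (G.inDeg c : ℝ) + S.card ≤
          B.card + fcount S (fun x => G.Adj x c) + C.card + X₀.card := by exact_mod_cast hin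
      have e2 : 2 * (fcount S (fun x => G.Adj x c) : ℝ) + 1 ≤ S.card := by exact_mod_cast hc
      linarith
  · exfalso
    push Not at hkC
    have hAC' : (G.edgeCount A C : ℝ) ≤ k * (n / 10000) := by
      have e1 : G.edgeCount A C ≤ C.card * Δ := by
        rw [edgeCount_eq_sum_right, ← smul_eq_mul]
        exact Finset.sum_le_card_nsmul _ _ _ fun y hy =>
          (fcount_mono Finset.subset_union_left _).trans (hQ y (Finset.mem_union_left _ hy))
      have e2 : G.edgeCount A C ≤ k * Δ := e1.trans (Nat.mul_le_mul_right _ hkC.le)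
      have e3 : (G.edgeCount A C : ℝ) ≤ k * Δ := by exact_mod_cast e2
      linarith
    -- Here C has fewer than `k` vertices and cannot hold the matching; the Ore condition summed
    -- over A × D rules this case out.
    refine contradiction_of_few_vertices (c := C.card) (e := G.edgeCount (A ∪ D) D) hT hn hsum hdb
      hkR ha hdle hd1 (by exact_mod_cast hkC) (pos _ _) hPD' (hSA hAC')
      (SI := ∑ y ∈ D, (G.inDeg y : ℝ)) ?_ ?_
    · rw [sumIn, hPDsplit]
      have e1 := hle B D
      have e2 := hle C D
      linarith
    · have e1 := hO.sum_disjoint T hTn A D hAD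
      have e2 : T * (G.edgeCount A D : ℝ) ≤ T * G.edgeCount (A ∪ D) D :=
        mul_le_mul_of_nonneg_left (by rw [hPDsplit]; have := pos D D; linarith) hT0
      linarith

end Balance

end Digraph

namespace Digraph

/-! ### Cleaned-up extremal structure, and the Hamilton cycle for balanced types -/

section Frame

open Classical

variable {V : Type*} [Fintype V]

/-- The structure of an extremal digraph after the removal of atypical vertices: `A`, `B`, `C`,
`D` are disjoint and cover all but few vertices, the pairs `AB`, `BC`, `CD`, `DA` are nearly
complete, `A` and `C` are near-tournaments, and either `C` is empty and `BD` is nearly complete or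
`C` is large compared to the errors. -/
structure Frame (G : Digraph V) (A B C D : Finset V) (m w : ℕ) : Prop where
  oriented : G.IsOriented
  ore : G.OreCondition
  disjAB : Disjoint A B
  disjAC : Disjoint A C
  disjAD : Disjoint A D
  disjBC : Disjoint B C
  disjBD : Disjoint B D
  disjCD : Disjoint C D
  nearAB : G.Near A B m
  nearBC : G.Near B C m
  nearCD : G.Near C D m
  nearDA : G.Near D A m
  tourA : ∀ x ∈ A, fcount A (fun y => ¬ (G.Adj x y ∨ G.Adj y x)) ≤ m
  tourC : ∀ x ∈ C, fcount C (fun y => ¬ (G.Adj x y ∨ G.Adj y x)) ≤ m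
  dichotomy : (C = ∅ ∧ G.Near B D m) ∨ 1000 * m ≤ C.card
  one_le : 1 ≤ w
  w_le : 3000 * w ≤ m
  m_le : (m : ℝ) ≤ Fintype.card V / 1000
  w_small : (w : ℝ) ≤ Fintype.card V / 1000000000
  B_lower : (Fintype.card V : ℝ) / 4 - w ≤ B.card
  B_upper : (B.card : ℝ) ≤ Fintype.card V / 4 + w
  D_lower : (Fintype.card V : ℝ) / 4 - w ≤ D.card
  D_upper : (D.card : ℝ) ≤ Fintype.card V / 4 + w
  AC_lower : (Fintype.card V : ℝ) / 2 - w ≤ A.card + C.card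
  AC_upper : (A.card : ℝ) + C.card ≤ Fintype.card V / 2 + w
  A_lower : (Fintype.card V : ℝ) / 4 - w ≤ A.card
  edgesBD : (Fintype.card V : ℝ) * A.card / 8 - w * Fintype.card V ≤ G.edgeCount B D
  edgesDB : (Fintype.card V : ℝ) * C.card / 8 - w * Fintype.card V ≤ G.edgeCount D B
  outDeg_lower : ∀ v, (Fintype.card V : ℝ) / 100 ≤ G.outDeg v
  inDeg_lower : ∀ v, (Fintype.card V : ℝ) / 100 ≤ G.inDeg v

omit [Fintype V] in
lemma fcount_or_comm (G : Digraph V) (S : Finset V) (x : V) :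
    fcount S (fun y => ¬ (G.rev.Adj x y ∨ G.rev.Adj y x)) =
      fcount S (fun y => ¬ (G.Adj x y ∨ G.Adj y x)) := by
  congr 1
  funext y
  simp only [rev_adj, or_comm]

/-- Reversal keeps A and C and exchanges B with D, so a surplus of `Q` over `P` can be treated as
the opposite one. -/
lemma Frame.rev {G : Digraph V} {A B C D : Finset V} {m w : ℕ} (h : G.Frame A B C D m w) :
    G.rev.Frame A D C B m w where
  oriented := h.oriented.rev
  ore := h.ore.rev
  disjAB := h.disjAD
  disjAC := h.disjAC
  disjAD := h.disjAB
  disjBC := h.disjCD.symm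
  disjBD := h.disjBD.symm
  disjCD := h.disjBC.symm
  nearAB := h.nearDA.rev
  nearBC := h.nearCD.rev
  nearCD := h.nearBC.rev
  nearDA := h.nearAB.rev
  tourA x hx := by rw [fcount_or_comm]; exact h.tourA x hx
  tourC x hx := by rw [fcount_or_comm]; exact h.tourC x hx
  dichotomy := h.dichotomy.imp_left fun h => ⟨h.1, h.2.rev⟩
  one_le := h.one_le
  w_le := h.w_le
  m_le := h.m_le
  w_small := h.w_small
  B_lower := h.D_lower
  B_upper := h.D_upper
  D_lower := h.B_lower
  D_upper := h.B_upper
  AC_lower := h.AC_lower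
  AC_upper := h.AC_upper
  A_lower := h.A_lower
  edgesBD := by rw [edgeCount_rev]; exact h.edgesBD
  edgesDB := by rw [edgeCount_rev]; exact h.edgesDB
  outDeg_lower := h.inDeg_lower
  inDeg_lower := h.outDeg_lower

lemma hasHamiltonCycle_rev {G : Digraph V} (h : G.rev.HasHamiltonCycle) :
    G.HasHamiltonCycle := by
  obtain ⟨v, hv, hadj⟩ := h
  refine ⟨fun i => v (-i), hv.comp (Equiv.neg _).bijective, fun i => ?_⟩
  have := hadj (-(i + 1))
  rw [show -(i + 1) + 1 = -i by ring] at this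
  exact this

lemma HasHamiltonCycle.mono {G H : Digraph V} (h : H.HasHamiltonCycle)
    (hle : ∀ x y, H.Adj x y → G.Adj x y) : G.HasHamiltonCycle := by
  obtain ⟨v, hv, hadj⟩ := h
  exact ⟨v, hv, fun i => hle _ _ (hadj i)⟩

lemma fcount_le_sdiff {α : Type*} (S U : Finset α) (q : α → Prop) :
    fcount S q ≤ fcount (S \ U) q + U.card := by
  have h : sel S q ⊆ sel (S \ U) q ∪ U := by
    intro x hx
    rw [mem_sel] at hx
    rw [Finset.mem_union, mem_sel, Finset.mem_sdiff]
    tauto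
  have := (Finset.card_le_card h).trans (Finset.card_union_le _ _)
  rwa [card_sel, card_sel] at this

/-- The edges respecting the out-types given by `P` and the in-types given by `Q`. -/
def neutral (G : Digraph V) (P Q : Finset V) : Digraph V :=
  ⟨fun x y => G.Adj x y ∧ (x ∈ P ↔ y ∈ Q)⟩

omit [Fintype V] in
lemma Near.neutral {G : Digraph V} {P Q X Y : Finset V} {m : ℕ} (h : G.Near X Y m)
    (hPQ : ∀ x ∈ X, ∀ y ∈ Y, x ∈ P ↔ y ∈ Q) : (G.neutral P Q).Near X Y m :=
  ⟨fun x hx => (fcount_imp Y fun y hy hn ha => hn ⟨ha, hPQ x hx y hy⟩).trans (h.1 x hx),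
    fun y hy => (fcount_imp X fun x hx hn ha => hn ⟨ha, hPQ x hx y hy⟩).trans (h.2 y hy)⟩

/-- The number of non-edges from B to D is about n²/16 - an/8 ≈ cn/8, only half of `|B| * |C|` ≈
cn/4. The gap absorbs errors of order `w * n` because `c ≥ 10000 * w`. -/
lemma nonEdges_lt {n a b c d w e b' c' : ℝ} (hn : 0 < n) (hw : 1 ≤ w)
    (hwn : w ≤ n / 1000000000)
    (hb : b ≤ n / 4 + w) (hd : d ≤ n / 4 + w) (hd0 : 0 ≤ d) (hac : n / 2 - w ≤ a + c)
    (he : n * a / 8 - w * n ≤ b * d - e) (hb' : n / 4 - 400 * w ≤ b') (hc' : c - 400 * w ≤ c')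
    (hc : 10000 * w ≤ c) (hcn : c ≤ n) : e < b' * c' := by
  have e1 : b * d ≤ (n / 4 + w) * (n / 4 + w) :=
    mul_le_mul hb hd hd0 (by linarith)
  have e2 : (n / 4 - 400 * w) * (c - 400 * w) ≤ b' * c' :=
    mul_le_mul hb' hc' (by linarith) (by linarith)
  have e3 : n * (n / 2 - w) ≤ n * (a + c) := mul_le_mul_of_nonneg_left hac hn.le
  have e4 : w * w ≤ w * n := mul_le_mul_of_nonneg_left (by linarith) (by linarith)
  have e5 : w * c ≤ w * n := mul_le_mul_of_nonneg_left hcn (by linarith)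
  have e6 : n * (10000 * w) ≤ n * c := mul_le_mul_of_nonneg_left hc hn.le
  have e7 : 0 < w * n := by positivity
  nlinarith

set_option maxHeartbeats 1000000 in
/-- A frame together with out-types `P` and in-types `Q` of equal size yields a Hamilton cycle,
if the vertices outside the frame are arranged into few paths with at most two vertices. -/
lemma Frame.hasHamiltonCycle_of_types {G : Digraph V} {A B C D : Finset V} {m w : ℕ}
    (h : G.Frame A B C D m w) {P Q : Finset V} (hPQ : P.card = Q.card) (S : Finset V)
    (W : List (V × V)) (hWn : (W.map Prod.fst ++ W.map Prod.snd).Nodup)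
    (hWS : ∀ x ∈ W.map Prod.fst ++ W.map Prod.snd, x ∉ S)
    (hW : ∀ p ∈ W, G.Adj p.1 p.2 ∧ (p.1 ∈ P ↔ p.2 ∈ Q))
    (U : Finset V) (hU : U = S ∪ (W.map Prod.fst ++ W.map Prod.snd).toFinset)
    (hcov : ∀ x, x ∉ U → x ∈ A ∪ B ∪ C ∪ D)
    (hA : ∀ x ∈ A, x ∉ U → x ∈ P ∧ x ∈ Q) (hB : ∀ x ∈ B, x ∉ U → x ∉ P ∧ x ∈ Q)
    (hC : ∀ x ∈ C, x ∉ U → x ∉ P ∧ x ∉ Q) (hD : ∀ x ∈ D, x ∉ U → x ∈ P ∧ x ∉ Q)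
    (hS : S.card + W.length ≤ 32 * w) (hUc : U.card ≤ 61 * w)
    (hout : ∀ x, x ∈ S ∨ x ∈ W.map Prod.snd →
      (x ∈ P → 400 * w ≤ fcount (A ∪ B) (fun y => G.Adj x y)) ∧
      (x ∉ P → 400 * w ≤ fcount (C ∪ D) (fun y => G.Adj x y)))
    (hin : ∀ x, x ∈ S ∨ x ∈ W.map Prod.fst →
      (x ∈ Q → 400 * w ≤ fcount (A ∪ D) (fun y => G.Adj y x)) ∧
      (x ∉ Q → 400 * w ≤ fcount (B ∪ C) (fun y => G.Adj y x)))
    (hAB : (B \ U).card + (S.card + W.length) ≤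
      (A \ U).card + lcount (fun p => p.1 ∉ Q) W) :
    G.HasHamiltonCycle := by
  have hw1 := h.one_le
  have hwm := h.w_le
  set n : ℝ := (Fintype.card V : ℝ) with hn
  have hnw : (w : ℝ) ≤ n / 1000000000 := h.w_small
  have hmn : (m : ℝ) ≤ n / 1000 := h.m_le
  have hw1R : (1 : ℝ) ≤ w := by exact_mod_cast hw1
  have hBl := h.B_lower
  have hBu := h.B_upper
  have hDl := h.D_lower
  have hDu := h.D_upper
  have hAl := h.A_lower
  have hACu := h.AC_upper
  have hC0 : (0 : ℝ) ≤ C.card := by positivity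
  rw [← hn] at hBl hBu hDl hDu hAl hACu
  have csd : ∀ X : Finset V, X.card ≤ (X \ U).card + 61 * w := by
    intro X
    have := Finset.card_le_card (show X ⊆ (X \ U) ∪ U by
      intro x hx
      rw [Finset.mem_union, Finset.mem_sdiff]
      tauto)
    have := Finset.card_union_le (X \ U) U
    omega
  have csd' : ∀ X : Finset V, (X \ U).card ≤ X.card :=
    fun X => Finset.card_le_card Finset.sdiff_subset
  -- natural number consequences of the size bounds
  have nB : 256 * w + 61 * w + 4 * m + 10 ≤ B.card := by
    have : (256 * w + 61 * w + 4 * m + 10 : ℝ) ≤ B.card := by linarith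
    exact_mod_cast this
  have nD : 256 * w + 61 * w + m + 10 ≤ D.card := by
    have : (256 * w + 61 * w + m + 10 : ℝ) ≤ D.card := by linarith
    exact_mod_cast this
  have nA : 256 * w + 61 * w + m + 10 ≤ A.card := by
    have : (256 * w + 61 * w + m + 10 : ℝ) ≤ A.card := by linarith
    exact_mod_cast this
  have nA3 : A.card + 2000 * w + 4 * m + 4 ≤ 3 * B.card := by
    have : (A.card + 2000 * w + 4 * m + 4 : ℝ) ≤ 3 * B.card := by linarith
    exact_mod_cast this
  have nC3 : C.card + 2000 * w + 4 * m + 4 ≤ 3 * B.card := by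
    have : (C.card + 2000 * w + 4 * m + 4 : ℝ) ≤ 3 * B.card := by linarith
    exact_mod_cast this
  set H := G.neutral P Q with hH
  have sd : ∀ {X : Finset V} {x : V}, x ∈ X \ U → x ∈ X ∧ x ∉ U := fun hx => Finset.mem_sdiff.1 hx
  have sub : ∀ X : Finset V, X \ U ⊆ X := fun X => Finset.sdiff_subset
  have kA : ∀ x ∈ A \ U, x ∈ P ∧ x ∈ Q := fun x hx => hA x (sd hx).1 (sd hx).2
  have kB : ∀ x ∈ B \ U, x ∉ P ∧ x ∈ Q := fun x hx => hB x (sd hx).1 (sd hx).2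
  have kC : ∀ x ∈ C \ U, x ∉ P ∧ x ∉ Q := fun x hx => hC x (sd hx).1 (sd hx).2
  have kD : ∀ x ∈ D \ U, x ∈ P ∧ x ∉ Q := fun x hx => hD x (sd hx).1 (sd hx).2
  have hb : Blowup H (A \ U) (B \ U) (C \ U) (D \ U) P Q m :=
    { neutral := fun x y hxy => hxy.2
      memA := kA
      memB := kB
      memC := kC
      memD := kD
      nearAB := (h.nearAB.mono (sub A) (sub B)).neutral fun x hx y hy => by
        simp [(kA x hx).1, (kB y hy).2]
      nearBC := (h.nearBC.mono (sub B) (sub C)).neutral fun x hx y hy => by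
        simp [(kB x hx).1, (kC y hy).2]
      nearCD := (h.nearCD.mono (sub C) (sub D)).neutral fun x hx y hy => by
        simp [(kC x hx).1, (kD y hy).2]
      nearDA := (h.nearDA.mono (sub D) (sub A)).neutral fun x hx y hy => by
        simp [(kD x hx).1, (kA y hy).2] }
  set Z : List (List V) := S.toList.map (fun x => [x]) ++ W.map (fun p => [p.1, p.2]) with hZ
  have hZl : Z.length = S.card + W.length := by simp [hZ]
  have hZf : Z.flatten.Perm (S.toList ++ (W.map Prod.fst ++ W.map Prod.snd)) := by
    rw [hZ, List.flatten_append, flatten_map_singleton]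
    exact (flatten_map_pair W).append_left _
  have hZU : ∀ x, x ∈ Z.flatten ↔ x ∈ U := by
    intro x
    rw [hZf.mem_iff, hU, List.mem_append, Finset.mem_union, Finset.mem_toList, List.mem_toFinset]
  have memT : ∀ x, x ∈ A \ U ∪ B \ U ∪ C \ U ∪ D \ U ↔ x ∈ A ∪ B ∪ C ∪ D ∧ x ∉ U := by
    intro x
    simp only [Finset.mem_union, Finset.mem_sdiff]
    tauto
  have hout' : ∀ x, x ∈ S ∨ x ∈ W.map Prod.snd →
      8 * (32 * w) < fcount (A \ U ∪ B \ U ∪ C \ U ∪ D \ U) (fun y => H.Adj x y) := by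
    intro x hx
    obtain ⟨h1, h2⟩ := hout x hx
    by_cases hxP : x ∈ P
    · have e1 := h1 hxP
      have e2 := fcount_le_sdiff (A ∪ B) U (fun y => G.Adj x y)
      have e3 : fcount ((A ∪ B) \ U) (fun y => G.Adj x y) ≤
          fcount (A \ U ∪ B \ U ∪ C \ U ∪ D \ U) (fun y => H.Adj x y) := by
        refine Finset.card_le_card fun y hy => ?_
        rw [mem_sel, Finset.mem_sdiff, Finset.mem_union] at hy
        obtain ⟨⟨hy1, hy2⟩, hy3⟩ := hy
        rw [mem_sel, memT]
        refine ⟨⟨by simp only [Finset.mem_union]; tauto, hy2⟩, hy3, ?_⟩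
        have : y ∈ Q := hy1.elim (fun h => (hA y h hy2).2) (fun h => (hB y h hy2).2)
        simp [hxP, this]
      omega
    · have e1 := h2 hxP
      have e2 := fcount_le_sdiff (C ∪ D) U (fun y => G.Adj x y)
      have e3 : fcount ((C ∪ D) \ U) (fun y => G.Adj x y) ≤
          fcount (A \ U ∪ B \ U ∪ C \ U ∪ D \ U) (fun y => H.Adj x y) := by
        refine Finset.card_le_card fun y hy => ?_
        rw [mem_sel, Finset.mem_sdiff, Finset.mem_union] at hy
        obtain ⟨⟨hy1, hy2⟩, hy3⟩ := hy
        rw [mem_sel, memT]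
        refine ⟨⟨by simp only [Finset.mem_union]; tauto, hy2⟩, hy3, ?_⟩
        have : y ∉ Q := hy1.elim (fun h => (hC y h hy2).2) (fun h => (hD y h hy2).2)
        simp [hxP, this]
      omega
  have hin' : ∀ x, x ∈ S ∨ x ∈ W.map Prod.fst →
      8 * (32 * w) < fcount (A \ U ∪ B \ U ∪ C \ U ∪ D \ U) (fun y => H.Adj y x) := by
    intro x hx
    obtain ⟨h1, h2⟩ := hin x hx
    by_cases hxQ : x ∈ Q
    · have e1 := h1 hxQ
      have e2 := fcount_le_sdiff (A ∪ D) U (fun y => G.Adj y x)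
      have e3 : fcount ((A ∪ D) \ U) (fun y => G.Adj y x) ≤
          fcount (A \ U ∪ B \ U ∪ C \ U ∪ D \ U) (fun y => H.Adj y x) := by
        refine Finset.card_le_card fun y hy => ?_
        rw [mem_sel, Finset.mem_sdiff, Finset.mem_union] at hy
        obtain ⟨⟨hy1, hy2⟩, hy3⟩ := hy
        rw [mem_sel, memT]
        refine ⟨⟨by simp only [Finset.mem_union]; tauto, hy2⟩, hy3, ?_⟩
        have : y ∈ P := hy1.elim (fun h => (hA y h hy2).1) (fun h => (hD y h hy2).1)
        simp [hxQ, this]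
      omega
    · have e1 := h2 hxQ
      have e2 := fcount_le_sdiff (B ∪ C) U (fun y => G.Adj y x)
      have e3 : fcount ((B ∪ C) \ U) (fun y => G.Adj y x) ≤
          fcount (A \ U ∪ B \ U ∪ C \ U ∪ D \ U) (fun y => H.Adj y x) := by
        refine Finset.card_le_card fun y hy => ?_
        rw [mem_sel, Finset.mem_sdiff, Finset.mem_union] at hy
        obtain ⟨⟨hy1, hy2⟩, hy3⟩ := hy
        rw [mem_sel, memT]
        refine ⟨⟨by simp only [Finset.mem_union]; tauto, hy2⟩, hy3, ?_⟩
        have : y ∉ P := hy1.elim (fun h => (hB y h hy2).1) (fun h => (hC y h hy2).1)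
        simp [hxQ, this]
      omega
  have tourmono : ∀ (X : Finset V), (∀ x ∈ X \ U, ∀ y ∈ X \ U, (x ∈ P ↔ y ∈ Q)) →
      (∀ x ∈ X, fcount X (fun y => ¬ (G.Adj x y ∨ G.Adj y x)) ≤ m) →
      ∀ x ∈ X \ U, fcount (X \ U) (fun y => ¬ (H.Adj x y ∨ H.Adj y x)) ≤ m := by
    intro X hX ht x hx
    refine le_trans ?_ (ht x (sub X hx))
    refine (fcount_imp (X \ U) (q' := fun y => ¬ (G.Adj x y ∨ G.Adj y x)) ?_).trans
      (fcount_mono (sub X) _)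
    intro y hy hn ha
    refine hn (ha.imp (fun ha => ⟨ha, hX x hx y hy⟩) fun ha => ⟨ha, hX y hy x hx⟩)
  refine HasHamiltonCycle.mono (H := H) ?_ fun x y hxy => hxy.1
  -- There are at most `32 * w` items, whose extensions use at most `256 * w` vertices. Of the `400
  -- * w` neighbours guaranteed by the types, at most `61 * w` lie in `U`, so more than `256 * w`
  -- remain.
  refine hasHamiltonCycle_of_blowup (s := 32 * w) hb (fun x hx => h.oriented.irrefl x hx.1) hPQ
    (tourmono A (fun x hx y hy => by simp [(kA x hx).1, (kA y hy).2]) h.tourA)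
    (tourmono C (fun x hx y hy => by simp [(kC x hx).1, (kC y hy).2]) h.tourC)
    Z ?_ (by omega) ?_ ?_ ?_ ?_ ?_ ?_ ?_ ?_ ?_ ?_
  · intro z hz
    rw [hZ, List.mem_append, List.mem_map, List.mem_map] at hz
    rcases hz with ⟨x, hx, rfl⟩ | ⟨p, hp, rfl⟩
    · rw [Finset.mem_toList] at hx
      exact ⟨by simp, ⟨x, by simp, hin' x (Or.inl hx)⟩, ⟨x, by simp, hout' x (Or.inl hx)⟩⟩
    · have hp' : H.Adj p.1 p.2 := hW p hp
      exact ⟨by simpa using hp', ⟨p.1, by simp, hin' _ (Or.inr (List.mem_map_of_mem hp))⟩,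
        ⟨p.2, by simp, hout' _ (Or.inr (List.mem_map_of_mem hp))⟩⟩
  · refine hZf.nodup_iff.2 (nodup_append_of S.nodup_toList hWn fun x hx hx' => ?_)
    exact hWS x hx' (Finset.mem_toList.1 hx)
  · intro x hx hT
    exact ((memT x).1 hT).2 ((hZU x).1 hx)
  · intro x
    rw [memT, hZU]
    by_cases hx : x ∈ U
    · exact Or.inr hx
    · exact Or.inl ⟨hcov x hx, hx⟩
  · have := csd A
    omega
  · have := csd B
    omega
  · have := csd D
    omega
  · have e1 : lcount (fun p => p.1 ∉ Q) W ≤ lcount (fun z => ∃ x ∈ z.head?, x ∉ Q) Z := by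
      rw [hZ, lcount_append]
      refine le_trans ?_ (Nat.le_add_left _ _)
      unfold lcount
      rw [List.countP_map]
      refine List.countP_mono_left fun p _ hp => ?_
      simpa using hp
    omega
  · have := csd B
    have := csd' A
    omega
  · have := csd B
    have := csd' C
    omega
  · rcases h.dichotomy with ⟨h1, h2⟩ | h1
    · left
      refine ⟨by rw [h1]; exact Finset.empty_sdiff _, ?_⟩
      exact (h2.mono (sub B) (sub D)).neutral fun x hx y hy => by
        simp [(kB x hx).1, (kD y hy).2]
    · right
      have cC := csd C
      refine ⟨by omega, ?_⟩
      intro b c hbb hcc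
      have cB := csd B
      have e1 : H.nonEdges (B \ U) (D \ U) ≤ G.nonEdges B D := by
        unfold nonEdges
        refine le_trans (Finset.sum_le_sum fun y hy => ?_) (Finset.sum_le_sum_of_subset (sub D))
        refine (fcount_imp (B \ U) (q' := fun x => ¬ G.Adj x y) ?_).trans (fcount_mono (sub B) _)
        intro x hx hn ha
        exact hn ⟨ha, by simp [(kB x hx).1, (kD y hy).2]⟩
      refine lt_of_le_of_lt e1 ?_
      have e2 : (G.edgeCount B D : ℝ) + G.nonEdges B D = B.card * D.card := by
        exact_mod_cast G.edgeCount_add_nonEdges B D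
      have e3 := h.edgesBD
      have e4 := h.AC_lower
      rw [← hn] at e3 e4
      have e5 : (B.card : ℝ) ≤ b + 399 * w := by
        exact_mod_cast (show B.card ≤ b + 399 * w by omega)
      have e6 : (C.card : ℝ) ≤ c + 400 * w := by
        exact_mod_cast (show C.card ≤ c + 400 * w by omega)
      have e7 : (10000 : ℝ) * w ≤ C.card := by
        exact_mod_cast (show 10000 * w ≤ C.card by omega)
      have e8 : (C.card : ℝ) ≤ n := by
        rw [hn]
        exact_mod_cast Finset.card_le_univ C
      have := nonEdges_lt (n := n) (a := A.card) (b := B.card) (c := C.card) (d := D.card)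
        (w := w) (e := G.nonEdges B D) (b' := b) (c' := c) (by linarith) hw1R hnw hBu hDu
        (by positivity) e4 (by linarith) (by linarith) (by linarith) e7 e8
      exact_mod_cast this

end Frame

end Digraph

namespace Digraph

/-! ### Types for the exceptional vertices -/

section Types

open Classical

variable {V : Type*} [Fintype V]

/-- Out-types `P` and in-types `Q` for all vertices extending those of the parts `A`, `B`, `C`,
`D`, such that each vertex has at least `s` neighbours of the type required. -/
structure Typing (G : Digraph V) (A B C D P Q : Finset V) (s : ℕ) : Prop where
  memA : ∀ x ∈ A, x ∈ P ∧ x ∈ Q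
  memB : ∀ x ∈ B, x ∉ P ∧ x ∈ Q
  memC : ∀ x ∈ C, x ∉ P ∧ x ∉ Q
  memD : ∀ x ∈ D, x ∈ P ∧ x ∉ Q
  out_mem : ∀ x, x ∈ P → s ≤ fcount (A ∪ B) (fun y => G.Adj x y)
  out_notMem : ∀ x, x ∉ P → s ≤ fcount (C ∪ D) (fun y => G.Adj x y)
  in_mem : ∀ x, x ∈ Q → s ≤ fcount (A ∪ D) (fun y => G.Adj y x)
  in_notMem : ∀ x, x ∉ Q → s ≤ fcount (B ∪ C) (fun y => G.Adj y x)

omit [Fintype V] in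
lemma Typing.rev {G : Digraph V} {A B C D P Q : Finset V} {s : ℕ}
    (h : G.Typing A B C D P Q s) : G.rev.Typing A D C B Q P s where
  memA x hx := (h.memA x hx).symm
  memB x hx := (h.memD x hx).symm
  memC x hx := (h.memC x hx).symm
  memD x hx := (h.memB x hx).symm
  out_mem := h.in_mem
  out_notMem x hx := by rw [Finset.union_comm]; exact h.in_notMem x hx
  in_mem := h.out_mem
  in_notMem x hx := by rw [Finset.union_comm]; exact h.out_notMem x hx

/-- The vertices outside all of the parts of a frame. -/
noncomputable def outside (A B C D : Finset V) : Finset V := Finset.univ \ (A ∪ B ∪ C ∪ D)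

lemma mem_outside {A B C D : Finset V} {x : V} :
    x ∈ outside A B C D ↔ x ∉ A ∧ x ∉ B ∧ x ∉ C ∧ x ∉ D := by
  simp only [outside, Finset.mem_sdiff, Finset.mem_univ, Finset.mem_union, true_and, not_or]
  tauto

lemma Frame.card_outside {G : Digraph V} {A B C D : Finset V} {m w : ℕ}
    (h : G.Frame A B C D m w) : (outside A B C D).card ≤ 3 * w := by
  have e1 := Finset.card_sdiff_add_card_eq_card (Finset.subset_univ (A ∪ B ∪ C ∪ D))
  rw [Finset.card_union_of_disjoint, Finset.card_union_of_disjoint,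
    Finset.card_union_of_disjoint h.disjAB, Finset.card_univ] at e1
  · have e2 : ((outside A B C D).card : ℝ) + (A.card + B.card + C.card + D.card) =
        Fintype.card V := by exact_mod_cast e1
    have := h.B_lower
    have := h.D_lower
    have := h.AC_lower
    have : ((outside A B C D).card : ℝ) ≤ 3 * w := by linarith
    exact_mod_cast this
  · exact Finset.disjoint_union_left.2 ⟨h.disjAC, h.disjBC⟩
  · exact Finset.disjoint_union_left.2
      ⟨Finset.disjoint_union_left.2 ⟨h.disjAD, h.disjBD⟩, h.disjCD⟩

omit [Fintype V] in
lemma Near.le_out {G : Digraph V} {X Y Y' : Finset V} {m : ℕ} (h : G.Near X Y m) {x : V}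
    (hx : x ∈ X) (hY : Y ⊆ Y') : Y.card ≤ fcount Y' (fun y => G.Adj x y) + m := by
  have e1 := fcount_add_not Y (fun y => G.Adj x y)
  have e2 := h.1 x hx
  have e3 := fcount_mono hY (fun y => G.Adj x y)
  omega

omit [Fintype V] in
lemma Near.le_in {G : Digraph V} {X Y X' : Finset V} {m : ℕ} (h : G.Near X Y m) {y : V}
    (hy : y ∈ Y) (hX : X ⊆ X') : X.card ≤ fcount X' (fun x => G.Adj x y) + m := by
  have e1 := fcount_add_not X (fun x => G.Adj x y)
  have e2 := h.2 y hy
  have e3 := fcount_mono hX (fun x => G.Adj x y)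
  omega

lemma Frame.card_ge {G : Digraph V} {A B C D : Finset V} {m w : ℕ}
    (h : G.Frame A B C D m w) : 400 * w + m ≤ A.card ∧ 400 * w + m ≤ B.card ∧
      400 * w + m ≤ D.card ∧ ∀ v, 1000 * w ≤ G.outDeg v ∧ 1000 * w ≤ G.inDeg v := by
  have := h.A_lower
  have := h.B_lower
  have := h.D_lower
  have := h.m_le
  have := h.w_small
  have hw : (1 : ℝ) ≤ w := by exact_mod_cast h.one_le
  refine ⟨?_, ?_, ?_, fun v => ⟨?_, ?_⟩⟩
  · exact_mod_cast (show (400 * w + m : ℝ) ≤ A.card by linarith)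
  · exact_mod_cast (show (400 * w + m : ℝ) ≤ B.card by linarith)
  · exact_mod_cast (show (400 * w + m : ℝ) ≤ D.card by linarith)
  · have := h.outDeg_lower v
    exact_mod_cast (show (1000 * w : ℝ) ≤ G.outDeg v by linarith)
  · have := h.inDeg_lower v
    exact_mod_cast (show (1000 * w : ℝ) ≤ G.inDeg v by linarith)

lemma fcount_univ_le {A B C D : Finset V} (q : V → Prop) :
    fcount Finset.univ q ≤ fcount (A ∪ B) q + fcount (C ∪ D) q + (outside A B C D).card := by
  have e : sel Finset.univ q ⊆ sel (A ∪ B) q ∪ sel (C ∪ D) q ∪ outside A B C D := by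
    intro x hx
    simp only [Finset.mem_union, mem_sel, mem_outside] at hx ⊢
    tauto
  have e1 := Finset.card_le_card e
  have e2 := Finset.card_union_le (sel (A ∪ B) q ∪ sel (C ∪ D) q) (outside A B C D)
  have e3 := Finset.card_union_le (sel (A ∪ B) q) (sel (C ∪ D) q)
  simp only [card_sel] at *
  omega

lemma outside_perm (A B C D : Finset V) : outside A D B C = outside A B C D := by
  ext x
  simp only [mem_outside]
  tauto

/-- An outside vertex joins `P` if it has enough out-neighbours in A ∪ B; if not, its linear
outdegree puts enough of them into C ∪ D. The same works for `Q` with in-neighbours. Vertices inside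
the frame inherit their types and have enough neighbours by the nearly complete pairs. -/
lemma Frame.exists_typing {G : Digraph V} {A B C D : Finset V} {m w : ℕ}
    (h : G.Frame A B C D m w) : ∃ P Q, G.Typing A B C D P Q (400 * w) := by
  obtain ⟨cA, cB, cD, cdeg⟩ := h.card_ge
  have hE := h.card_outside
  have hw := h.one_le
  have hwm := h.w_le
  have dis : ∀ {X Y : Finset V} {x : V}, Disjoint X Y → x ∈ X → x ∉ Y :=
    fun hXY hx hy => Finset.disjoint_left.1 hXY hx hy
  refine ⟨A ∪ D ∪ sel (outside A B C D) (fun x => 400 * w ≤ fcount (A ∪ B) (fun y => G.Adj x y)),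
    A ∪ B ∪ sel (outside A B C D) (fun x => 400 * w ≤ fcount (A ∪ D) (fun y => G.Adj y x)),
    ?_, ?_, ?_, ?_, ?_, ?_, ?_, ?_⟩
  · intro x hx
    simp [hx]
  · intro x hx
    simp [hx, mem_sel, mem_outside, dis h.disjAB.symm hx, dis h.disjBD hx]
  · intro x hx
    simp [hx, mem_sel, mem_outside, dis h.disjAC.symm hx, dis h.disjBC.symm hx, dis h.disjCD hx]
  · intro x hx
    simp [hx, mem_sel, mem_outside, dis h.disjAD.symm hx, dis h.disjBD.symm hx]
  · intro x hx
    simp only [Finset.mem_union, mem_sel] at hx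
    rcases hx with (hx | hx) | hx
    · have := h.nearAB.le_out hx (Finset.subset_union_right (s₁ := A))
      omega
    · have := h.nearDA.le_out hx (Finset.subset_union_left (s₂ := B))
      omega
    · exact hx.2
  · intro x hx
    simp only [Finset.mem_union, mem_sel, mem_outside] at hx
    by_cases hB : x ∈ B
    · rcases h.dichotomy with ⟨-, h2⟩ | h2
      · have := h2.le_out hB (Finset.subset_union_right (s₁ := C))
        omega
      · have := h.nearBC.le_out hB (Finset.subset_union_left (s₂ := D))
        omega
    · by_cases hC : x ∈ C
      · have := h.nearCD.le_out hC (Finset.subset_union_right (s₁ := C))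
        omega
      · have e1 : fcount (A ∪ B) (fun y => G.Adj x y) < 400 * w := not_le.1 fun hc => by tauto
        have e2 := (cdeg x).1
        rw [outDeg_eq] at e2
        have e3 := fcount_univ_le (A := A) (B := B) (C := C) (D := D) (fun y => G.Adj x y)
        omega
  · intro x hx
    simp only [Finset.mem_union, mem_sel] at hx
    rcases hx with (hx | hx) | hx
    · have := h.nearDA.le_in hx (Finset.subset_union_right (s₁ := A))
      omega
    · have := h.nearAB.le_in hx (Finset.subset_union_left (s₂ := D))
      omega
    · exact hx.2
  · intro x hx
    simp only [Finset.mem_union, mem_sel, mem_outside] at hx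
    by_cases hD : x ∈ D
    · rcases h.dichotomy with ⟨-, h2⟩ | h2
      · have := h2.le_in hD (Finset.subset_union_left (s₂ := C))
        omega
      · have := h.nearCD.le_in hD (Finset.subset_union_right (s₁ := B))
        omega
    · by_cases hC : x ∈ C
      · have := h.nearBC.le_in hC (Finset.subset_union_left (s₂ := C))
        omega
      · have e1 : fcount (A ∪ D) (fun y => G.Adj y x) < 400 * w := not_le.1 fun hc => by tauto
        have e2 := (cdeg x).2
        rw [inDeg_eq] at e2
        have e3 := fcount_univ_le (A := A) (B := D) (C := B) (D := C) (fun y => G.Adj y x)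
        rw [outside_perm] at e3
        omega

end Types

end Digraph

namespace Digraph

/-! ### Removing the surplus of `P` over `Q` -/

section Balanced

open Classical

variable {V : Type*} [Fintype V]

/-- Few type changes `F₁`, `F₂` and few disjoint edges `M` which together even out the sizes of
`P` and `Q`. -/
structure Balancing (G : Digraph V) (A B C D P Q : Finset V) (w : ℕ) (F₁ F₂ : Finset V)
    (M : List (V × V)) : Prop where
  sub₁ : F₁ ⊆ P
  disj₂ : ∀ x ∈ F₂, x ∉ Q
  out₁ : ∀ x ∈ F₁, 400 * w ≤ fcount (C ∪ D) (fun y => G.Adj x y)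
  in₂ : ∀ x ∈ F₂, 400 * w ≤ fcount (A ∪ D) (fun y => G.Adj y x)
  nodup : (M.map Prod.fst ++ M.map Prod.snd).Nodup
  edge : ∀ p ∈ M, (p.1 ∈ P ∧ p.1 ∉ F₁) ∧ (p.2 ∉ Q ∧ p.2 ∉ F₂) ∧ G.Adj p.1 p.2
  card : P.card = Q.card + (F₁.card + F₂.card + M.length)
  le : F₁.card + F₂.card + M.length ≤ 5 * w

/-- D is nearly complete to A and sends about cn/8 ≈ dc/2 edges to B. Changing O(w) vertices of each
class stays within the error term n²/1000. -/
lemma outDeg_sum_bound {n a c d m w a' c' d' e₁ e₂ S S' : ℝ} (hn : 0 < n)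
    (hw : w ≤ n / 1000000000) (hw0 : 0 ≤ w) (hm : m ≤ n / 1000) (hd : d ≤ n / 4 + w)
    (ha : 0 ≤ a) (hc : 0 ≤ c) (hac : a + c ≤ n / 2 + w) (ha' : a' ≤ a + 8 * w)
    (hc' : c' ≤ c + 8 * w) (hd' : d' ≤ d + 3 * w) (ha0 : 0 ≤ a') (hc0 : 0 ≤ c')
    (hd0 : 0 ≤ d)
    (h1 : d * a - m * d ≤ e₁) (h2 : n * c / 8 - w * n ≤ e₂) (h3 : e₁ + e₂ ≤ S)
    (h4 : S ≤ S' + 5 * w * n) :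
    d' * (a' + c' / 2) - n * n / 1000 ≤ S' := by
  have e1 : d' * (a' + c' / 2) ≤ (d + 3 * w) * ((a + 8 * w) + (c + 8 * w) / 2) :=
    mul_le_mul hd' (by linarith) (by linarith) (by linarith)
  have e2 : d * c ≤ (n / 4 + w) * c := mul_le_mul_of_nonneg_right hd hc
  have e3 : w * c ≤ w * n := mul_le_mul_of_nonneg_left (by linarith) hw0
  have e4 : w * a ≤ w * n := mul_le_mul_of_nonneg_left (by linarith) hw0
  have e5 : w * d ≤ w * n := mul_le_mul_of_nonneg_left (by linarith) hw0
  have e6 : w * w ≤ w * n := mul_le_mul_of_nonneg_left (by linarith) hw0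
  have e7 : m * d ≤ n / 1000 * d := mul_le_mul_of_nonneg_right hm hd0
  have e8 : n * d ≤ n * (n / 4 + w) := mul_le_mul_of_nonneg_left hd hn.le
  have e9 : w * n ≤ n / 1000000000 * n := mul_le_mul_of_nonneg_right hw hn.le
  nlinarith

omit [Fintype V] in
lemma sum_le_sum_add_mul {X Y Z : Finset V} (h : X ⊆ Y ∪ Z) (f : V → ℝ) {c : ℝ}
    (h0 : ∀ x, 0 ≤ f x) (hc : ∀ x, f x ≤ c) :
    ∑ x ∈ X, f x ≤ ∑ x ∈ Y, f x + Z.card * c := by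
  have e1 : ∑ x ∈ Z, f x ≤ Z.card * c := by
    rw [← nsmul_eq_mul]
    exact Finset.sum_le_card_nsmul _ _ _ fun x _ => hc x
  have e2 := Finset.sum_union_inter (s₁ := Y) (s₂ := Z) (f := f)
  have e3 : 0 ≤ ∑ x ∈ Y ∩ Z, f x := Finset.sum_nonneg fun x _ => h0 x
  have e4 := Finset.sum_le_sum_of_subset_of_nonneg h fun x _ _ => h0 x
  linarith

set_option maxHeartbeats 1000000 in
-- Retype vertices with many edges of the wrong kind while there is a surplus. If all of them are
-- used up, the wrong edges have small maximum degree and `exists_balancing_edges` supplies the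
-- rest.
lemma Frame.exists_balancing {G : Digraph V} {A B C D P Q : Finset V} {m w : ℕ}
    (h : G.Frame A B C D m w) (hT : G.Typing A B C D P Q (400 * w)) (hPQ : Q.card ≤ P.card) :
    ∃ F₁ F₂ M, G.Balancing A B C D P Q w F₁ F₂ M := by
  set n : ℝ := (Fintype.card V : ℝ) with hn
  set E := outside A B C D with hE
  have hEc : E.card ≤ 3 * w := h.card_outside
  have hEm : ∀ x, x ∈ E ↔ x ∉ A ∧ x ∉ B ∧ x ∉ C ∧ x ∉ D := fun x => mem_outside
  have hw1 : (1 : ℝ) ≤ w := by exact_mod_cast h.one_le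
  have hBl := h.B_lower
  have hBu := h.B_upper
  have hDl := h.D_lower
  have hDu := h.D_upper
  have hAl := h.A_lower
  have hACu := h.AC_upper
  have hws := h.w_small
  have hms := h.m_le
  rw [← hn] at hBl hBu hDl hDu hAl hACu hws hms
  have hn0 : 0 < n := by linarith
  obtain ⟨k, hk⟩ : ∃ k, P.card = Q.card + k := ⟨P.card - Q.card, by omega⟩
  have hk5 : k ≤ 5 * w := by
    have e1 : P.card ≤ A.card + D.card + E.card := by
      refine (Finset.card_le_card (t := A ∪ D ∪ E) fun x hx => ?_).trans
        ((Finset.card_union_le _ _).trans (Nat.add_le_add_right (Finset.card_union_le _ _) _))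
      have := hT.memB x
      have := hT.memC x
      simp only [Finset.mem_union, hEm]
      tauto
    have e2 : A.card + B.card ≤ Q.card := by
      rw [← Finset.card_union_of_disjoint h.disjAB]
      refine Finset.card_le_card fun x hx => ?_
      have := hT.memA x
      have := hT.memB x
      rw [Finset.mem_union] at hx
      tauto
    have e3 : (k : ℝ) ≤ D.card - B.card + E.card := by
      have : B.card + k ≤ D.card + E.card := by omega
      have : (B.card + k : ℝ) ≤ D.card + E.card := by exact_mod_cast this
      linarith
    have e4 : (E.card : ℝ) ≤ 3 * w := by exact_mod_cast hEc
    exact_mod_cast (show (k : ℝ) ≤ 5 * w by linarith)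
  -- The threshold exceeds the `400 * w` neighbours required after a type change, and `t + 3 * w`,
  -- which also counts outside vertices, stays below the degree bound n/10000.
  obtain ⟨t, ht⟩ : ∃ t : ℕ, t = ⌊n / 20000⌋₊ := ⟨_, rfl⟩
  have ht1 : (t : ℝ) ≤ n / 20000 := by rw [ht]; exact Nat.floor_le (by positivity)
  have ht2 : 400 * w ≤ t := by
    rw [ht]
    refine Nat.le_floor ?_
    push_cast
    linarith
  set W₁ := sel P (fun x => t ≤ fcount (C ∪ D) (fun y => G.Adj x y)) with hW₁
  set W₂ := sel (Finset.univ \ Q) (fun x => t ≤ fcount (A ∪ D) (fun y => G.Adj y x)) with hW₂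
  have m₁ : ∀ x, x ∈ W₁ ↔ x ∈ P ∧ t ≤ fcount (C ∪ D) (fun y => G.Adj x y) := fun x => mem_sel
  have m₂ : ∀ x, x ∈ W₂ ↔ x ∉ Q ∧ t ≤ fcount (A ∪ D) (fun y => G.Adj y x) := by
    intro x
    rw [hW₂, mem_sel]
    simp
  by_cases hWk : k ≤ W₁.card + W₂.card
  · obtain ⟨F₁, f1, f1c⟩ := Finset.exists_subset_card_eq (s := W₁) (min_le_right k W₁.card)
    obtain ⟨F₂, f2, f2c⟩ := Finset.exists_subset_card_eq (s := W₂) (n := k - F₁.card) (by omega)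
    refine ⟨F₁, F₂, [], ?_, ?_, ?_, ?_, ?_, ?_, ?_, ?_⟩
    · exact fun x hx => ((m₁ x).1 (f1 hx)).1
    · exact fun x hx => ((m₂ x).1 (f2 hx)).1
    · exact fun x hx => ht2.trans ((m₁ x).1 (f1 hx)).2
    · exact fun x hx => ht2.trans ((m₂ x).1 (f2 hx)).2
    · simp
    · simp
    · simp only [List.length_nil]
      omega
    · simp only [List.length_nil]
      omega
  push Not at hWk
  obtain ⟨k', hk'⟩ : ∃ k', k = W₁.card + W₂.card + k' := ⟨k - (W₁.card + W₂.card), by omega⟩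
  have hk1 : 1 ≤ k' := by omega
  set P' := P \ W₁ with hP'
  set Q' := Q ∪ W₂ with hQ'
  have mP : ∀ x, x ∈ P' ↔ x ∈ P ∧ x ∉ W₁ := fun x => Finset.mem_sdiff
  have mQ : ∀ x, x ∈ Q' ↔ x ∈ Q ∨ x ∈ W₂ := fun x => Finset.mem_union
  have cP : P'.card + W₁.card = P.card :=
    Finset.card_sdiff_add_card_eq_card (sel_subset _ _)
  have cQ : Q'.card = Q.card + W₂.card := by
    refine Finset.card_union_of_disjoint (Finset.disjoint_left.2 fun x hx hx' => ?_)
    exact ((m₂ x).1 hx').1 hx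
  -- The new types determine a partition of all vertices into four classes with `|D'| - |B'| = |P'|
  -- - |Q'| = k'`, close to the old one.
  set A' := P' ∩ Q' with hA'
  set D' := P' \ Q' with hD'
  set B' := Q' \ P' with hB'
  set C' := Finset.univ \ (P' ∪ Q') with hC'
  have mA : ∀ x, x ∈ A' ↔ x ∈ P' ∧ x ∈ Q' := fun x => Finset.mem_inter
  have mD : ∀ x, x ∈ D' ↔ x ∈ P' ∧ x ∉ Q' := fun x => Finset.mem_sdiff
  have mB : ∀ x, x ∈ B' ↔ x ∈ Q' ∧ x ∉ P' := fun x => Finset.mem_sdiff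
  have mC : ∀ x, x ∈ C' ↔ x ∉ P' ∧ x ∉ Q' := by
    intro x
    simp [hC']
  have cA : A'.card + D'.card = P'.card := Finset.card_inter_add_card_sdiff P' Q'
  have cB : A'.card + B'.card = Q'.card := by
    rw [hA', Finset.inter_comm]
    exact Finset.card_inter_add_card_sdiff Q' P'
  have hAD : ∀ x, x ∈ A' ∪ D' ↔ x ∈ P' := by
    intro x
    rw [Finset.mem_union, mA, mD]
    tauto
  have hCD : ∀ x, x ∈ C' ∪ D' ↔ x ∉ Q' := by
    intro x
    rw [Finset.mem_union, mC, mD]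
    tauto
  have hADs : A' ∪ D' ⊆ A ∪ D ∪ E := by
    intro x hx
    rw [hAD, mP] at hx
    have := hT.memB x
    have := hT.memC x
    simp only [Finset.mem_union, hEm]
    tauto
  have hCDs : C' ∪ D' ⊆ C ∪ D ∪ E := by
    intro x hx
    rw [hCD, mQ] at hx
    have := hT.memA x
    have := hT.memB x
    simp only [Finset.mem_union, hEm]
    tauto
  have fadd : ∀ {X Y : Finset V} (q : V → Prop), X ⊆ Y ∪ E → fcount X q ≤ fcount Y q + 3 * w := by
    intro X Y q hXY
    have e1 := fcount_le_sdiff X E q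
    have e2 : fcount (X \ E) q ≤ fcount Y q := fcount_mono (fun x hx => by
      rw [Finset.mem_sdiff] at hx
      have := hXY hx.1
      rw [Finset.mem_union] at this
      tauto) q
    omega
  have hW5 : W₁.card + W₂.card ≤ 5 * w := by omega
  have sA : A.card ≤ A'.card + W₁.card := by
    refine (Finset.card_le_card (t := A' ∪ W₁) fun x hx => ?_).trans (Finset.card_union_le _ _)
    have := hT.memA x hx
    rw [Finset.mem_union, mA, mP, mQ]
    tauto
  have sA' : A'.card ≤ A.card + E.card + W₂.card := by
    refine (Finset.card_le_card (t := A ∪ E ∪ W₂) fun x hx => ?_).trans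
      ((Finset.card_union_le _ _).trans (Nat.add_le_add_right (Finset.card_union_le _ _) _))
    have := hT.memB x
    have := hT.memC x
    have := hT.memD x
    rw [mA, mP, mQ] at hx
    simp only [Finset.mem_union, hEm]
    tauto
  have sB : B.card ≤ B'.card := by
    refine Finset.card_le_card fun x hx => ?_
    have := hT.memB x hx
    rw [mB, mP, mQ]
    tauto
  have sC' : C'.card ≤ C.card + E.card + W₁.card := by
    refine (Finset.card_le_card (t := C ∪ E ∪ W₁) fun x hx => ?_).trans
      ((Finset.card_union_le _ _).trans (Nat.add_le_add_right (Finset.card_union_le _ _) _))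
    have := hT.memA x
    have := hT.memB x
    have := hT.memD x
    rw [mC, mP, mQ] at hx
    simp only [Finset.mem_union, hEm]
    tauto
  have sD' : D'.card ≤ D.card + E.card := by
    refine (Finset.card_le_card (t := D ∪ E) fun x hx => ?_).trans (Finset.card_union_le _ _)
    have := hT.memA x
    have := hT.memB x
    have := hT.memC x
    rw [mD, mP, mQ] at hx
    simp only [Finset.mem_union, hEm]
    tauto
  have sD : D ⊆ D' ∪ (W₁ ∪ W₂) := by
    intro x hx
    have := hT.memD x hx
    rw [Finset.mem_union, mD, mP, mQ, Finset.mem_union]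
    tauto
  have hEr : (E.card : ℝ) ≤ 3 * w := by exact_mod_cast hEc
  have hWr : (W₁.card : ℝ) + W₂.card ≤ 5 * w := by exact_mod_cast hW5
  have hW₁0 : (0 : ℝ) ≤ W₁.card := by positivity
  have hW₂0 : (0 : ℝ) ≤ W₂.card := by positivity
  have rA : (A.card : ℝ) ≤ A'.card + W₁.card := by exact_mod_cast sA
  have rA' : (A'.card : ℝ) ≤ A.card + E.card + W₂.card := by exact_mod_cast sA'
  have rB : (B.card : ℝ) ≤ B'.card := by exact_mod_cast sB
  have rC' : (C'.card : ℝ) ≤ C.card + E.card + W₁.card := by exact_mod_cast sC'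
  have rD' : (D'.card : ℝ) ≤ D.card + E.card := by exact_mod_cast sD'
  have hDA : (D.card : ℝ) * A.card - m * D.card ≤ ∑ x ∈ D, (fcount A (fun y => G.Adj x y) : ℝ) := by
    rw [sub_le_iff_le_add, mul_comm (m : ℝ), ← nsmul_eq_mul, ← nsmul_eq_mul, ← Finset.sum_const,
      ← Finset.sum_const, ← Finset.sum_add_distrib]
    refine Finset.sum_le_sum fun x hx => ?_
    exact_mod_cast h.nearDA.le_out hx (Finset.Subset.refl A)
  have hDB := h.edgesDB
  have hout : D'.card * ((A'.card : ℝ) + C'.card / 2) - n * n / 1000 ≤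
      ∑ x ∈ D', (G.outDeg x : ℝ) := by
    refine outDeg_sum_bound (n := n) (a := A.card) (c := C.card) (d := D.card) (m := m) (w := w)
      (S := ∑ x ∈ D, (G.outDeg x : ℝ)) hn0 hws (by linarith) hms hDu (by positivity)
      (by positivity) hACu (by linarith) (by linarith) (by linarith) (by positivity)
      (by positivity) (by positivity) hDA hDB ?_ ?_
    · rw [edgeCount_eq_sum_left]
      push_cast
      rw [← Finset.sum_add_distrib]
      refine Finset.sum_le_sum fun x _ => ?_
      have := fcount_mono (Finset.subset_univ (A ∪ B)) (fun y => G.Adj x y)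
      rw [fcount_union h.disjAB] at this
      exact_mod_cast this
    · refine (sum_le_sum_add_mul sD (fun x => (G.outDeg x : ℝ)) (c := n)
        (fun x => by positivity) fun x => ?_).trans ?_
      · have e1 := fcount_le_card Finset.univ (fun y => G.Adj x y)
        rw [Finset.card_univ, ← outDeg_eq] at e1
        rw [hn]
        exact_mod_cast e1
      · have e1 : ((W₁ ∪ W₂).card : ℝ) ≤ 5 * w := by
          exact_mod_cast (Finset.card_union_le W₁ W₂).trans hW5
        have := mul_le_mul_of_nonneg_right e1 hn0.le
        linarith
  obtain ⟨M, hM, hMn, hMe⟩ := exists_balancing_edges (A := A') (B := B') (C := C') (D := D')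
    h.oriented h.ore (k := k')
    (by
      intro x
      simp only [Finset.mem_union, mA, mB, mC, mD]
      tauto)
    (Finset.disjoint_left.2 fun x hx hx' => by rw [mA] at hx; rw [mB] at hx'; tauto)
    (Finset.disjoint_left.2 fun x hx hx' => by
      rw [Finset.mem_union, mA, mB] at hx; rw [mC] at hx'; tauto)
    (Finset.disjoint_left.2 fun x hx hx' => by
      rw [Finset.mem_union, Finset.mem_union, mA, mB, mC] at hx; rw [mD] at hx'; tauto)
    hk1 (by omega) hn.symm (by linarith) (t + 3 * w)
    (by push_cast; linarith)
    (by
      intro x hx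
      have e1 := fadd (fun y => G.Adj x y) hCDs
      rw [hAD, mP, m₁] at hx
      have e2 : fcount (C ∪ D) (fun y => G.Adj x y) < t := not_le.1 fun hc => by tauto
      omega)
    (by
      intro x hx
      have e1 := fadd (fun y => G.Adj y x) hADs
      rw [hCD, mQ, m₂] at hx
      have e2 : fcount (A ∪ D) (fun y => G.Adj y x) < t := not_le.1 fun hc => by tauto
      omega)
    (by linarith) (by linarith) (by linarith) hout
  refine ⟨W₁, W₂, M, ?_, ?_, ?_, ?_, hMn, ?_, ?_, ?_⟩
  · exact fun x hx => ((m₁ x).1 hx).1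
  · exact fun x hx => ((m₂ x).1 hx).1
  · exact fun x hx => ht2.trans ((m₁ x).1 hx).2
  · exact fun x hx => ht2.trans ((m₂ x).1 hx).2
  · intro p hp
    obtain ⟨q1, q2, q3⟩ := hMe p hp
    rw [hAD, mP] at q1
    rw [hCD, mQ] at q2
    exact ⟨q1, by tauto, q3⟩
  · omega
  · omega

end Balanced

end Digraph

namespace Digraph

/-! ### From a frame to a Hamilton cycle -/

section FrameHamilton

open Classical

variable {V : Type*} [Fintype V]

omit [Fintype V] in
lemma edgeCount_le_sdiff (G : Digraph V) (X Y Z : Finset V) :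
    G.edgeCount X Y ≤ G.edgeCount (X \ Z) (Y \ Z) + Z.card * (X.card + Y.card) := by
  have e : (X ×ˢ Y).filter (fun p => G.Adj p.1 p.2) ⊆
      ((X \ Z) ×ˢ (Y \ Z)).filter (fun p => G.Adj p.1 p.2) ∪ (Z ×ˢ Y ∪ X ×ˢ Z) := by
    intro p hp
    simp only [Finset.mem_union, Finset.mem_filter, Finset.mem_product, Finset.mem_sdiff] at hp ⊢
    tauto
  have e1 := Finset.card_le_card e
  have e2 := (Finset.card_union_le (((X \ Z) ×ˢ (Y \ Z)).filter (fun p => G.Adj p.1 p.2))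
    (Z ×ˢ Y ∪ X ×ˢ Z))
  have e3 := Finset.card_union_le (Z ×ˢ Y) (X ×ˢ Z)
  rw [Finset.card_product, Finset.card_product] at e3
  unfold edgeCount
  nlinarith

/-- If A is hardly larger than B, then C has about n/4 vertices and D sends about n²/32 edges to B,
far more than the greedy choice needs. -/
lemma Frame.exists_disjoint_edges_of_card_lt {G : Digraph V} {A B C D : Finset V} {m w : ℕ}
    (h : G.Frame A B C D m w) (hAB : A.card < B.card + 21 * w) (Z : Finset V)
    (hZ : Z.card ≤ 13 * w) :
    ∃ R : List (V × V), R.length = 24 * w ∧ (R.map Prod.fst ++ R.map Prod.snd).Nodup ∧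
      ∀ p ∈ R, p.1 ∈ D \ Z ∧ p.2 ∈ B \ Z ∧ G.Adj p.1 p.2 := by
  refine exists_disjoint_edges h.oriented.irrefl (D \ Z) (B \ Z) (Fintype.card V)
    (fun x _ => (fcount_le_card _ _).trans (Finset.card_le_univ _))
    (fun x _ => (fcount_le_card _ _).trans (Finset.card_le_univ _)) _ ?_
  set n : ℝ := (Fintype.card V : ℝ) with hn
  have hw1 : (1 : ℝ) ≤ w := by exact_mod_cast h.one_le
  have hBu := h.B_upper
  have hDu := h.D_upper
  have hACl := h.AC_lower
  have hws := h.w_small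
  have hDB := h.edgesDB
  rw [← hn] at hBu hDu hACl hws hDB
  have hABr : (A.card : ℝ) < B.card + 21 * w := by exact_mod_cast hAB
  have hn0 : 0 < n := by linarith
  have e1 : (G.edgeCount D B : ℝ) ≤ G.edgeCount (D \ Z) (B \ Z) + Z.card * (D.card + B.card) := by
    exact_mod_cast edgeCount_le_sdiff G D B Z
  have e2 : (Z.card : ℝ) * (D.card + B.card) ≤ 13 * w * n :=
    mul_le_mul (by exact_mod_cast hZ) (by linarith) (by positivity) (by positivity)
  have e3 : n * (n / 4 - 23 * w) ≤ n * C.card := mul_le_mul_of_nonneg_left (by linarith) hn0.le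
  have e4 : w * n ≤ n / 1000000000 * n := mul_le_mul_of_nonneg_right hws hn0.le
  have e5 : 0 < n * n := by positivity
  have : (4 * (24 * w) * n : ℝ) < G.edgeCount (D \ Z) (B \ Z) := by nlinarith
  rw [hn] at this
  exact_mod_cast this

omit [Fintype V] in
lemma nodup_append_pairs {M R : List (V × V)} (hM : (M.map Prod.fst ++ M.map Prod.snd).Nodup)
    (hR : (R.map Prod.fst ++ R.map Prod.snd).Nodup)
    (h : ∀ x ∈ R.map Prod.fst ++ R.map Prod.snd, x ∉ M.map Prod.fst ++ M.map Prod.snd) :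
    ((M ++ R).map Prod.fst ++ (M ++ R).map Prod.snd).Nodup := by
  have e : ((M ++ R).map Prod.fst ++ (M ++ R).map Prod.snd).Perm
      ((M.map Prod.fst ++ M.map Prod.snd) ++ (R.map Prod.fst ++ R.map Prod.snd)) := by
    rw [List.map_append, List.map_append, List.append_assoc, List.append_assoc]
    refine List.Perm.append_left _ ?_
    rw [← List.append_assoc, ← List.append_assoc]
    exact List.perm_append_comm.append_right _
  exact e.nodup_iff.2 (nodup_append_of hM hR fun x hx hx' => h x hx' hx)

set_option maxHeartbeats 1000000 in
-- The items are the outside and retyped vertices, the balancing edges and, if A is small,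
-- additional neutral edges from D to B. The latter do not affect the types; they lower the demand
-- on A.
lemma Frame.hasHamiltonCycle_of_typing {G : Digraph V} {A B C D P Q : Finset V} {m w : ℕ}
    (h : G.Frame A B C D m w) (hT : G.Typing A B C D P Q (400 * w)) (hPQ : Q.card ≤ P.card) :
    G.HasHamiltonCycle := by
  obtain ⟨F₁, F₂, M, hM⟩ := h.exists_balancing hT hPQ
  set E := outside A B C D with hE
  have hEc : E.card ≤ 3 * w := h.card_outside
  have hEm : ∀ x, x ∈ E ↔ x ∉ A ∧ x ∉ B ∧ x ∉ C ∧ x ∉ D := fun x => mem_outside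
  have hle := hM.le
  obtain ⟨Z, hZ⟩ : ∃ Z, Z = E ∪ F₁ ∪ F₂ ∪ (M.map Prod.fst ++ M.map Prod.snd).toFinset := ⟨_, rfl⟩
  have len2 : ∀ L : List (V × V), (L.map Prod.fst ++ L.map Prod.snd).toFinset.card ≤
      2 * L.length := by
    intro L
    refine (List.toFinset_card_le _).trans ?_
    simp only [List.length_append, List.length_map]
    omega
  have hEF : (E ∪ F₁ ∪ F₂).card ≤ 3 * w + F₁.card + F₂.card := by
    have e2 := Finset.card_union_le (E ∪ F₁) F₂
    have e3 := Finset.card_union_le E F₁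
    omega
  have hZc : Z.card ≤ 13 * w := by
    have e1 := Finset.card_union_le (E ∪ F₁ ∪ F₂) (M.map Prod.fst ++ M.map Prod.snd).toFinset
    have e4 := len2 M
    rw [hZ]
    omega
  have hBA : B.card ≤ A.card + 2 * w := by
    have := h.B_upper
    have := h.A_lower
    exact_mod_cast (show (B.card : ℝ) ≤ A.card + 2 * w by linarith)
  obtain ⟨R, hRl, hRn, hR⟩ : ∃ R : List (V × V),
      ((R.length = 0 ∧ B.card + 21 * w ≤ A.card) ∨ R.length = 24 * w) ∧
      (R.map Prod.fst ++ R.map Prod.snd).Nodup ∧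
      ∀ p ∈ R, p.1 ∈ D \ Z ∧ p.2 ∈ B \ Z ∧ G.Adj p.1 p.2 := by
    -- An edge from D to B removes one vertex of B, and reaching its tail in D from A uses up
    -- another, so each edge gains one unit in the comparison of B with A. The total loss is at most
    -- `2 * w` from `|B| - |A|`, `8 * w` from `S` and `M` and `13 * w` from `Z`, so `24 * w` edges
    -- suffice.
    by_cases hAB : A.card < B.card + 21 * w
    · obtain ⟨R, h1, h2⟩ := h.exists_disjoint_edges_of_card_lt hAB Z hZc
      exact ⟨R, Or.inr h1, h2⟩
    · exact ⟨[], Or.inl ⟨rfl, by omega⟩, by simp, by simp⟩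
  have mZ : ∀ x, x ∈ Z ↔ ((x ∈ E ∨ x ∈ F₁) ∨ x ∈ F₂) ∨
      x ∈ M.map Prod.fst ++ M.map Prod.snd := by
    intro x
    rw [hZ, Finset.mem_union, Finset.mem_union, Finset.mem_union, List.mem_toFinset]
  have hRf : ∀ x ∈ R.map Prod.fst, x ∈ D ∧ x ∉ Z := by
    intro x hx
    obtain ⟨p, hp, rfl⟩ := List.mem_map.1 hx
    exact Finset.mem_sdiff.1 (hR p hp).1
  have hRs : ∀ x ∈ R.map Prod.snd, x ∈ B ∧ x ∉ Z := by
    intro x hx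
    obtain ⟨p, hp, rfl⟩ := List.mem_map.1 hx
    exact Finset.mem_sdiff.1 (hR p hp).2.1
  obtain ⟨W, hW⟩ : ∃ W, W = M ++ R := ⟨_, rfl⟩
  have hWn : (W.map Prod.fst ++ W.map Prod.snd).Nodup := by
    rw [hW]
    refine nodup_append_pairs hM.nodup hRn fun x hx hx' => ?_
    have hxZ : x ∈ Z := (mZ x).2 (Or.inr hx')
    exact (List.mem_append.1 hx).elim (fun hx => (hRf x hx).2 hxZ) fun hx => (hRs x hx).2 hxZ
  have mW : ∀ x, x ∈ W.map Prod.fst ++ W.map Prod.snd ↔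
      x ∈ M.map Prod.fst ++ M.map Prod.snd ∨ x ∈ R.map Prod.fst ∨ x ∈ R.map Prod.snd := by
    intro x
    rw [hW, List.map_append, List.map_append]
    simp only [List.mem_append]
    tauto
  obtain ⟨eW, heW⟩ : ∃ eW, eW = (W.map Prod.fst ++ W.map Prod.snd).toFinset := ⟨_, rfl⟩
  have meW : ∀ x, x ∈ eW ↔ x ∈ W.map Prod.fst ++ W.map Prod.snd := by
    intro x
    rw [heW, List.mem_toFinset]
  obtain ⟨S, hS⟩ : ∃ S, S = (E ∪ F₁ ∪ F₂) \ eW := ⟨_, rfl⟩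
  obtain ⟨U, hU⟩ : ∃ U, U = S ∪ eW := ⟨_, rfl⟩
  have mS : ∀ x, x ∈ S ↔ ((x ∈ E ∨ x ∈ F₁) ∨ x ∈ F₂) ∧ x ∉ eW := by
    intro x
    rw [hS, Finset.mem_sdiff, Finset.mem_union, Finset.mem_union]
  have mU : ∀ x, x ∈ U ↔ x ∈ Z ∨ x ∈ R.map Prod.fst ∨ x ∈ R.map Prod.snd := by
    intro x
    rw [hU, Finset.mem_union, mS, meW, mW, mZ]
    tauto
  have hSc : S.card ≤ 3 * w + F₁.card + F₂.card := by
    rw [hS]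
    exact (Finset.card_le_card Finset.sdiff_subset).trans hEF
  have hWl : W.length = M.length + R.length := by rw [hW, List.length_append]
  have hUc : U.card ≤ S.card + 2 * W.length := by
    rw [hU, heW]
    exact (Finset.card_union_le _ _).trans (Nat.add_le_add_left (len2 W) _)
  -- The tails of the balancing edges leave `P` although they need not have many neighbours of the
  -- new kind; this makes those edges neutral and equalizes the sizes.
  obtain ⟨P', hP'⟩ : ∃ P', P' = P \ (F₁ ∪ (M.map Prod.fst).toFinset) := ⟨_, rfl⟩
  obtain ⟨Q', hQ'⟩ : ∃ Q', Q' = Q ∪ F₂ := ⟨_, rfl⟩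
  have mP : ∀ x, x ∈ P' ↔ x ∈ P ∧ x ∉ F₁ ∧ x ∉ M.map Prod.fst := by
    intro x
    rw [hP', Finset.mem_sdiff, Finset.mem_union, List.mem_toFinset, not_or]
  have mQ : ∀ x, x ∈ Q' ↔ x ∈ Q ∨ x ∈ F₂ := by
    intro x
    rw [hQ', Finset.mem_union]
  have hMf : ∀ x ∈ M.map Prod.fst, x ∈ P ∧ x ∉ F₁ := by
    intro x hx
    obtain ⟨p, hp, rfl⟩ := List.mem_map.1 hx
    exact (hM.edge p hp).1
  have hcard : P'.card = Q'.card := by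
    have e1 : Q'.card = Q.card + F₂.card := by
      rw [hQ']
      exact Finset.card_union_of_disjoint
        (Finset.disjoint_left.2 fun x hx hx' => hM.disj₂ x hx' hx)
    have e2 : P'.card + (F₁ ∪ (M.map Prod.fst).toFinset).card = P.card := by
      rw [hP']
      refine Finset.card_sdiff_add_card_eq_card (Finset.union_subset hM.sub₁ fun x hx => ?_)
      exact (hMf x (List.mem_toFinset.1 hx)).1
    rw [Finset.card_union_of_disjoint (Finset.disjoint_left.2 fun x hx hx' =>
      (hMf x (List.mem_toFinset.1 hx')).2 hx),
      List.toFinset_card_of_nodup (List.nodup_append.1 hM.nodup).1, List.length_map] at e2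
    have := hM.card
    omega
  have hZU : ∀ x, x ∉ U → x ∉ E ∧ x ∉ F₁ ∧ x ∉ F₂ ∧ x ∉ M.map Prod.fst := by
    intro x hx
    rw [mU, mZ, List.mem_append] at hx
    tauto
  refine h.hasHamiltonCycle_of_types (P := P') (Q := Q') hcard S W hWn ?_ ?_ U (by rw [hU, heW])
    ?_ ?_ ?_ ?_ ?_ (by omega) (by omega) ?_ ?_ ?_
  · intro x hx hxS
    exact ((mS x).1 hxS).2 ((meW x).2 hx)
  · intro p hp
    rw [hW, List.mem_append] at hp
    rw [mP, mQ]
    rcases hp with hp | hp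
    · obtain ⟨q1, q2, q3⟩ := hM.edge p hp
      have : p.1 ∈ M.map Prod.fst := List.mem_map_of_mem hp
      exact ⟨q3, by tauto⟩
    · obtain ⟨q1, q2, q3⟩ := hR p hp
      rw [Finset.mem_sdiff, mZ, List.mem_append] at q1 q2
      have e1 := hT.memD _ q1.1
      have e2 := hT.memB _ q2.1
      exact ⟨q3, by tauto⟩
  · intro x hx
    have := (hZU x hx).1
    rw [hEm] at this
    simp only [Finset.mem_union]
    tauto
  · intro x hx hxU
    have e1 := hZU x hxU
    have e2 := hT.memA x hx
    rw [mP, mQ]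
    tauto
  · intro x hx hxU
    have e2 := hT.memB x hx
    rw [mP, mQ]
    tauto
  · intro x hx hxU
    have e1 := hZU x hxU
    have e2 := hT.memC x hx
    rw [mP, mQ]
    tauto
  · intro x hx hxU
    have e1 := hZU x hxU
    have e2 := hT.memD x hx
    rw [mP, mQ]
    tauto
  · intro x hx
    -- The tail of a balancing edge is never the last vertex of an item, so nothing is required of
    -- its remaining out-neighbours.
    have hxM : x ∉ M.map Prod.fst := by
      intro hxM
      have hxW : x ∈ W.map Prod.fst := by
        rw [hW, List.map_append]
        exact List.mem_append_left _ hxM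
      rcases hx with hx | hx
      · exact ((mS x).1 hx).2 ((meW x).2 (List.mem_append_left _ hxW))
      · exact (List.nodup_append.1 hWn).2.2 x hxW x hx rfl
    rw [mP]
    refine ⟨fun hx => hT.out_mem x hx.1, fun hx => ?_⟩
    by_cases hxP : x ∈ P
    · exact hM.out₁ x (by tauto)
    · exact hT.out_notMem x hxP
  · intro x hx
    rw [mQ]
    refine ⟨fun hx => hx.elim (hT.in_mem x) (hM.in₂ x), fun hx => hT.in_notMem x (by tauto)⟩
  · rcases hRl with ⟨h1, h2⟩ | h1
    · have e1 := Finset.card_le_card (show B \ U ⊆ B from Finset.sdiff_subset)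
      have e2 := Finset.card_le_card (show A ⊆ (A \ U) ∪ U from fun x hx => by
        rw [Finset.mem_union, Finset.mem_sdiff]
        tauto)
      have e3 := Finset.card_union_le (A \ U) U
      omega
    · have e1 : (B \ U).card + R.length ≤ B.card := by
        have e2 : (R.map Prod.snd).toFinset ⊆ B :=
          fun x hx => (hRs x (List.mem_toFinset.1 hx)).1
        have e3 := Finset.card_sdiff_add_card_eq_card e2
        rw [List.toFinset_card_of_nodup (List.nodup_append.1 hRn).2.1, List.length_map] at e3
        have e4 : B \ U ⊆ B \ (R.map Prod.snd).toFinset := by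
          intro x hx
          rw [Finset.mem_sdiff, mU] at hx
          rw [Finset.mem_sdiff, List.mem_toFinset]
          tauto
        have := Finset.card_le_card e4
        omega
      have e2 : A.card ≤ (A \ U).card + Z.card := by
        refine (Finset.card_le_card (show A ⊆ (A \ U) ∪ Z from fun x hx => ?_)).trans
          (Finset.card_union_le _ _)
        have f1 : x ∉ R.map Prod.fst := fun hx' =>
          Finset.disjoint_left.1 h.disjAD hx (hRf x hx').1
        have f2 : x ∉ R.map Prod.snd := fun hx' =>
          Finset.disjoint_left.1 h.disjAB hx (hRs x hx').1
        rw [Finset.mem_union, Finset.mem_sdiff, mU]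
        tauto
      have e3 : R.length ≤ lcount (fun p => p.1 ∉ Q') W := by
        rw [hW, lcount_append]
        refine le_trans (le_of_eq ?_) (Nat.le_add_left _ _)
        refine (List.countP_eq_length.2 fun p hp => ?_).symm
        have f1 := (hR p hp).1
        rw [Finset.mem_sdiff, mZ] at f1
        have f2 := hT.memD _ f1.1
        have : p.1 ∉ Q' := by
          rw [mQ]
          tauto
        simpa using this
      omega

/-- A digraph with a frame has a Hamilton cycle. -/
theorem Frame.hasHamiltonCycle {G : Digraph V} {A B C D : Finset V} {m w : ℕ}
    (h : G.Frame A B C D m w) : G.HasHamiltonCycle := by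
  obtain ⟨P, Q, hT⟩ := h.exists_typing
  rcases le_total Q.card P.card with hPQ | hPQ
  · exact h.hasHamiltonCycle_of_typing hT hPQ
  · exact hasHamiltonCycle_rev (h.rev.hasHamiltonCycle_of_typing hT.rev hPQ)

end FrameHamilton

end Digraph

namespace Digraph

/-! ### Deleting atypical vertices to obtain a frame -/

section Extremal

open Classical

variable {V : Type*} [Fintype V]

omit [Fintype V] in
lemma card_sel_mul_le (X : Finset V) (f : V → ℕ) (m : ℕ) :
    (sel X (fun x => m < f x)).card * m ≤ ∑ x ∈ X, f x := by
  refine le_trans ?_ (Finset.sum_le_sum_of_subset (sel_subset X (fun x => m < f x)))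
  rw [← smul_eq_mul]
  exact Finset.card_nsmul_le_sum _ _ _ fun x hx => (mem_sel.1 hx).2.le

omit [Fintype V] in
lemma nonEdges_eq_sum_left (G : Digraph V) (X Y : Finset V) :
    G.nonEdges X Y = ∑ x ∈ X, fcount Y (fun y => ¬ G.Adj x y) := by
  have e1 := G.edgeCount_add_nonEdges X Y
  have e2 : G.edgeCount X Y + ∑ x ∈ X, fcount Y (fun y => ¬ G.Adj x y) = X.card * Y.card := by
    rw [edgeCount_eq_sum_left, ← Finset.sum_add_distrib]
    simp only [fcount_add_not, Finset.sum_const, smul_eq_mul]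
  omega

omit [Fintype V] in
-- By Markov's inequality at most `q / m` vertices on each side miss more than `m` of the other
-- side. Deleting a larger set `Z'` can only lower the counts, so several such cleanings can be
-- combined.
lemma exists_near_sdiff (G : Digraph V) (X Y : Finset V) (m : ℕ) {q : ℝ}
    (hq : (X.card : ℝ) * Y.card - q ≤ G.edgeCount X Y) :
    ∃ Z : Finset V, (Z.card : ℝ) * m ≤ 2 * q ∧
      ∀ Z', Z ⊆ Z' → G.Near (X \ Z') (Y \ Z') m := by
  refine ⟨sel X (fun x => m < fcount Y (fun y => ¬ G.Adj x y)) ∪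
    sel Y (fun y => m < fcount X (fun x => ¬ G.Adj x y)), ?_, fun Z' hZ => ⟨?_, ?_⟩⟩
  · have e1 := card_sel_mul_le X (fun x => fcount Y (fun y => ¬ G.Adj x y)) m
    have e2 := card_sel_mul_le Y (fun y => fcount X (fun x => ¬ G.Adj x y)) m
    rw [← nonEdges_eq_sum_left] at e1
    have e3 := Nat.mul_le_mul_right m (Finset.card_union_le
      (sel X (fun x => m < fcount Y (fun y => ¬ G.Adj x y)))
      (sel Y (fun y => m < fcount X (fun x => ¬ G.Adj x y))))
    rw [add_mul] at e3
    have e4 := e3.trans (add_le_add e1 (show _ ≤ G.nonEdges X Y from e2))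
    have e5 : (G.edgeCount X Y : ℝ) + G.nonEdges X Y = X.card * Y.card := by
      exact_mod_cast G.edgeCount_add_nonEdges X Y
    have e6 : ((sel X (fun x => m < fcount Y (fun y => ¬ G.Adj x y)) ∪
      sel Y (fun y => m < fcount X (fun x => ¬ G.Adj x y))).card : ℝ) * m ≤
      G.nonEdges X Y + G.nonEdges X Y := by exact_mod_cast e4
    linarith
  · intro x hx
    rw [Finset.mem_sdiff] at hx
    refine (fcount_mono Finset.sdiff_subset _).trans (not_lt.1 fun hlt => hx.2 (hZ ?_))
    exact Finset.mem_union_left _ (mem_sel.2 ⟨hx.1, hlt⟩)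
  · intro y hy
    rw [Finset.mem_sdiff] at hy
    refine (fcount_mono Finset.sdiff_subset _).trans (not_lt.1 fun hlt => hy.2 (hZ ?_))
    exact Finset.mem_union_right _ (mem_sel.2 ⟨hy.1, hlt⟩)

omit [Fintype V] in
-- In an oriented graph, edges in the two directions at a vertex count different neighbours. Hence
-- the number of ordered nonadjacent pairs (diagonal included) is at most `2 * q`, and Markov's
-- inequality applies.
lemma IsOriented.exists_tournament_sdiff {G : Digraph V} (hG : G.IsOriented) (X : Finset V)
    (m : ℕ) {q : ℝ} (hq : (X.card : ℝ) ^ 2 / 2 - q ≤ G.edgeCount X X) :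
    ∃ Z : Finset V, (Z.card : ℝ) * m ≤ 2 * q ∧ ∀ Z', Z ⊆ Z' → ∀ x ∈ X \ Z',
      fcount (X \ Z') (fun y => ¬ (G.Adj x y ∨ G.Adj y x)) ≤ m := by
  refine ⟨sel X (fun x => m < fcount X (fun y => ¬ (G.Adj x y ∨ G.Adj y x))), ?_,
    fun Z' hZ x hx => ?_⟩
  · have e1 := card_sel_mul_le X (fun x => fcount X (fun y => ¬ (G.Adj x y ∨ G.Adj y x))) m
    have e2 : G.edgeCount X X + G.edgeCount X X +
        ∑ x ∈ X, fcount X (fun y => ¬ (G.Adj x y ∨ G.Adj y x)) ≤ X.card * X.card := by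
      nth_rewrite 1 [edgeCount_eq_sum_left]
      rw [edgeCount_eq_sum_right, ← Finset.sum_add_distrib, ← Finset.sum_add_distrib]
      refine (Finset.sum_le_sum (g := fun _ => X.card) fun x _ => ?_).trans (by simp)
      have f1 := fcount_add_not X (fun y => G.Adj x y ∨ G.Adj y x)
      have f2 : fcount X (fun y => G.Adj x y) + fcount X (fun y => G.Adj y x) ≤
          fcount X (fun y => G.Adj x y ∨ G.Adj y x) := by
        rw [← card_sel, ← card_sel, ← Finset.card_union_of_disjoint]
        · refine Finset.card_le_card fun y hy => ?_
          rw [Finset.mem_union, mem_sel, mem_sel] at hy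
          rw [mem_sel]
          tauto
        · refine Finset.disjoint_left.2 fun y hy hy' => ?_
          exact hG x y (mem_sel.1 hy).2 (mem_sel.1 hy').2
      omega
    have e3 : (G.edgeCount X X : ℝ) + G.edgeCount X X +
        (sel X (fun x => m < fcount X (fun y => ¬ (G.Adj x y ∨ G.Adj y x)))).card * m ≤
        X.card * X.card := by
      exact_mod_cast (Nat.add_le_add_left e1 _).trans e2
    nlinarith
  · rw [Finset.mem_sdiff] at hx
    refine (fcount_mono Finset.sdiff_subset _).trans (not_lt.1 fun hlt => hx.2 (hZ ?_))
    exact mem_sel.2 ⟨hx.1, hlt⟩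

omit [Fintype V] in
lemma card_sdiff_bounds {X Z : Finset V} {s : ℝ} (hZ : (Z.card : ℝ) ≤ s) :
    (X.card : ℝ) - s ≤ (X \ Z).card ∧ ((X \ Z).card : ℝ) ≤ X.card := by
  constructor
  · have e1 : X.card ≤ (X \ Z).card + Z.card := by
      refine (Finset.card_le_card (show X ⊆ (X \ Z) ∪ Z from fun x hx => ?_)).trans
        (Finset.card_union_le _ _)
      rw [Finset.mem_union, Finset.mem_sdiff]
      tauto
    have : (X.card : ℝ) ≤ (X \ Z).card + Z.card := by exact_mod_cast e1
    linarith
  · exact_mod_cast Finset.card_le_card (Finset.sdiff_subset (s := X) (t := Z))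

set_option maxHeartbeats 1000000 in
/-- Removing the atypical vertices from almost complete pairs and almost tournaments leaves
a frame. -/
lemma exists_frame_of_edgeCount {G : Digraph V} (hG : G.IsOriented) (hO : G.OreCondition)
    {n : ℝ} (hn : n = Fintype.card V)
    (hout : ∀ v, n / 100 ≤ G.outDeg v) (hin : ∀ v, n / 100 ≤ G.inDeg v)
    {A B C D : Finset V} (hAB : Disjoint A B) (hAC : Disjoint A C) (hAD : Disjoint A D)
    (hBC : Disjoint B C) (hBD : Disjoint B D) (hCD : Disjoint C D)
    {m w : ℕ} {q s r : ℝ} (hw1 : 1 ≤ w) (hwm : 3000 * w ≤ m) (hmn : m ≤ n / 1000)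
    (hwn : w ≤ n / 1000000000) (hqs : 14 * q ≤ s * m) (hsrw : 2 * s + r ≤ w)
    (hB : |(B.card : ℝ) - n / 4| ≤ r) (hD : |(D.card : ℝ) - n / 4| ≤ r)
    (hACc : |(A.card : ℝ) + C.card - n / 2| ≤ r) (hA : n / 4 - r ≤ A.card)
    (eAB : (A.card : ℝ) * B.card - q ≤ G.edgeCount A B)
    (eBC : (B.card : ℝ) * C.card - q ≤ G.edgeCount B C)
    (eCD : (C.card : ℝ) * D.card - q ≤ G.edgeCount C D)
    (eDA : (D.card : ℝ) * A.card - q ≤ G.edgeCount D A)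
    (eAA : (A.card : ℝ) ^ 2 / 2 - q ≤ G.edgeCount A A)
    (eCC : (C.card : ℝ) ^ 2 / 2 - q ≤ G.edgeCount C C)
    (eBD : n * A.card / 8 - r * n ≤ G.edgeCount B D)
    (eDB : n * C.card / 8 - r * n ≤ G.edgeCount D B)
    (hdich : (C = ∅ ∧ (B.card : ℝ) * D.card - q ≤ G.edgeCount B D) ∨
      1000 * (m : ℝ) + s ≤ C.card) (hs : 0 ≤ s) :
    ∃ A' B' C' D' : Finset V, G.Frame A' B' C' D' m w := by
  have hm : (0 : ℝ) < m := by exact_mod_cast (show 0 < m by omega)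
  have hw1R : (1 : ℝ) ≤ w := by exact_mod_cast hw1
  obtain ⟨Z₁, z1, n1⟩ := exists_near_sdiff G A B m eAB
  obtain ⟨Z₂, z2, n2⟩ := exists_near_sdiff G B C m eBC
  obtain ⟨Z₃, z3, n3⟩ := exists_near_sdiff G C D m eCD
  obtain ⟨Z₄, z4, n4⟩ := exists_near_sdiff G D A m eDA
  obtain ⟨Z₅, z5, n5⟩ := hG.exists_tournament_sdiff A m eAA
  obtain ⟨Z₆, z6, n6⟩ := hG.exists_tournament_sdiff C m eCC
  have hq0 : 0 ≤ q := by
    have : (0 : ℝ) ≤ Z₁.card * m := by positivity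
    linarith
  obtain ⟨Z₇, z7, n7⟩ : ∃ Z : Finset V, (Z.card : ℝ) * m ≤ 2 * q ∧ ∀ Z', Z ⊆ Z' →
      (C = ∅ ∧ G.Near (B \ Z') (D \ Z') m) ∨ 1000 * (m : ℝ) + s ≤ C.card := by
    rcases hdich with ⟨h1, h2⟩ | h1
    · obtain ⟨Z, z, n⟩ := exists_near_sdiff G B D m h2
      exact ⟨Z, z, fun Z' hZ' => Or.inl ⟨h1, n Z' hZ'⟩⟩
    · exact ⟨∅, by simpa using hq0, fun _ _ => Or.inr h1⟩
  -- Seven exceptional sets of size at most `2 * q / m`; this is the origin of the 14 in `hqs`.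
  set Z := Z₁ ∪ Z₂ ∪ Z₃ ∪ Z₄ ∪ Z₅ ∪ Z₆ ∪ Z₇ with hZ
  have hZc : (Z.card : ℝ) ≤ s := by
    have e1 : Z.card ≤ Z₁.card + Z₂.card + Z₃.card + Z₄.card + Z₅.card + Z₆.card + Z₇.card := by
      rw [hZ]
      repeat refine (Finset.card_union_le _ _).trans (Nat.add_le_add_right ?_ _)
      exact le_rfl
    have e2 : (Z.card : ℝ) ≤
        Z₁.card + Z₂.card + Z₃.card + Z₄.card + Z₅.card + Z₆.card + Z₇.card := by
      exact_mod_cast e1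
    have e3 := mul_le_mul_of_nonneg_right e2 hm.le
    refine le_of_mul_le_mul_right (a := (m : ℝ)) ?_ hm
    linarith
  have s1 : Z₁ ⊆ Z := fun x hx => by simp only [hZ, Finset.mem_union]; tauto
  have s2 : Z₂ ⊆ Z := fun x hx => by simp only [hZ, Finset.mem_union]; tauto
  have s3 : Z₃ ⊆ Z := fun x hx => by simp only [hZ, Finset.mem_union]; tauto
  have s4 : Z₄ ⊆ Z := fun x hx => by simp only [hZ, Finset.mem_union]; tauto
  have s5 : Z₅ ⊆ Z := fun x hx => by simp only [hZ, Finset.mem_union]; tauto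
  have s6 : Z₆ ⊆ Z := fun x hx => by simp only [hZ, Finset.mem_union]; tauto
  have s7 : Z₇ ⊆ Z := fun x hx => by simp only [hZ, Finset.mem_union]; tauto
  have sub : ∀ X : Finset V, X \ Z ⊆ X := fun X => Finset.sdiff_subset
  obtain ⟨cA, cA'⟩ := card_sdiff_bounds (X := A) hZc
  obtain ⟨cB, cB'⟩ := card_sdiff_bounds (X := B) hZc
  obtain ⟨cC, cC'⟩ := card_sdiff_bounds (X := C) hZc
  obtain ⟨cD, cD'⟩ := card_sdiff_bounds (X := D) hZc
  rw [abs_le] at hB hD hACc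
  have hn0 : 0 ≤ n := by rw [hn]; positivity
  have loss : (Z.card : ℝ) * (B.card + D.card) ≤ s * n :=
    mul_le_mul hZc (by linarith) (by positivity) hs
  have lBD : (G.edgeCount B D : ℝ) ≤ G.edgeCount (B \ Z) (D \ Z) + Z.card * (B.card + D.card) := by
    exact_mod_cast edgeCount_le_sdiff G B D Z
  have lDB : (G.edgeCount D B : ℝ) ≤ G.edgeCount (D \ Z) (B \ Z) + Z.card * (D.card + B.card) := by
    exact_mod_cast edgeCount_le_sdiff G D B Z
  have lw := mul_le_mul_of_nonneg_right (show s + r ≤ w by linarith) hn0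
  have lA := mul_le_mul_of_nonneg_left cA' hn0
  have lC := mul_le_mul_of_nonneg_left cC' hn0
  refine ⟨A \ Z, B \ Z, C \ Z, D \ Z,
    { oriented := hG
      ore := hO
      disjAB := hAB.mono (sub A) (sub B)
      disjAC := hAC.mono (sub A) (sub C)
      disjAD := hAD.mono (sub A) (sub D)
      disjBC := hBC.mono (sub B) (sub C)
      disjBD := hBD.mono (sub B) (sub D)
      disjCD := hCD.mono (sub C) (sub D)
      nearAB := n1 Z s1
      nearBC := n2 Z s2
      nearCD := n3 Z s3
      nearDA := n4 Z s4
      tourA := n5 Z s5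
      tourC := n6 Z s6
      dichotomy := ?_
      one_le := hw1
      w_le := hwm
      m_le := by rwa [← hn]
      w_small := by rwa [← hn]
      B_lower := by rw [← hn]; linarith
      B_upper := by rw [← hn]; linarith
      D_lower := by rw [← hn]; linarith
      D_upper := by rw [← hn]; linarith
      AC_lower := by rw [← hn]; linarith
      AC_upper := by rw [← hn]; linarith
      A_lower := by rw [← hn]; linarith
      edgesBD := by rw [← hn]; linarith
      edgesDB := by rw [← hn]; linarith
      outDeg_lower := by rwa [← hn]
      inDeg_lower := by rwa [← hn] }⟩
  rcases n7 Z s7 with ⟨h1, h2⟩ | h1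
  · exact Or.inl ⟨by rw [h1]; exact Finset.empty_sdiff _, h2⟩
  · right
    exact_mod_cast (show 1000 * (m : ℝ) ≤ (C \ Z).card by linarith)

end Extremal

end Digraph

namespace Digraph

/-! ### Linear minimum semidegrees of extremal graphs -/

section ExtremalHamilton

open Classical

variable {V : Type*} [Fintype V]

/-- Reversal exchanges A and C here, not B and D, because the sparse pairs AC and DD must be
preserved. -/
lemma IsExtremal.rev {G : Digraph V} {K η : ℝ} (h : G.IsExtremal K η) :
    G.rev.IsExtremal K η := by
  obtain ⟨A, B, C, D, ⟨dAB, dAC, dAD, dBC, dBD, dCD⟩, h1, h2, h3, h4, h5, h6, h7, h8, h9, h10, h11,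
    h12, h13⟩ := h
  refine ⟨C, B, A, D, ⟨dBC.symm, dAC.symm, dCD, dAB.symm, dBD, dAD⟩, ?_⟩
  simp only [edgeCount_rev]
  refine ⟨by rwa [add_comm], h2, h3, ?_, ?_, h7, h6, h9, h8, h11, h10, h12, h13⟩
  · rwa [mul_comm (C.card : ℝ)]
  · rwa [mul_comm (B.card : ℝ)]

lemma IsExtremal.mono {G : Digraph V} {K η ε : ℝ} (h : G.IsExtremal K η) (hε : K * η ≤ ε) :
    G.IsExtremal 1 ε := by
  obtain ⟨A, B, C, D, d, h1, h2, h3, h4, h5, h6, h7, h8, h9, h10, h11, h12, h13⟩ := h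
  have e1 : K * η * (Fintype.card V : ℝ) ≤ 1 * ε * (Fintype.card V : ℝ) := by
    rw [one_mul]
    exact mul_le_mul_of_nonneg_right hε (by positivity)
  have e2 : K * η * (Fintype.card V : ℝ) ^ 2 ≤ 1 * ε * (Fintype.card V : ℝ) ^ 2 := by
    rw [one_mul]
    exact mul_le_mul_of_nonneg_right hε (by positivity)
  refine ⟨A, B, C, D, d, ?_⟩
  refine ⟨h1.trans e1, h2.trans e1, h3.trans e1, ?_⟩
  refine ⟨?_, ?_, ?_, ?_, ?_, ?_, ?_, ?_, ?_, ?_⟩ <;> linarith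

/-- The outdegrees in D average about `a + c / 2`, at most about n/2, whereas a vertex of indegree
below n/100 would force almost all of them above 0.73n. -/
lemma min_degree_contradiction {n ε a b c d i x e₁ e₂ e₃ S : ℝ} (hn : 1000 ≤ n)
    (hε : ε ≤ 1 / 1000) (hb : b ≤ n / 4 + ε * n) (hd : d ≤ n / 4 + ε * n)
    (hd' : n / 4 - ε * n ≤ d) (hac : a + c ≤ n / 2 + ε * n) (hb0 : 0 ≤ b) (hd0 : 0 ≤ d)
    (ha0 : 0 ≤ a) (hc0 : 0 ≤ c) (he₁ : e₁ ≤ d * b - (a * n / 8 - ε * n ^ 2))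
    (he₂ : e₂ ≤ ε * n ^ 2) (he₃ : e₃ ≤ ε * n ^ 2)
    (hS : S ≤ d * a + e₁ + e₂ + e₃ + d * (3 * ε * n)) (hx : d - i - 1 ≤ x)
    (hS' : x * ((3 * n - 3) / 4 - i) ≤ S) (hi : i < n / 100) : False := by
  have e0 : ε * n ≤ n / 1000 := by nlinarith
  have e1 : ε * n ^ 2 ≤ n ^ 2 / 1000 := by nlinarith [sq_nonneg n]
  have f1 : 238 / 1000 * n * (739 / 1000 * n) ≤ x * ((3 * n - 3) / 4 - i) :=
    mul_le_mul (by linarith) (by linarith) (by linarith) (by linarith)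
  have f2 : d * b ≤ 251 / 1000 * n * (251 / 1000 * n) :=
    mul_le_mul (by linarith) (by linarith) hb0 (by linarith)
  have f3 : (d - n / 8) * a ≤ 126 / 1000 * n * (501 / 1000 * n) :=
    mul_le_mul (by linarith) (by linarith) ha0 (by linarith)
  have f4 : d * (3 * ε * n) ≤ 251 / 1000 * n * (3 * (n / 1000)) := by
    refine (mul_le_mul_of_nonneg_left (show 3 * ε * n ≤ 3 * (n / 1000) by linarith) hd0).trans ?_
    exact mul_le_mul_of_nonneg_right (by linarith) (by linarith)
  nlinarith [mul_pos (show 0 < n by linarith) (show 0 < n by linarith)]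

/-- A vertex of tiny indegree is missed by nearly all of D, so the Ore condition makes the
outdegrees in D large. But D sends few edges to C and D, and e(B, D) leaves it only about cn/8 edges
to B. -/
lemma IsExtremal.inDeg_lower {G : Digraph V} {ε : ℝ} (h : G.IsExtremal 1 ε)
    (hG : G.IsOriented) (hO : G.OreCondition) (hε : ε ≤ 1 / 1000)
    (hn : (1000 : ℝ) ≤ Fintype.card V) (y : V) : (Fintype.card V : ℝ) / 100 ≤ G.inDeg y := by
  obtain ⟨A, B, C, D, ⟨dAB, dAC, dAD, dBC, dBD, dCD⟩, h1, h2, h3, -, -, h6, -, h8, -, -, -,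
    -, h13⟩ := h
  set n : ℝ := (Fintype.card V : ℝ) with hnV
  rw [one_mul] at h1 h2 h3 h6 h8 h13
  rw [abs_le] at h1 h2 h3
  by_contra hcon
  push Not at hcon
  set E := outside A B C D with hE
  have hEc : (E.card : ℝ) ≤ 3 * ε * n := by
    have e1 := Finset.card_sdiff_add_card_eq_card (Finset.subset_univ (A ∪ B ∪ C ∪ D))
    rw [Finset.card_union_of_disjoint (Finset.disjoint_union_left.2
        ⟨Finset.disjoint_union_left.2 ⟨dAD, dBD⟩, dCD⟩),
      Finset.card_union_of_disjoint (Finset.disjoint_union_left.2 ⟨dAC, dBC⟩),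
      Finset.card_union_of_disjoint dAB, Finset.card_univ] at e1
    have e2 : (E.card : ℝ) + (A.card + B.card + C.card + D.card) = n := by
      rw [hnV]
      exact_mod_cast e1
    linarith
  have hS : ∑ x ∈ D, (G.outDeg x : ℝ) ≤ D.card * A.card + G.edgeCount D B + G.edgeCount D C +
      G.edgeCount D D + D.card * (3 * ε * n) := by
    refine le_trans ?_ (add_le_add_right (mul_le_mul_of_nonneg_left hEc (by positivity)) _)
    have : ∑ x ∈ D, G.outDeg x ≤ D.card * A.card + G.edgeCount D B + G.edgeCount D C +
      G.edgeCount D D + D.card * E.card := by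
      rw [edgeCount_eq_sum_left, edgeCount_eq_sum_left, edgeCount_eq_sum_left, ← smul_eq_mul,
        ← smul_eq_mul, ← Finset.sum_const, ← Finset.sum_const, ← Finset.sum_add_distrib,
        ← Finset.sum_add_distrib, ← Finset.sum_add_distrib, ← Finset.sum_add_distrib]
      refine Finset.sum_le_sum fun x _ => ?_
      have f1 := fcount_univ_le (A := A) (B := B) (C := C) (D := D) (fun y => G.Adj x y)
      rw [fcount_union dAB, fcount_union dCD, ← hE] at f1
      have f2 := fcount_le_card A (fun y => G.Adj x y)
      rw [outDeg_eq]
      omega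
    exact_mod_cast this
  set X := (sel D (fun x => ¬ G.Adj x y)).erase y with hX
  have hXc : (D.card : ℝ) - G.inDeg y - 1 ≤ X.card := by
    have f1 := fcount_add_not D (fun x => G.Adj x y)
    have f2 := fcount_mono (Finset.subset_univ D) (fun x => G.Adj x y)
    rw [← inDeg_eq] at f2
    have f3 := Finset.pred_card_le_card_erase (s := sel D (fun x => ¬ G.Adj x y)) (a := y)
    rw [card_sel, ← hX] at f3
    have f4 : (D.card : ℝ) ≤ X.card + 1 + G.inDeg y := by
      exact_mod_cast (show D.card ≤ X.card + 1 + G.inDeg y by omega)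
    linarith
  have hS' : (X.card : ℝ) * ((3 * n - 3) / 4 - G.inDeg y) ≤ ∑ x ∈ D, (G.outDeg x : ℝ) := by
    have f1 : X ⊆ D := (Finset.erase_subset _ _).trans (sel_subset _ _)
    refine le_trans ?_ (Finset.sum_le_sum_of_subset_of_nonneg f1 fun _ _ _ => by positivity)
    rw [← nsmul_eq_mul]
    refine Finset.card_nsmul_le_sum _ _ _ fun x hx => ?_
    rw [hX, Finset.mem_erase, mem_sel] at hx
    have := hO x y hx.1 hx.2.2
    linarith
  have g1 : (G.edgeCount D B : ℝ) + G.edgeCount B D ≤ D.card * B.card := by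
    exact_mod_cast hG.edgeCount_add_le D B
  have g2 : (G.edgeCount D C : ℝ) + G.edgeCount C D ≤ D.card * C.card := by
    exact_mod_cast hG.edgeCount_add_le D C
  exact min_degree_contradiction (n := n) (ε := ε) (a := A.card) (b := B.card) (c := C.card)
    (d := D.card) hn hε (by linarith) (by linarith) (by linarith) (by linarith) (by positivity)
    (by positivity) (by positivity) (by positivity) (show (G.edgeCount D B : ℝ) ≤ _ by linarith)
    (show (G.edgeCount D C : ℝ) ≤ _ by linarith) (show (G.edgeCount D D : ℝ) ≤ _ by linarith)
    hS hXc hS' hcon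

end ExtremalHamilton

end Digraph

namespace Digraph

/-! ### Choice of scales and conclusion -/

section ExtremalFrame

open Classical

variable {V : Type*} [Fintype V]

lemma exists_nat_near {x : ℝ} (hx : 0 ≤ x) : ∃ m : ℕ, (m : ℝ) ≤ x ∧ x - 1 ≤ m :=
  ⟨⌊x⌋₊, Nat.floor_le hx, (Nat.sub_one_lt_floor x).le⟩

/-- If C is tiny then `a` is about n/2, so e(B, D) is at least about n²/16, which is nearly all of
`b * d`. -/
lemma nonEdges_le_of_small {n ε κ a b c d e : ℝ} (hn : 0 ≤ n) (hε : 0 ≤ ε) (hκ : 10 * ε ≤ κ)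
    (hκ1 : κ ≤ 1 / 100) (hb : b ≤ n / 4 + ε * n) (hd : d ≤ n / 4 + ε * n) (hd0 : 0 ≤ d)
    (hac : n / 2 - ε * n ≤ a + c) (hc : c ≤ κ * n) (he : a * n / 8 - ε * n ^ 2 ≤ e) :
    b * d - κ * n ^ 2 ≤ e := by
  have e1 : b * d ≤ (n / 4 + ε * n) * (n / 4 + ε * n) :=
    mul_le_mul hb hd hd0 (by positivity)
  have e2 : (n / 2 - ε * n - κ * n) * n ≤ a * n := mul_le_mul_of_nonneg_right (by linarith) hn
  have e3 : 0 ≤ n * n := by positivity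
  have e4 : ε * (n * n) ≤ κ / 10 * (n * n) := mul_le_mul_of_nonneg_right (by linarith) e3
  have e5 : ε * (ε * (n * n)) ≤ 1 * (ε * (n * n)) :=
    mul_le_mul_of_nonneg_right (by linarith) (by positivity)
  nlinarith

set_option maxHeartbeats 1000000 in
/-- An extremal digraph with the larger part `A` has a Hamilton cycle. -/
lemma hasHamiltonCycle_of_parts {G : Digraph V} (hG : G.IsOriented) (hO : G.OreCondition)
    {n ε : ℝ} (hn : n = Fintype.card V) (hn0 : 10 ^ 30 ≤ n) (hε : ε = 1 / 10 ^ 45)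
    (hout : ∀ v, n / 100 ≤ G.outDeg v) (hin : ∀ v, n / 100 ≤ G.inDeg v)
    {A B C D : Finset V} (hAB : Disjoint A B) (hAC : Disjoint A C) (hAD : Disjoint A D)
    (hBC : Disjoint B C) (hBD : Disjoint B D) (hCD : Disjoint C D) (hCA : C.card ≤ A.card)
    (h1 : |(A.card : ℝ) + C.card - n / 2| ≤ ε * n) (h2 : |(B.card : ℝ) - n / 4| ≤ ε * n)
    (h3 : |(D.card : ℝ) - n / 4| ≤ ε * n)
    (h4 : (G.edgeCount A B : ℝ) > A.card * B.card - ε * n ^ 2)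
    (h5 : (G.edgeCount B C : ℝ) > B.card * C.card - ε * n ^ 2)
    (h6 : (G.edgeCount C D : ℝ) > C.card * D.card - ε * n ^ 2)
    (h7 : (G.edgeCount D A : ℝ) > A.card * D.card - ε * n ^ 2)
    (h8 : (G.edgeCount B D : ℝ) > A.card * n / 8 - ε * n ^ 2)
    (h9 : (G.edgeCount D B : ℝ) > C.card * n / 8 - ε * n ^ 2)
    (h10 : (G.edgeCount A A : ℝ) > (A.card : ℝ) ^ 2 / 2 - ε * n ^ 2)
    (h11 : (G.edgeCount C C : ℝ) > (C.card : ℝ) ^ 2 / 2 - ε * n ^ 2) :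
    G.HasHamiltonCycle := by
  have hCAr : (C.card : ℝ) ≤ A.card := by exact_mod_cast hCA
  have a1 := abs_le.1 h1
  have a2 := abs_le.1 h2
  have a3 := abs_le.1 h3
  have hεn : ε * n = n / 10 ^ 45 := by rw [hε]; ring
  have hn1 : (0 : ℝ) < n := lt_of_lt_of_le (by positivity) hn0
  have nn : 0 ≤ n ^ 2 := sq_nonneg n
  have pos : ∀ X Y, (0 : ℝ) ≤ G.edgeCount X Y := fun X Y => Nat.cast_nonneg _
  -- A tiny C cannot dominate the degree errors; its vertices then become outside vertices and the
  -- frame is built with C empty, on the coarse scales n/1000 for `m` and n/10⁹ for `w`.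
  by_cases hC : (C.card : ℝ) ≤ 1 / 10 ^ 15 * n
  · obtain ⟨m, m1, m2⟩ := exists_nat_near (show 0 ≤ n / 1000 by positivity)
    obtain ⟨w, w1, w2⟩ := exists_nat_near (show 0 ≤ n / 1000000000 by positivity)
    have key : (B.card : ℝ) * D.card - 1 / 10 ^ 15 * n ^ 2 ≤ G.edgeCount B D :=
      nonEdges_le_of_small (ε := ε) (a := A.card) (c := C.card) hn1.le
        (by rw [hε]; positivity) (by rw [hε]; norm_num) (by norm_num) (by linarith)
        (by linarith) (by positivity) (by linarith) hC h8.le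
    have hq : ε * n ^ 2 ≤ 1 / 10 ^ 15 * n ^ 2 :=
      mul_le_mul_of_nonneg_right (by rw [hε]; norm_num) (by positivity)
    have hs : n / 10 ^ 10 * (n / 1001) ≤ n / 10 ^ 10 * m :=
      mul_le_mul_of_nonneg_left (by linarith) (by positivity)
    have hr : ε * n ^ 2 ≤ 2 / 10 ^ 15 * n * n := by linarith
    obtain ⟨A', B', C', D', h⟩ := exists_frame_of_edgeCount (A := A) (B := B) (C := ∅) (D := D)
      hG hO hn hout hin hAB (Finset.disjoint_empty_right _) hAD (Finset.disjoint_empty_right _)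
      hBD (Finset.disjoint_empty_left _) (m := m) (w := w) (q := 1 / 10 ^ 15 * n ^ 2)
      (s := n / 10 ^ 10) (r := 2 / 10 ^ 15 * n)
      (by exact_mod_cast (show (1 : ℝ) ≤ w by linarith))
      (by exact_mod_cast (show 3000 * (w : ℝ) ≤ m by linarith))
      m1 w1 (by linarith) (by linarith)
      (abs_le.2 ⟨by linarith, by linarith⟩) (abs_le.2 ⟨by linarith, by linarith⟩)
      (abs_le.2 ⟨by rw [Finset.card_empty]; push_cast; linarith,
        by rw [Finset.card_empty]; push_cast; linarith⟩)
      (by linarith) (by linarith) (by rw [Finset.card_empty, Nat.cast_zero]; linarith [pos B ∅])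
      (by rw [Finset.card_empty, Nat.cast_zero]; linarith [pos ∅ D]) (by linarith) (by linarith)
      (by rw [Finset.card_empty, Nat.cast_zero]; linarith [pos ∅ ∅]) (by linarith)
      (by rw [Finset.card_empty, Nat.cast_zero]; linarith [pos D ∅]) (Or.inl ⟨rfl, key⟩) (by positivity)
    exact h.hasHamiltonCycle
  · push Not at hC
    -- The scale of `m` keeps `1000 * m` below `|C|`, and ε = 10⁻⁴⁵ is small enough that even so at
    -- most n/10²⁵ vertices are deleted, well below `w`.
    obtain ⟨m, m1, m2⟩ := exists_nat_near (show 0 ≤ 5 / 10 ^ 19 * n by positivity)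
    obtain ⟨w, w1, w2⟩ := exists_nat_near (show 0 ≤ (m : ℝ) / 3000 by positivity)
    have hm : 4 / 10 ^ 19 * n ≤ m := by linarith
    have hs : n / 10 ^ 25 * (4 / 10 ^ 19 * n) ≤ n / 10 ^ 25 * m :=
      mul_le_mul_of_nonneg_left hm (by positivity)
    have hr : ε * n ^ 2 = ε * n * n := by ring
    obtain ⟨A', B', C', D', h⟩ := exists_frame_of_edgeCount (A := A) (B := B) (C := C) (D := D)
      hG hO hn hout hin hAB hAC hAD hBC hBD hCD (m := m) (w := w) (q := ε * n ^ 2)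
      (s := n / 10 ^ 25) (r := ε * n)
      (by exact_mod_cast (show (1 : ℝ) ≤ w by linarith))
      (by exact_mod_cast (show 3000 * (w : ℝ) ≤ m by linarith))
      (by linarith) (by linarith) (by rw [hε]; linarith) (by linarith)
      h2 h3 h1 (by linarith) h4.le h5.le h6.le (by linarith) h10.le h11.le (by linarith)
      (by linarith) (Or.inr (by linarith)) (by positivity)
    exact h.hasHamiltonCycle

/-- Every sufficiently large extremal oriented graph with the Ore condition is Hamiltonian. -/
theorem IsExtremal.hasHamiltonCycle {G : Digraph V} (h : G.IsExtremal 1 (1 / 10 ^ 45))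
    (hG : G.IsOriented) (hO : G.OreCondition) (hn : (10 : ℝ) ^ 30 ≤ Fintype.card V) :
    G.HasHamiltonCycle := by
  have hn' : (1000 : ℝ) ≤ Fintype.card V := le_trans (by norm_num) hn
  have hin := h.inDeg_lower hG hO (by norm_num) hn'
  have hout := h.rev.inDeg_lower hG.rev hO.rev (by norm_num) hn'
  obtain ⟨A, B, C, D, ⟨dAB, dAC, dAD, dBC, dBD, dCD⟩, h1, h2, h3, h4, h5, h6, h7, h8, h9, h10, h11,
    -, -⟩ := h
  rw [one_mul] at h1 h2 h3 h4 h5 h6 h7 h8 h9 h10 h11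
  -- A frame needs A to have about n/4 vertices; reversal exchanges A and C, so A may be taken as
  -- the larger one.
  rcases le_total C.card A.card with hCA | hCA
  · exact hasHamiltonCycle_of_parts hG hO rfl hn rfl hout hin dAB dAC dAD dBC dBD dCD hCA h1 h2 h3
      h4 h5 h6 h7 h8 h9 h10 h11
  · refine hasHamiltonCycle_rev (hasHamiltonCycle_of_parts hG.rev hO.rev rfl hn rfl hin hout
      dBC.symm dAC.symm dCD dAB.symm dBD dAD hCA (by rwa [add_comm]) h2 h3 ?_ ?_ ?_ ?_ ?_ ?_ ?_ ?_)
      <;> rw [edgeCount_rev]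
    · rwa [mul_comm (C.card : ℝ)]
    · rwa [mul_comm (B.card : ℝ)]
    · exact h7
    · exact h6
    · exact h9
    · exact h8
    · exact h11
    · exact h10

end ExtremalFrame

end Digraph

/-- `0 < 1/n ≪ η ≪ 1` unfolds to: there is `η₀ > 0` such that for each `0 < η ≤ η₀` there is
`n₀` such that the claim holds for all `n ≥ n₀`. The constant `K` implied by the `O(η)`-terms in
the definition of `η`-extremal is arbitrary; `η₀` and `n₀` may depend on it. -/
theorem theorem1p6 (K : ℝ) (hK : 0 < K) :
    ∃ η₀ : ℝ, 0 < η₀ ∧ ∀ η : ℝ, 0 < η → η ≤ η₀ →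
      ∃ n₀ : ℕ, ∀ (V : Type*) [Fintype V] (G : Digraph V),
        n₀ ≤ Fintype.card V →
        G.IsOriented →
        G.OreCondition →
        G.IsExtremal K η →
        G.HasHamiltonCycle := by
  -- Extremality is monotone in the product `K * η`, so one fixed error 10⁻⁴⁵ suffices, and `n₀`
  -- depends on neither `K` nor `η`.
  refine ⟨1 / 10 ^ 45 / K, by positivity, fun η _ hη => ⟨10 ^ 30, fun V _ G hn hG hO hE => ?_⟩⟩
  refine (hE.mono ?_).hasHamiltonCycle hG hO (by exact_mod_cast hn)
  rwa [le_div_iff₀ hK, mul_comm] at hη
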